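/- Conventions. For an integrally closed Noetherian domain $A$, the divisor group of $A$ is the free abelian group on the height one primes of $A$, ordered coefficientwise; $D>E$ (equivalently $E<D$) means $D\ge E$ and $D\ne E$. For a finitely generated torsion $A$-module $N$ put $\mathrm{Div}(N)=\sum_{\mathfrak p}\mathrm{length}_{A_{\mathfrak p}}(N_{\mathfrak p})\,\mathfrak p$, the sum over the height one primes; $N$ is pseudo-null if $\mathrm{Div}(N)=0$. The divisor class group of $A$ is the quotient of the divisor group by the subgroup generated by the $\mathrm{Div}(A/(r))$ with $0\neq r\in A$. Let $p$ be a prime and $n\ge 1$. Let $\mathcal T$ and $\mathcal R$ be integrally closed domains that are finite extensions of $\mathbb Z_p[[u_1,\dots,u_n]]$ and $\mathbb Z_p[[v_1,\dots,v_{n-1}]]$ respectively. Let $\varpi:\mathcal T\to\mathcal R$ be a ring homomorphism such that $\ker\varpi$ is a prime ideal of height one and $\mathcal R$ is, via $\varpi$, the integral closure of $\mathcal T/\ker\varpi$ in its field of fractions. Let $\mathcal Y_1,\mathcal Y_2,\mathcal M$ be finitely generated torsion $\mathcal T$-modules such that: 1. $\ker\varpi$ is not in the support of $\mathcal Y_1$,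 $\mathcal Y_2$ or $\mathcal M$. 2. For every height two prime ideal $Q\supseteq\ker\varpi$ of $\mathcal T$ and $i=1,2$, the $\mathcal T_Q$-module $(\mathcal Y_i)_Q$ has no non-zero pseudo-null submodule and has finite projective dimension. 3. For every height two prime ideal $Q\supseteq\ker\varpi$ of $\mathcal T$ in the support of $\mathcal M$, the local ring $\mathcal T_Q$ is regular and the local domain $(\mathcal T/\ker\varpi)_Q$ is integrally closed. 4. $\mathrm{Div}(\mathcal Y_1)$ and $\mathrm{Div}(\mathcal Y_2)-\mathrm{Div}(\mathcal M)$ have finite order in the divisor class group of $\mathcal T$. Then $\mathcal Y_1\otimes_\varpi\mathcal R$, $\mathcal Y_2\otimes_\varpi\mathcal R$, $\mathcal M\otimes_\varpi\mathcal R$ and $\mathrm{Tor}_1^{\mathcal T}(\mathcal R,\mathcal M)$ are finitely generated torsion $\mathcal R$-modules (so that their divisors are defined). Moreover, let $\lhd\rhd$ denote either $>$ or $<$. If $$\mathrm{Div}(\mathcal Y_1)\ \lhd\rhd\ \mathrm{Div}(\mathcal Y_2)-\mathrm{Div}(\mathcal M)$$ in the divisor group of $\mathcal T$, then $$\mathrm{Div}(\mathcal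 Y_1\otimes_\varpi\mathcal R)\ \lhd\rhd\ \mathrm{Div}(\mathcal Y_2\otimes_\varpi\mathcal R)+\mathrm{Div}\big(\mathrm{Tor}_1^{\mathcal T}(\mathcal R,\mathcal M)\big)-\mathrm{Div}(\mathcal M\otimes_\varpi\mathcal R)$$ in the divisor group of $\mathcal R$, with the same choice of the symbol. -/

import Mathlib

open scoped TensorProduct

universe u v

namespace Specialization

/-- The set of height one prime ideals of `A`. -/
abbrev HeightOnePrime (A : Type u) [CommRing A] : Type u :=
  {P : PrimeSpectrum A // P.asIdeal.height = 1}

/-- The divisor group: the free abelian group on the height one primes, with the order in which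
`D ≤ E` means that each coefficient of `D` is at most that of `E`
(so `D < E` means `D ≤ E` and `D ≠ E`). -/
abbrev DivisorGroup (A : Type u) [CommRing A] : Type u :=
  HeightOnePrime A →₀ ℤ

/-- The multiplicity of `M` at `P`: the length of `M_P` over `A_P`. -/
noncomputable def localLength (A : Type u) [CommRing A] (M : Type v) [AddCommGroup M] [Module A M]
    (P : HeightOnePrime A) : ℤ :=
  ((Module.length (Localization.AtPrime P.1.asIdeal)
    (LocalizedModule P.1.asIdeal.primeCompl M)).toNat : ℤ)

open Classical in
/-- `Div(M) = ∑_P length_{A_P}(M_P) · P`. For a finitely generated torsion module over a Noetherian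
domain all the lengths are finite and the sum is finite (`length_ne_top`, `divisor_apply`), so the
default value `0` is not used there. -/
noncomputable def divisor (A : Type u) [CommRing A] (M : Type v) [AddCommGroup M] [Module A M] :
    DivisorGroup A :=
  if h : (Function.support (localLength A M)).Finite
  then Finsupp.ofSupportFinite (localLength A M) h else 0

/-- A finitely generated torsion module is pseudo-null if its divisor is zero. -/
structure IsPseudoNull (A : Type u) [CommRing A] (M : Type v) [AddCommGroup M] [Module A M] :
    Prop where
  finite : Module.Finite A M
  torsion : Module.IsTorsion A M
  divisor_eq_zero : divisor A M = 0

/-- The subgroup of principal divisors, generated by `Div(A/(r))` for `r ≠ 0`. -/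
noncomputable def principalDivisors (A : Type u) [CommRing A] : AddSubgroup (DivisorGroup A) :=
  AddSubgroup.closure {D | ∃ r : A, r ≠ 0 ∧ D = divisor A (A ⧸ Ideal.span {r})}

/-- The divisor class group. -/
abbrev DivisorClassGroup (A : Type u) [CommRing A] : Type u :=
  DivisorGroup A ⧸ principalDivisors A

/-- The class of a divisor in the divisor class group. -/
noncomputable def divisorClass (A : Type u) [CommRing A] (D : DivisorGroup A) :
    DivisorClassGroup A :=
  QuotientAddGroup.mk D

/-- The kernel of the structure map `T → R`, as a point of the spectrum of `T`. -/
def kerPrime (T R : Type u) [CommRing T] [CommRing R] [IsDomain R] [Algebra T R] :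
    PrimeSpectrum T :=
  ⟨RingHom.ker (algebraMap T R), RingHom.ker_isPrime _⟩

/-- `R` is, through the structure map `T → R`, the integral closure of `T / ker(T → R)`
(in the field of fractions of `T / ker(T → R)`). -/
def IsIntegralClosureOfImage (T R : Type u) [CommRing T] [CommRing R] [Algebra T R] : Prop :=
  ∃ e : R ≃+* integralClosure (T ⧸ RingHom.ker (algebraMap T R))
      (FractionRing (T ⧸ RingHom.ker (algebraMap T R))),
    ∀ t : T, (e (algebraMap T R t) : FractionRing (T ⧸ RingHom.ker (algebraMap T R))) =
      algebraMap (T ⧸ RingHom.ker (algebraMap T R)) _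
        (Ideal.Quotient.mk (RingHom.ker (algebraMap T R)) t)

/-- For every height two prime `Q ⊇ ker(T → R)`, the `T_Q`-module `N_Q` has no non-zero pseudo-null
submodules. -/
def NoPseudoNull (T R : Type u) [CommRing T] [CommRing R] [Algebra T R]
    (N : Type u) [AddCommGroup N] [Module T N] : Prop :=
  ∀ Q : PrimeSpectrum T, Q.asIdeal.height = 2 → RingHom.ker (algebraMap T R) ≤ Q.asIdeal →
    ∀ L : Submodule (Localization.AtPrime Q.asIdeal) (LocalizedModule Q.asIdeal.primeCompl N),
      IsPseudoNull (Localization.AtPrime Q.asIdeal) L → L = ⊥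

/-- For every height two prime `Q ⊇ ker(T → R)`, the `T_Q`-module `N_Q` has finite projective
dimension. -/
def FiniteProjDim (T R : Type u) [CommRing T] [CommRing R] [Algebra T R]
    (N : Type u) [AddCommGroup N] [Module T N] : Prop :=
  ∀ Q : PrimeSpectrum T, Q.asIdeal.height = 2 → RingHom.ker (algebraMap T R) ≤ Q.asIdeal →
    ∃ d : ℕ, CategoryTheory.HasProjectiveDimensionLE
      (ModuleCat.of (Localization.AtPrime Q.asIdeal) (LocalizedModule Q.asIdeal.primeCompl N)) d

/-- For every height two prime `Q ⊇ ker(T → R)` in the support of `M`, the local ring `T_Q` is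
regular and the local ring `(T / ker(T → R))_Q` is integrally closed. -/
def RegularAlong (T R : Type u) [CommRing T] [CommRing R] [Algebra T R]
    (M : Type u) [AddCommGroup M] [Module T M] : Prop :=
  ∀ Q : PrimeSpectrum T, Q.asIdeal.height = 2 → RingHom.ker (algebraMap T R) ≤ Q.asIdeal →
    Q ∈ Module.support T M →
      IsRegularLocalRing (Localization.AtPrime Q.asIdeal) ∧
      IsIntegrallyClosed (Localization
        (Q.asIdeal.primeCompl.map (Ideal.Quotient.mk (RingHom.ker (algebraMap T R)))))

instance extendScalars_additive {T R : Type u} [CommRing T] [CommRing R] (f : T →+* R) :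
    (ModuleCat.extendScalars.{u, u, u} f).Additive :=
  (ModuleCat.extendRestrictScalarsAdj.{u, u, u} f).left_adjoint_additive

/-- `Tor_1^T(R, M)` as an `R`-module: the first left derived functor of
`R ⊗_T - : Mod_T ⥤ Mod_R`, evaluated at `M`. -/
noncomputable abbrev TorOne (T R : Type u) [CommRing T] [CommRing R] [Algebra T R]
    (M : Type u) [AddCommGroup M] [Module T M] : Type u :=
  (((ModuleCat.extendScalars.{u, u, u} (algebraMap T R)).leftDerived 1).obj (ModuleCat.of T M) :
    ModuleCat.{u} R)

section WellDefined

variable {A : Type u} [CommRing A] [IsDomain A]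
  {M : Type v} [AddCommGroup M] [Module A M] [Module.Finite A M]

theorem annihilator_ne_bot (h : Module.IsTorsion A M) : Module.annihilator A M ≠ ⊥ := by
  obtain ⟨x, hx, hx0⟩ := Submodule.annihilator_top_inter_nonZeroDivisors h
  intro hbot
  have hx' : x ∈ Module.annihilator A M := by
    rwa [Submodule.annihilator_top] at hx
  rw [hbot] at hx'
  exact nonZeroDivisors.ne_zero hx0 (by simpa using hx')

theorem length_ne_top [IsNoetherianRing A] (h : Module.IsTorsion A M) (P : HeightOnePrime A) :
    Module.length (Localization.AtPrime P.1.asIdeal)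
      (LocalizedModule P.1.asIdeal.primeCompl M) ≠ ⊤ := by
  set B := Localization.AtPrime P.1.asIdeal
  set N := LocalizedModule P.1.asIdeal.primeCompl M
  obtain ⟨x, hx, hx0⟩ := Submodule.exists_mem_ne_zero_of_ne_bot (annihilator_ne_bot h)
  have hy0 : algebraMap A B x ≠ 0 := by
    simpa using (IsLocalization.injective B P.1.asIdeal.primeCompl_le_nonZeroDivisors).ne hx0
  have : Ring.KrullDimLE 1 B := by
    rw [Ring.KrullDimLE, Order.krullDimLE_iff]
    have := IsLocalization.AtPrime.ringKrullDim_eq_height P.1.asIdeal B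
    rw [ringKrullDim] at this
    rw [this, P.2]
    rfl
  have hfl := isFiniteLength_quotient_span_singleton B (mem_nonZeroDivisors_of_ne_zero hy0)
  rw [isFiniteLength_iff_isNoetherian_isArtinian] at hfl
  have hkill : ∀ m : N, algebraMap A B x • m = 0 := by
    intro m
    induction m using LocalizedModule.induction_on with
    | h m s =>
      rw [algebraMap_smul, LocalizedModule.smul'_mk, Module.mem_annihilator.1 hx,
        LocalizedModule.zero_mk]
  rw [Module.length_ne_top_iff, isFiniteLength_iff_isNoetherian_isArtinian]
  have : Module.Finite B N := inferInstance
  refine ⟨inferInstance, ?_⟩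
  obtain ⟨k, f, hf⟩ := Module.Finite.exists_fin' B N
  have := hfl.2
  let g : (Fin k → B ⧸ Ideal.span {algebraMap A B x}) →ₗ[B] N :=
    (LinearMap.lsum B (fun _ => B ⧸ Ideal.span {algebraMap A B x}) B) fun i =>
      Submodule.liftQ _ (LinearMap.toSpanSingleton B N (f (Pi.single i 1))) (by
        rw [Ideal.span, Submodule.span_le]
        rintro _ rfl
        simpa using hkill _)
  refine isArtinian_of_surjective _ g fun m => ?_
  obtain ⟨c, rfl⟩ := hf m
  refine ⟨fun i => Ideal.Quotient.mk _ (c i), ?_⟩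
  have : ∀ i, Submodule.liftQ (Ideal.span {algebraMap A B x})
      (LinearMap.toSpanSingleton B N (f (Pi.single i 1))) (by
        rw [Ideal.span, Submodule.span_le]
        rintro _ rfl
        simpa using hkill _) (Ideal.Quotient.mk _ (c i)) = c i • f (Pi.single i 1) :=
    fun i => rfl
  simp only [g, LinearMap.lsum_apply, LinearMap.sum_apply, LinearMap.comp_apply,
    LinearMap.proj_apply, this]
  rw [f.pi_apply_eq_sum_univ]
  refine Finset.sum_congr rfl fun i _ => ?_
  congr 2
  ext j
  simp [Pi.single_apply, eq_comm]

theorem finite_support_localLength [IsNoetherianRing A] (h : Module.IsTorsion A M) :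
    (Function.support (localLength A M)).Finite := by
  have hfin := (Module.annihilator A M).finite_minimalPrimes_of_isNoetherianRing
  refine Set.Finite.of_finite_image (f := fun P : HeightOnePrime A => P.1.asIdeal)
    (hfin.subset ?_) (fun P _ Q _ hPQ => Subtype.ext (PrimeSpectrum.ext hPQ))
  rintro _ ⟨P, hP, rfl⟩
  have hPs : P.1 ∈ Module.support A M := by
    by_contra hns
    have := Module.notMem_support_iff.1 hns
    exact hP (by simp [localLength, Module.length_eq_zero])
  refine ⟨⟨P.1.2, Module.annihilator_le_of_mem_support hPs⟩, fun J hJ hJP => ?_⟩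
  by_contra hlt
  have hJlt : J < P.1.asIdeal := lt_of_le_not_ge hJP hlt
  have := hJ.1
  have h1 : J.height < 1 := P.2 ▸ Ideal.height_strict_mono_of_isPrime hJlt
  rw [Order.lt_one_iff, Ideal.height_eq_zero_iff_eq_bot] at h1
  exact annihilator_ne_bot h (le_bot_iff.1 (h1 ▸ hJ.2))

theorem divisor_apply [IsNoetherianRing A] (h : Module.IsTorsion A M) (P : HeightOnePrime A) :
    divisor A M P = localLength A M P := by
  rw [divisor, dif_pos (finite_support_localLength h)]
  rfl

end WellDefined

end Specialization

/-! Fix a height one prime `P` of `R`, let `Q` be its contraction to `T`, and put `A = T_Q`, `B =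
R_P`. Here `Q` has height two (`height_comap_eq_two`), so `A` is a normal local domain of dimension
two, and `B` is a discrete valuation ring. The proof attaches to each module an element `θ` of `A`
that has the divisor of the module over `A` and whose order in `B` is the specialized multiplicity.

For `Y₁` and `Y₂` (`exists_divisor_of_finiteProjDim`): without pseudo-null submodules the localized
module has positive depth, and its projective dimension is finite, so the first syzygy of a free
cover is free by an Auslander-Buchsbaum argument (`IsRegularPair.free_of_hasProjectiveDimensionLE`).
As the module is torsion, this is a square presentation `φ`. Take `θ = det φ`. It computes lengths
at every height one prime of `A` and also, tensor products being right exact, the length over `B`.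

For `M` (`exists_divisor_of_regular`): on the support, `A` is regular and `A → B` is surjective with
kernel `(f)`. Divide `M_Q` by its largest submodule of finite length. The quotient has a square
presentation, giving `θ`. The submodule does not affect the divisor over `A`, and multiplication by
`f` on it has kernel and cokernel of the same length. Hence `ord_B θ` is the length of `B ⊗ M` minus
that of `Tor_1`, which explains the correction term.

Some multiple `N` of the positive difference of the two sides over `T` is the divisor of a nonunit
`c`. In the normal domain `A` elements with equal divisors are associates, and this survives in `B`
(`ordInt_eq_of_forall_height_one`). So `N` times the specialized difference is the divisor of the
image of `c` (`nsmul_divisor_specialization`). That image is nonzero because the kernel is outside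
all supports. It is a nonunit because `T` is local (`PowersLiftToIdempotents.isLocalRing`) and `R`
is integral over `T`. Its divisor is therefore positive, and so is the specialized difference. -/

namespace Specialization

/-! ### Height one primes of normal Noetherian domains -/

section NormalDomain

variable {A : Type*} [CommRing A] [IsDomain A] [IsNoetherianRing A] [IsIntegrallyClosed A]

open IsLocalRing in
/-- In a local normal Noetherian domain whose maximal ideal is an associated prime of a principal
ideal, the maximal ideal has height at most one. -/
theorem height_maximalIdeal_le_one_of_colon [IsLocalRing A] {a b : A} (ha : a ≠ 0)
    (hb : ¬ a ∣ b) (h : ∀ z ∈ maximalIdeal A, a ∣ z * b) : (maximalIdeal A).height ≤ 1 := by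
  choose! g hg using h
  -- Here `g z` is `(b / a) z`. If `b / a` maps the maximal ideal into itself, it is integral and so
  -- lies in `A`. Otherwise some `g z` is a unit and `z` generates the maximal ideal.
  by_cases hall : ∀ z ∈ maximalIdeal A, g z ∈ maximalIdeal A
  · exfalso
    let K := FractionRing A
    have ha' : algebraMap A K a ≠ 0 := by simpa using ha
    set x : K := algebraMap A K b / algebraMap A K a with hx
    have hxz : ∀ z ∈ maximalIdeal A, x * algebraMap A K z = algebraMap A K (g z) := by
      intro z hz
      rw [hx, div_mul_eq_mul_div, div_eq_iff ha', ← map_mul, ← map_mul, mul_comm b z, hg z hz,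
        mul_comm]
    by_cases hm : maximalIdeal A = ⊥
    · have hf : IsUnit a := by
        by_contra hu
        have : a ∈ maximalIdeal A := hu
        rw [hm] at this
        exact ha (by simpa using this)
      exact hb hf.dvd
    obtain ⟨w, hw, hw0⟩ := Submodule.exists_mem_ne_zero_of_ne_bot hm
    have hint : IsIntegral A x := by
      refine isIntegral_of_smul_mem_submodule
        (N := Submodule.map (Algebra.linearMap A K) (maximalIdeal A)) ?_ ?_ x ?_
      · intro hbot
        have : algebraMap A K w ∈ Submodule.map (Algebra.linearMap A K) (maximalIdeal A) :=
            ⟨w, hw, rfl⟩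
        rw [hbot, Submodule.mem_bot] at this
        exact hw0 (by simpa using this)
      · exact Submodule.FG.map _ (IsNoetherian.noetherian _)
      · rintro _ ⟨z, hz, rfl⟩
        exact ⟨g z, hall z hz, by simp [hxz z hz]⟩
    obtain ⟨c, hc⟩ := IsIntegrallyClosed.isIntegral_iff.1 hint
    refine hb ⟨c, ?_⟩
    apply IsFractionRing.injective A K
    rw [map_mul, hc, hx, mul_div_cancel₀ _ ha']
  · push Not at hall
    obtain ⟨z, hz, hgz⟩ := hall
    have hu : IsUnit (g z) := by simpa using hgz
    have hspan : maximalIdeal A = Ideal.span {z} := by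
      refine le_antisymm (fun w hw => ?_) (by simpa [Ideal.span_le] using hz)
      rw [Ideal.mem_span_singleton]
      have hb0 : b ≠ 0 := fun h => hb (by simp [h])
      have : w * g z = z * g w := by
        apply mul_left_cancel₀ ha
        apply mul_left_cancel₀ hb0
        calc b * (a * (w * g z)) = (a * g z) * (w * b) := by ring
          _ = (z * b) * (a * g w) := by rw [← hg z hz, hg w hw]
          _ = b * (a * (z * g w)) := by ring
      exact (hu.dvd_mul_right).1 ⟨g w, this⟩
    have : (maximalIdeal A).IsPrincipal := ⟨z, hspan⟩
    exact Ideal.height_le_one_of_isPrincipal_of_mem_minimalPrimes (maximalIdeal A) _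
      ⟨⟨inferInstance, le_rfl⟩, fun _ h _ => h.2⟩

/-- The associated primes of a nonzero principal ideal of a normal Noetherian domain have height
at most one. -/
theorem height_le_one_of_isAssociatedPrime {a : A} (ha : a ≠ 0) {q : Ideal A}
    (hq : IsAssociatedPrime q (A ⧸ Ideal.span {a})) : q.height ≤ 1 := by
  have := hq.isPrime
  obtain ⟨_, x, hx⟩ := isAssociatedPrime_iff.1 hq
  obtain ⟨b, rfl⟩ := Ideal.Quotient.mk_surjective x
  have hmem : ∀ z, z ∈ q ↔ a ∣ z * b := by
    intro z
    rw [hx, Submodule.mem_colon_singleton,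
        Submodule.mem_bot, ← Ideal.mem_span_singleton, ← Ideal.Quotient.eq_zero_iff_mem]
    rfl
  let L := Localization.AtPrime q
  have hL : IsIntegrallyClosed L :=
    isIntegrallyClosed_of_isLocalization L q.primeCompl q.primeCompl_le_nonZeroDivisors
  have hNL : IsNoetherianRing L := IsLocalization.isNoetherianRing q.primeCompl L inferInstance
  have hinj : Function.Injective (algebraMap A L) :=
    IsLocalization.injective L q.primeCompl_le_nonZeroDivisors
  have key := height_maximalIdeal_le_one_of_colon (A := L) (a := algebraMap A L a)
    (b := algebraMap A L b) (by simpa using hinj.ne ha) ?_ ?_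
  · have h := IsLocalization.AtPrime.ringKrullDim_eq_height q L
    rw [← IsLocalRing.maximalIdeal_height_eq_ringKrullDim] at h
    rwa [← WithBot.coe_inj.1 h]
  · rintro ⟨c, hc⟩
    obtain ⟨⟨c, s⟩, hcs⟩ := IsLocalization.surj q.primeCompl c
    simp only at hcs
    refine s.2 ((hmem s).2 ⟨c, hinj ?_⟩)
    rw [map_mul, map_mul, hc, ← hcs]
    ring
  · intro z hz
    obtain ⟨z, s, rfl⟩ := IsLocalization.exists_mk'_eq q.primeCompl z
    have hzq : z ∈ q := by
      rwa [IsLocalization.AtPrime.mk'_mem_maximal_iff L q] at hz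
    obtain ⟨c, hc⟩ := (hmem z).1 hzq
    refine ⟨IsLocalization.mk' L c s, ?_⟩
    rw [← IsLocalization.mk'_one (M := q.primeCompl) L b,
      ← IsLocalization.mk'_one (M := q.primeCompl) L a, ← IsLocalization.mk'_mul,
      ← IsLocalization.mk'_mul, hc, mul_comm s 1]

/-- Divisibility in a normal Noetherian domain can be tested at the primes of height one. -/
theorem dvd_of_forall_height_one {a b : A} (ha : a ≠ 0)
    (h : ∀ (q : Ideal A) [q.IsPrime], q.height = 1 →
      algebraMap A (Localization.AtPrime q) a ∣ algebraMap A (Localization.AtPrime q) b) :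
    a ∣ b := by
  by_contra hab
  have hne : (Ideal.Quotient.mk (Ideal.span {a}) b) ≠ 0 := by
    rwa [Ne, Ideal.Quotient.eq_zero_iff_mem, Ideal.mem_span_singleton]
  -- The annihilator of the class of `b` lies in an associated prime `q` of `A ⧸ (a)`, necessarily
  -- of height one. Divisibility at `q` produces an annihilating element outside `q`.
  obtain ⟨q, hq, hle⟩ := exists_le_isAssociatedPrime_of_isNoetherianRing A _ hne
  have hqp := hq.isPrime
  have haq : a ∈ q := hle (by
    rw [Submodule.mem_colon_singleton, Submodule.mem_bot]
    change Ideal.Quotient.mk _ (a * b) = 0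
    rw [Ideal.Quotient.eq_zero_iff_mem]
    exact Ideal.mul_mem_right _ _ (Ideal.mem_span_singleton_self a))
  have h1 : q.height = 1 := by
    refine le_antisymm (height_le_one_of_isAssociatedPrime ha hq) ?_
    rw [Order.one_le_iff_ne_zero, Ne, Ideal.height_eq_zero_iff_eq_bot]
    rintro rfl
    exact ha (by simpa using haq)
  obtain ⟨c, hc⟩ := h q h1
  obtain ⟨⟨c, s⟩, hcs⟩ := IsLocalization.surj q.primeCompl c
  simp only at hcs
  refine s.2 (hle ?_)
  rw [Submodule.mem_colon_singleton, Submodule.mem_bot]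
  change Ideal.Quotient.mk _ ((s : A) * b) = 0
  rw [Ideal.Quotient.eq_zero_iff_mem, Ideal.mem_span_singleton]
  refine ⟨c, IsLocalization.injective (Localization.AtPrime q) q.primeCompl_le_nonZeroDivisors ?_⟩
  rw [map_mul, map_mul, hc, ← hcs]
  ring

/-- The localization of a normal Noetherian domain at a prime of height one is a discrete valuation
ring. -/
theorem isDiscreteValuationRing_of_height_eq_one (q : Ideal A) [q.IsPrime] (h : q.height = 1)
    (L : Type*) [CommRing L] [IsDomain L] [Algebra A L] [IsLocalization.AtPrime L q] :
    IsDiscreteValuationRing L := by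
  have hL : IsIntegrallyClosed L :=
    isIntegrallyClosed_of_isLocalization L q.primeCompl q.primeCompl_le_nonZeroDivisors
  have hNL : IsNoetherianRing L := IsLocalization.isNoetherianRing q.primeCompl L inferInstance
  have := IsLocalization.AtPrime.isLocalRing L q
  have hdim := IsLocalization.AtPrime.ringKrullDim_eq_height q L
  rw [h] at hdim
  have hnf : ¬ IsField L := fun hf => by
    rw [ringKrullDim_eq_zero_of_isField hf] at hdim
    exact zero_ne_one (WithBot.coe_inj.1 hdim)
  refine ((IsDiscreteValuationRing.TFAE L hnf).out 2 0).1 ?_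
  have : Ring.KrullDimLE 1 L := by
    rw [Ring.krullDimLE_iff, hdim]
    rfl
  have : Ring.DimensionLEOne L := ⟨fun hp _ => Ideal.isMaximal_of_isPrime_of_ne_bot _ hp⟩
  exact { }

end NormalDomain

/-! ### Depth two, free syzygies and square presentations -/

section FreeCriterion

/-- `x, y` is a weakly regular sequence on `K`. -/
structure IsRegularPair {A : Type*} [CommRing A] (x y : A) (K : Type*) [AddCommGroup K]
    [Module A K] : Prop where
  eq_zero_of_smul : ∀ k : K, x • k = 0 → k = 0
  exists_of_smul : ∀ k k' : K, y • k = x • k' → ∃ k'', k = x • k''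

variable {A : Type u} [CommRing A] {x y : A}

theorem IsRegularPair.pi (h : IsRegularPair x y A) (m : ℕ) : IsRegularPair x y (Fin m → A) where
  eq_zero_of_smul k hk := by
    ext i
    exact h.eq_zero_of_smul _ (congrFun hk i)
  exists_of_smul k k' hk := by
    choose g hg using fun i => h.exists_of_smul (k i) (k' i) (congrFun hk i)
    exact ⟨g, funext hg⟩

/-- The depth lemma for a first syzygy: writing `k = x • f` in `F`, the image `π f` is killed by `x`
and, after cancelling `x`, by `y`. So `K` only needs depth one. -/
theorem IsRegularPair.ker {F K : Type*} [AddCommGroup F] [Module A F] [AddCommGroup K] [Module A K]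
    (hF : IsRegularPair x y F) (π : F →ₗ[A] K)
    (hK : ∀ k : K, x • k = 0 → y • k = 0 → k = 0) : IsRegularPair x y (LinearMap.ker π) where
  eq_zero_of_smul k hk := Subtype.ext (hF.eq_zero_of_smul _ (congrArg Subtype.val hk))
  exists_of_smul k k' hk := by
    obtain ⟨f, hf⟩ := hF.exists_of_smul _ _ (congrArg Subtype.val hk)
    have hx : x • π f = 0 := by rw [← map_smul, ← hf]; exact k.2
    have hyf : y • f = k' := by
      rw [← sub_eq_zero]
      apply hF.eq_zero_of_smul
      have : y • (k : F) = x • (k' : F) := congrArg Subtype.val hk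
      rw [smul_sub, ← this, hf, smul_comm, sub_self]
    have hy : y • π f = 0 := by rw [← map_smul, hyf]; exact k'.2
    exact ⟨⟨f, hK _ hx hy⟩, Subtype.ext hf⟩

/-- This is the vanishing of the first Koszul homology of `K`: `(x, y)F` meets the kernel in `(x,
y)` times the kernel. The pair `(a, b)` is corrected by a Koszul relation `(y • c, -x • c)`. -/
theorem IsRegularPair.exists_mem_ker {F K : Type*} [AddCommGroup F] [Module A F] [AddCommGroup K]
    [Module A K] (hK : IsRegularPair x y K) (π : F →ₗ[A] K) (hπ : Function.Surjective π)
    (a b : F) (h : x • a + y • b ∈ LinearMap.ker π) :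
    ∃ a' ∈ LinearMap.ker π, ∃ b' ∈ LinearMap.ker π, x • a + y • b = x • a' + y • b' := by
  have h1 : y • π b = x • (- π a) := by
    rw [LinearMap.mem_ker, map_add, map_smul, map_smul] at h
    rw [smul_neg, eq_neg_iff_add_eq_zero, add_comm, h]
  obtain ⟨k, hk⟩ := hK.exists_of_smul _ _ h1
  obtain ⟨c, rfl⟩ := hπ k
  have h2 : π a = - (y • π c) := by
    rw [eq_neg_iff_add_eq_zero]
    apply hK.eq_zero_of_smul
    rw [smul_add, smul_comm, ← hk, h1, smul_neg, add_neg_cancel]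
  refine ⟨a + y • c, by simp [h2], b - x • c, by simp [hk], ?_⟩
  rw [smul_add, smul_sub, smul_comm x y c]
  abel

/-- A finitely generated module over a local ring has a minimal cover by a free module. -/
theorem exists_minimal_cover [IsLocalRing A] (K : Type*) [AddCommGroup K] [Module A K]
    [Module.Finite A K] : ∃ (m : ℕ) (π : (Fin m → A) →ₗ[A] K), Function.Surjective π ∧
      ∀ v ∈ LinearMap.ker π, ∀ i, v i ∈ IsLocalRing.maximalIdeal A := by
  classical
  have hex := Module.Finite.exists_fin' A K
  obtain ⟨π, hπ⟩ := Nat.find_spec hex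
  refine ⟨Nat.find hex, π, hπ, fun v hv i => ?_⟩
  -- The number of generators is minimal, whereas a relation with a unit coefficient would make the
  -- corresponding generator redundant.
  by_contra hu
  have hu : IsUnit (v i) := by simpa using hu
  have hmin := fun j => Nat.find_min hex (m := j)
  generalize Nat.find hex = m at *
  obtain _ | m := m
  · exact i.elim0
  refine hmin m (Nat.lt_succ_self m)
    ⟨π ∘ₗ Function.ExtendByZero.linearMap A i.succAbove, fun k => ?_⟩
  obtain ⟨w, rfl⟩ := hπ k
  obtain ⟨c, hc⟩ := hu.exists_right_inv
  refine ⟨fun j => (w - (w i * c) • v) (i.succAbove j), ?_⟩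
  have hext : Function.ExtendByZero.linearMap A i.succAbove
      (fun j => (w - (w i * c) • v) (i.succAbove j)) = w - (w i * c) • v := by
    ext j
    rw [Function.ExtendByZero.linearMap_apply]
    rcases Fin.eq_self_or_eq_succAbove i j with rfl | ⟨j, rfl⟩
    · rw [Function.extend_apply']
      · simp only [Pi.zero_apply, Pi.sub_apply, Pi.smul_apply, smul_eq_mul]
        linear_combination (w j) * hc
      · rintro ⟨l, hl⟩
        exact Fin.succAbove_ne _ _ hl
    · rw [Fin.succAbove_right_injective.extend_apply]
  rw [LinearMap.comp_apply, hext, map_sub, map_smul, LinearMap.mem_ker.1 hv, smul_zero, sub_zero]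

/-- Over a local ring with maximal ideal `(x, y)`, a finitely generated module on which
`x, y` is weakly regular is free. -/
theorem IsRegularPair.free_of_maximalIdeal_eq [IsLocalRing A] [IsNoetherianRing A]
    (hm : IsLocalRing.maximalIdeal A = Ideal.span {x, y}) {K : Type*} [AddCommGroup K] [Module A K]
    [Module.Finite A K] (hK : IsRegularPair x y K) : Module.Free A K := by
  obtain ⟨m, π, hπ, hker⟩ := exists_minimal_cover (A := A) K
  suffices LinearMap.ker π = ⊥ from
    Module.Free.of_equiv (LinearEquiv.ofBijective π ⟨LinearMap.ker_eq_bot.1 this, hπ⟩)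
  -- Nakayama: by minimality the kernel lies in `(x, y)F`, hence in `(x, y)` times itself.
  refine Submodule.eq_bot_of_le_smul_of_le_jacobson_bot (IsLocalRing.maximalIdeal A) _
    (IsNoetherian.noetherian _) (fun v hv => ?_) (IsLocalRing.maximalIdeal_le_jacobson _)
  choose a b hab using fun i => Ideal.mem_span_pair.1 (hm ▸ hker v hv i)
  have hv' : v = x • a + y • b := by
    ext i
    simp [← hab i, mul_comm]
  rw [hv'] at hv ⊢
  obtain ⟨a', ha', b', hb', h⟩ := hK.exists_mem_ker π hπ a b hv
  rw [h]
  exact Submodule.add_mem _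
    (Submodule.smul_mem_smul (hm ▸ Ideal.subset_span (by simp)) ha')
    (Submodule.smul_mem_smul (hm ▸ Ideal.subset_span (by simp)) hb')

/-- A finitely generated module of finite projective dimension over a local ring of depth two,
on which the regular sequence `x, y` is weakly regular, is free. -/
theorem IsRegularPair.free_of_hasProjectiveDimensionLE [IsLocalRing A] [IsNoetherianRing A]
    (hA : IsRegularPair x y A) {s : A} (hs : s ∉ Ideal.span {x, y})
    (hsm : ∀ z ∈ IsLocalRing.maximalIdeal A, s * z ∈ Ideal.span {x, y}) (d : ℕ)
    (K : Type u) [AddCommGroup K] [Module A K] [Module.Finite A K] (hK : IsRegularPair x y K)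
    (hd : CategoryTheory.HasProjectiveDimensionLE (ModuleCat.of A K) d) : Module.Free A K := by
  induction d generalizing K with
  | zero =>
    simp only [CategoryTheory.HasProjectiveDimensionLE, zero_add] at hd
    rw [← CategoryTheory.projective_iff_hasProjectiveDimensionLT_one,
      ← IsProjective.iff_projective] at hd
    exact Module.free_of_flat_of_isLocalRing
  | succ d ih =>
    obtain ⟨m, π, hπ, hker⟩ := exists_minimal_cover (A := A) K
    have hfree : Module.Free A (LinearMap.ker π) := by
      -- The syzygy is again weakly regular for `x, y`, with projective dimension smaller by one.
      refine ih _ ((hA.pi m).ker π fun k hk _ => hK.eq_zero_of_smul k hk) ?_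
      have hS := LinearMap.shortExact_shortComplexKer hπ
      have hproj : CategoryTheory.Projective (ModuleCat.of A (Fin m → A)) :=
        (IsProjective.iff_projective _).1 inferInstance
      exact (hS.hasProjectiveDimensionLT_X₃_iff d hproj).1 hd
    suffices LinearMap.ker π = ⊥ from
      Module.Free.of_equiv (LinearEquiv.ofBijective π ⟨LinearMap.ker_eq_bot.1 this, hπ⟩)
    by_contra hne
    have : Nontrivial (LinearMap.ker π) := Submodule.nontrivial_iff_ne_bot.2 hne
    let b := Module.Free.chooseBasis A (LinearMap.ker π)
    obtain ⟨i⟩ : Nonempty (Module.Free.ChooseBasisIndex A (LinearMap.ker π)) := b.index_nonempty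
    -- A basis vector of the kernel has coordinates in the maximal ideal, so `s` times it lies in
    -- `(x, y)F` and hence in `(x, y)` times the kernel. Its own coordinate then gives `s ∈ (x, y)`.
    choose f g hfg using fun j =>
      Ideal.mem_span_pair.1 (hsm _ (hker (b i : Fin m → A) (b i).2 j))
    have he : s • (b i : Fin m → A) = x • f + y • g := by
      ext j
      simp [← hfg j, mul_comm]
    obtain ⟨f', hf', g', hg', h⟩ := hK.exists_mem_ker π hπ f g
      (he ▸ Submodule.smul_mem _ _ (b i).2)
    have he' : s • b i = x • (⟨f', hf'⟩ : LinearMap.ker π) + y • (⟨g', hg'⟩ : LinearMap.ker π) :=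
      Subtype.ext (he.trans h)
    apply hs
    have := congrArg (fun z => b.repr z i) he'
    simp only [map_smul, map_add, Module.Basis.repr_self, Finsupp.smul_apply, Finsupp.add_apply,
      Finsupp.single_eq_same, smul_eq_mul, mul_one] at this
    rw [this]
    exact Ideal.mem_span_pair.2 ⟨b.repr ⟨f', hf'⟩ i, b.repr ⟨g', hg'⟩ i, by ring⟩

/-- A square presentation of a torsion module, from a free first syzygy. -/
theorem exists_square_presentation [IsDomain A] [IsNoetherianRing A] {Y : Type*} [AddCommGroup Y]
    [Module A Y] {a : A} (ha : a ≠ 0) (haY : ∀ z : Y, a • z = 0) {m : ℕ}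
    (π : (Fin m → A) →ₗ[A] Y) (hfree : Module.Free A (LinearMap.ker π)) :
    ∃ φ : (Fin m → A) →ₗ[A] (Fin m → A), Function.Exact φ π := by
  -- The kernel contains `a` times the free module, so it has full rank.
  have hrank : Module.finrank A (LinearMap.ker π) = m := by
    refine le_antisymm ((Submodule.finrank_le _).trans (by simp)) ?_
    let g : (Fin m → A) →ₗ[A] LinearMap.ker π :=
      (LinearMap.lsmul A (Fin m → A) a).codRestrict _ fun v => by simp [haY]
    have hg : Function.Injective g := fun v w h => by
      have : a • v = a • w := congrArg Subtype.val h
      exact smul_right_injective _ ha this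
    simpa using LinearMap.finrank_le_finrank_of_injective hg
  let e : (Fin m → A) ≃ₗ[A] LinearMap.ker π :=
    LinearEquiv.ofFinrankEq _ _ (by rw [hrank]; simp)
  refine ⟨(LinearMap.ker π).subtype ∘ₗ e.toLinearMap, fun v => ⟨fun h => ?_, ?_⟩⟩
  · exact ⟨e.symm ⟨v, h⟩, by simp⟩
  · rintro ⟨w, rfl⟩
    exact (e w).2

end FreeCriterion

/-! ### Regular sequences in two-dimensional normal local domains -/

section RegularPair

open IsLocalRing

variable {A : Type u} [CommRing A] [IsDomain A] [IsNoetherianRing A] [IsIntegrallyClosed A]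
  [IsLocalRing A]

/-- A two-dimensional normal local domain has a regular sequence of length two in its maximal
ideal. -/
theorem exists_isRegularPair (hA : (maximalIdeal A).height = 2) :
    ∃ x y : A, IsRegularPair x y A ∧
      (∀ q : Ideal A, q.IsPrime → x ∈ q → y ∈ q → q = maximalIdeal A) ∧
      ∃ s ∉ Ideal.span {x, y}, ∀ z ∈ maximalIdeal A, s * z ∈ Ideal.span {x, y} := by
  have hbot : maximalIdeal A ≠ ⊥ := by
    intro h
    rw [h, Ideal.height_bot] at hA
    exact absurd hA (by norm_num)
  obtain ⟨x, hx, hx0⟩ := Submodule.exists_mem_ne_zero_of_ne_bot hbot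
  have hfin := (Ideal.span {x}).finite_minimalPrimes_of_isNoetherianRing
  have hle1 : ∀ q ∈ (Ideal.span {x}).minimalPrimes, q.height ≤ 1 := fun q hq =>
    Ideal.height_le_one_of_isPrincipal_of_mem_minimalPrimes _ q hq
  -- Prime avoidance: these finitely many primes have height at most one, the maximal ideal has
  -- height two.
  obtain ⟨y, hy, hyq⟩ : ∃ y ∈ maximalIdeal A, ∀ q ∈ (Ideal.span {x}).minimalPrimes, y ∉ q := by
    by_contra hcon
    push Not at hcon
    have hsub : (maximalIdeal A : Set A) ⊆ ⋃ q ∈ hfin.toFinset, (q : Set A) := by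
      intro y hy
      obtain ⟨q, hq, hyq⟩ := hcon y hy
      simp only [Set.Finite.mem_toFinset, Set.mem_iUnion]
      exact ⟨q, hq, hyq⟩
    obtain ⟨q, hq, hle⟩ := (Ideal.subset_union_prime (s := hfin.toFinset) (f := id) ⊥ ⊥
      (fun q hq _ _ => (hfin.mem_toFinset.1 hq).1.1)).1 hsub
    have hq' := hfin.mem_toFinset.1 hq
    have := (Ideal.height_mono hle).trans (hle1 q hq')
    rw [hA] at this
    exact absurd this (by decide)
  have hmem : ∀ q : Ideal A, q.IsPrime → x ∈ q → q.height ≤ 1 → 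
      q ∈ (Ideal.span {x}).minimalPrimes := by
    intro q hq hxq hq1
    have hxq' : Ideal.span {x} ≤ q := by simpa [Ideal.span_le] using hxq
    refine Ideal.mem_minimalPrimes_of_height_le hxq' (hq1.trans ?_)
    exact Ideal.one_le_height_span_singleton_of_mem_nonZeroDivisors 
      (mem_nonZeroDivisors_of_ne_zero hx0)
  have hprime : ∀ q : Ideal A, q.IsPrime → x ∈ q → y ∈ q → q = maximalIdeal A := by
    intro q hq hxq hyq'
    by_contra hne
    have hlt : q < maximalIdeal A := lt_of_le_of_ne (le_maximalIdeal hq.ne_top) hne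
    have h2 := Ideal.height_strict_mono_of_isPrime hlt
    rw [hA] at h2
    exact hyq q (hmem q hq hxq (Order.le_of_lt_add_one (by rw [one_add_one_eq_two]; exact h2))) hyq'
  refine ⟨x, y, ⟨fun k hk => (mul_eq_zero.1 hk).resolve_left hx0, fun k k' hk => ?_⟩, hprime, ?_⟩
  -- Serre's condition: at each height one prime either `x` or `y` is a unit, so `x ∣ y * k` yields
  -- `x ∣ k` there.
  · refine dvd_of_forall_height_one hx0 fun q _ hq => ?_
    by_cases hxq : x ∈ q
    · have hyu : IsUnit (algebraMap A (Localization.AtPrime q) y) :=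
        IsLocalization.map_units (M := q.primeCompl) _
          ⟨y, hyq q (hmem q inferInstance hxq hq.le)⟩
      rw [← hyu.dvd_mul_left, ← map_mul]
      exact map_dvd _ ⟨k', hk⟩
    · exact (IsLocalization.map_units (M := q.primeCompl) _ ⟨x, hxq⟩).dvd
  · have hne : Ideal.span {x, y} ≠ ⊤ := fun h => by
      have : Ideal.span {x, y} ≤ maximalIdeal A := by
        rw [Ideal.span_le]
        rintro _ (rfl | rfl) <;> assumption
      rw [h] at this
      exact (maximalIdeal.isMaximal A).ne_top (top_le_iff.1 this)
    have : Nontrivial (A ⧸ Ideal.span {x, y}) := Ideal.Quotient.nontrivial_iff.2 hne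
    -- An associated prime contains `x` and `y`, so it is the maximal ideal. Thus `A ⧸ (x, y)` has a
    -- nonzero socle element, represented by `s`.
    obtain ⟨q, hq⟩ := associatedPrimes.nonempty A (A ⧸ Ideal.span {x, y})
    obtain ⟨hqp, z, hz⟩ := isAssociatedPrime_iff.1 hq
    obtain ⟨s, rfl⟩ := Ideal.Quotient.mk_surjective z
    have hmq : ∀ z, z ∈ q ↔ s * z ∈ Ideal.span {x, y} := by
      intro z
      rw [hz, Submodule.mem_colon_singleton, Submodule.mem_bot, mul_comm,
        ← Ideal.Quotient.eq_zero_iff_mem]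
      rfl
    have hqm := hprime q hqp ((hmq x).2 (Ideal.mul_mem_left _ _ (Ideal.subset_span (by simp))))
      ((hmq y).2 (Ideal.mul_mem_left _ _ (Ideal.subset_span (by simp))))
    refine ⟨s, fun hs => hqp.ne_top ((Ideal.eq_top_iff_one _).2 ((hmq 1).2 (by simpa using hs))),
      fun z hz => (hmq z).1 (hqm ▸ hz)⟩

end RegularPair

/-! ### Lengths of cokernels as orders of determinants -/

section Length

/-- Over a principal ideal domain, the length of the cokernel of an injective endomorphism of a
finite free module is the order of its determinant. -/
theorem length_eq_ord_det {C F Z : Type*} [CommRing C] [IsDomain C] [IsPrincipalIdealRing C]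
    [AddCommGroup F] [Module C F] [Module.Free C F] [Module.Finite C F]
    [AddCommGroup Z] [Module C Z]
    {φ : F →ₗ[C] F} (hφ : LinearMap.det φ ≠ 0) {π : F →ₗ[C] Z} (hπ : Function.Surjective π)
    (h : Function.Exact φ π) : Module.length C Z = Ring.ord C (LinearMap.det φ) := by
  classical
  have hinj : Function.Injective φ := by
    rw [← LinearMap.ker_eq_bot]
    by_contra hne
    exact hφ (LinearMap.det_eq_zero_iff_ker_ne_bot.2 hne)
  let N := LinearMap.range φ
  let e : F ≃ₗ[C] N := LinearEquiv.ofInjective φ hinj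
  have hrank : Module.finrank C N = Module.finrank C F := e.finrank_eq.symm
  let b := Module.Free.chooseBasis C F
  let b' := Submodule.smithNormalFormTopBasis b hrank
  let c := Submodule.smithNormalFormBotBasis b hrank
  let a := Submodule.smithNormalFormCoeffs b hrank
  have hc : ∀ i, (c i : F) = a i • b' i := Submodule.smithNormalFormBotBasis_def b hrank
  -- Smith normal form: `φ` is the diagonal map `D` preceded by an automorphism `w`, so the
  -- determinants agree up to a unit.
  let D : F →ₗ[C] F := b'.constr C fun i => a i • b' i
  let w : F ≃ₗ[C] F := e.trans (c.equiv b' (Equiv.refl _))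
  have hD : ∀ n : N, D (c.equiv b' (Equiv.refl _) n) = n := by
    have : D ∘ₗ (c.equiv b' (Equiv.refl _)).toLinearMap = N.subtype := by
      refine c.ext fun i => ?_
      simp [D, hc]
    exact fun n => LinearMap.congr_fun this n
  have hφD : φ = D ∘ₗ w.toLinearMap := by
    ext v
    exact (hD (e v)).symm
  have hdetD : LinearMap.det D = ∏ i, a i := by
    rw [← LinearMap.det_toMatrix b', ← Matrix.det_diagonal]
    congr 1
    ext i j
    by_cases hij : i = j
    · subst hij
      simp [D, LinearMap.toMatrix_apply]
    · simp [D, LinearMap.toMatrix_apply, hij]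
  have hker : LinearMap.ker π = N := LinearMap.exact_iff.1 h
  let eZ : (F ⧸ N) ≃ₗ[C] Z :=
    (Submodule.quotEquivOfEq _ _ hker.symm).trans (π.quotKerEquivOfSurjective hπ)
  rw [← eZ.length_eq, (N.quotientEquivPiSpan b hrank).length_eq, Module.length_pi_of_fintype, hφD,
    LinearMap.det_comp, mul_comm, Ring.ord_mul_of_isUnit_left (LinearEquiv.isUnit_det' w), hdetD]
  have hprod : ∀ s : Finset (Module.Free.ChooseBasisIndex C F),
      Ring.ord C (∏ i ∈ s, a i) = ∑ i ∈ s, Ring.ord C (a i) := by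
    intro s
    induction s using Finset.induction_on with
    | empty => simp
    | insert i s hi ih =>
      rw [Finset.prod_insert hi, Finset.sum_insert hi, Ring.ord_mul' C, ih]
      exact mem_nonZeroDivisors_of_ne_zero (Submodule.smithNormalFormCoeffs_ne_zero b hrank i)
  rw [hprod]
  rfl

/-- If `s` kills the cokernel of an endomorphism `φ` of `Aᵐ`, then `det φ ∣ s ^ m`. -/
theorem det_dvd_pow {A Y : Type*} [CommRing A] [AddCommGroup Y] [Module A Y] {m : ℕ}
    {φ : (Fin m → A) →ₗ[A] (Fin m → A)} {π : (Fin m → A) →ₗ[A] Y} (h : Function.Exact φ π)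
    {s : A} (hs : ∀ z : Y, s • z = 0) : LinearMap.det φ ∣ s ^ m := by
  -- As `s` kills the cokernel, `s • id = φ ∘ ψ` for some `ψ`. Taking determinants gives the
  -- divisibility.
  have hex : ∀ i, ∃ v, φ v = s • Pi.single i 1 := fun i =>
    (h _).1 (by rw [map_smul, hs])
  choose v hv using hex
  let ψ : (Fin m → A) →ₗ[A] (Fin m → A) := (Pi.basisFun A (Fin m)).constr A v
  refine ⟨LinearMap.det ψ, ?_⟩
  have : φ ∘ₗ ψ = s • LinearMap.id := by
    refine (Pi.basisFun A (Fin m)).ext fun i => ?_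
    simp [ψ, hv, -Pi.basisFun_apply]
    simp
  rw [← LinearMap.det_comp, this, LinearMap.det_smul, LinearMap.det_id, mul_one]
  nontriviality A
  simp

/-- The length of the base change of a module with a square presentation. -/
theorem length_baseChange_eq_ord {A Y : Type*} [CommRing A] [AddCommGroup Y] [Module A Y] {m : ℕ}
    {φ : (Fin m → A) →ₗ[A] (Fin m → A)} {π : (Fin m → A) →ₗ[A] Y} (hπ : Function.Surjective π)
    (h : Function.Exact φ π) (C : Type*) [CommRing C] [IsDomain C] [IsPrincipalIdealRing C]
    [Algebra A C] (hdet : algebraMap A C (LinearMap.det φ) ≠ 0) :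
    Module.length C (C ⊗[A] Y) = Ring.ord C (algebraMap A C (LinearMap.det φ)) := by
  rw [← LinearMap.det_baseChange] at hdet ⊢
  refine length_eq_ord_det hdet (π := π.baseChange C) ?_ ?_
  · exact LinearMap.lTensor_surjective C hπ
  · exact lTensor_exact C h hπ

/-- The length of a localized module may be computed with any model of the localization. -/
theorem length_localizedModule_eq {T : Type*} [CommRing T] (S : Submonoid T) (C : Type*)
    [CommRing C] [Algebra T C] [IsLocalization S C] {X Z : Type*} [AddCommGroup X] [Module T X]
    [AddCommGroup Z] [Module T Z] [Module C Z] [IsScalarTower T C Z] (f : X →ₗ[T] Z)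
    [IsLocalizedModule S f] :
    Module.length (Localization S) (LocalizedModule S X) = Module.length C Z := by
  let e : Localization S ≃ₐ[T] C := IsLocalization.algEquiv S (Localization S) C
  let : Algebra (Localization S) C := e.toAlgHom.toRingHom.toAlgebra
  let : Module (Localization S) Z := Module.compHom Z (algebraMap (Localization S) C)
  have : IsScalarTower (Localization S) C Z := ⟨fun x y z => by
    rw [Algebra.smul_def, mul_smul]; rfl⟩
  have : IsScalarTower T (Localization S) C := IsScalarTower.of_algebraMap_eq fun x =>
    (e.commutes x).symm
  have : IsScalarTower T (Localization S) Z := ⟨fun x y z => by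
    change algebraMap (Localization S) C (x • y) • z = x • (algebraMap (Localization S) C y • z)
    rw [Algebra.smul_def, map_mul, mul_smul, ← IsScalarTower.algebraMap_apply, algebraMap_smul]⟩
  rw [← Module.length_eq_of_surjective (S := Localization S) (R := C) (M := Z) e.surjective]
  exact ((IsLocalizedModule.iso S f).extendScalarsOfIsLocalization S (Localization S)).length_eq

theorem length_localizedModule_eq_tensor {T : Type*} [CommRing T] (S : Submonoid T) (C : Type*)
    [CommRing C] [Algebra T C] [IsLocalization S C] (X : Type*) [AddCommGroup X] [Module T X] :
    Module.length (Localization S) (LocalizedModule S X) = Module.length C (C ⊗[T] X) := by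
  have : IsLocalizedModule S (TensorProduct.mk T C X 1) :=
    (isLocalizedModule_iff_isBaseChange S C _).2 (TensorProduct.isBaseChange T X C)
  exact length_localizedModule_eq S C (TensorProduct.mk T C X 1)

end Length

/-! ### Normality of power series rings -/

section PowerSeriesNormal

open PowerSeries

variable {A : Type*} [CommRing A] [IsDomain A] [IsNoetherianRing A] [IsIntegrallyClosed A]

/-- A power series over the fraction field that is almost integral over `A⟦X⟧` has coefficients
in `A`. -/
theorem coeff_mem_range_of_isAlmostIntegral {K : Type*} [Field K] [Algebra A K]
    [IsFractionRing A K] {f : K⟦X⟧} (hf : IsAlmostIntegral A⟦X⟧ f) (i : ℕ) :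
    coeff i f ∈ (algebraMap A K).range := by
  have hinj := IsFractionRing.injective A K
  induction i using Nat.strong_induction_on with
  | h i ih =>
    choose! g hg using ih
    -- Removing the lower terms, already in `A`, leaves `X ^ i * f'`, which is still almost integral
    -- and has the wanted coefficient in front.
    let P : A⟦X⟧ := mk fun j => if j < i then g j else 0
    let f' : K⟦X⟧ := mk fun j => coeff (j + i) f
    have hfP : f - algebraMap A⟦X⟧ K⟦X⟧ P = X ^ i * f' := by
      ext j
      rw [algebraMap_apply'', map_sub, coeff_map, coeff_mk, coeff_X_pow_mul']
      split_ifs with h1 h2 h2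
      · omega
      · rw [hg j h1, sub_self]
      · rw [coeff_mk, Nat.sub_add_cancel h2, map_zero, sub_zero]
      · omega
    have hal : IsAlmostIntegral A⟦X⟧ (X ^ i * f') := by
      rw [← hfP]
      exact (completeIntegralClosure A⟦X⟧ K⟦X⟧).sub_mem hf (algebraMap_mem _ P)
    obtain ⟨d, hd, hdn⟩ := hal
    have hd0 : d ≠ 0 := nonZeroDivisors.ne_zero hd
    obtain ⟨e, d', hde, hd'⟩ : ∃ (e : ℕ) (d' : A⟦X⟧), d = X ^ e * d' ∧ constantCoeff d' ≠ 0 := by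
      refine ⟨d.order.toNat, divXPowOrder d, X_pow_order_mul_divXPowOrder.symm, ?_⟩
      rw [constantCoeff_divXPowOrder]
      exact coeff_order hd0
    have hint : IsIntegral A (coeff i f) := by
      refine IsAlmostIntegral.isIntegral
        ⟨constantCoeff d', mem_nonZeroDivisors_of_ne_zero hd', fun n => ?_⟩
      obtain ⟨r, hr⟩ := hdn n
      -- The lowest coefficient of `d * (X ^ i * f') ^ n` sits in degree `e + i * n` and equals
      -- `d'(0)` times the `n`-th power of the wanted coefficient. So `d'(0)` is a common
      -- denominator of all its powers.
      refine ⟨coeff (e + i * n) r, ?_⟩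
      have h1 := congrArg (coeff (e + i * n)) hr
      rw [Algebra.smul_def, hde] at h1
      have h2 : algebraMap A⟦X⟧ K⟦X⟧ (X ^ e * d') * (X ^ i * f') ^ n =
          X ^ (e + i * n) * (PowerSeries.map (algebraMap A K) d' * f' ^ n) := by
        rw [algebraMap_apply'', map_mul, map_pow, map_X, mul_pow, ← pow_mul, pow_add]
        ring
      rw [h2, algebraMap_apply'', coeff_map] at h1
      rw [h1, coeff_X_pow_mul', if_pos le_rfl, Nat.sub_self, coeff_zero_eq_constantCoeff_apply,
        map_mul, map_pow, Algebra.smul_def]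
      congr 2
      · simp [f', ← coeff_zero_eq_constantCoeff_apply]
    exact IsIntegrallyClosed.isIntegral_iff.1 hint

/-- An integral fraction becomes a power series over the field `K`, since `K⟦X⟧` is integrally
closed. Being almost integral, it has coefficients in `A`. Almost integrality is used because it
passes to coefficients through a common denominator. -/
instance isIntegrallyClosed_powerSeries : IsIntegrallyClosed A⟦X⟧ := by
  let K := FractionRing A
  have hinj : Function.Injective (algebraMap A⟦X⟧ K⟦X⟧) :=
    map_injective _ (IsFractionRing.injective A K)
  let ψ : A⟦X⟧ →+* FractionRing K⟦X⟧ := (algebraMap K⟦X⟧ _).comp (algebraMap A⟦X⟧ K⟦X⟧)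
  have hψ : Function.Injective ψ := (IsFractionRing.injective K⟦X⟧ _).comp hinj
  let Ψ : FractionRing A⟦X⟧ →+* FractionRing K⟦X⟧ := IsFractionRing.lift hψ
  have hΨ : ∀ a, Ψ (algebraMap _ _ a) = ψ a := IsFractionRing.lift_algebraMap hψ
  rw [isIntegrallyClosed_iff (FractionRing A⟦X⟧)]
  intro x hx
  have hx' : IsIntegral K⟦X⟧ (Ψ x) := by
    obtain ⟨p, hp, hpx⟩ := hx
    refine ⟨p.map (algebraMap A⟦X⟧ K⟦X⟧), hp.map _, ?_⟩
    rw [Polynomial.eval₂_map]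
    have := congrArg Ψ hpx
    rw [Polynomial.hom_eval₂, map_zero] at this
    convert! this using 2
    ext1 a
    exact (hΨ a).symm
  obtain ⟨f, hf⟩ := IsIntegrallyClosed.isIntegral_iff.1 hx'
  have hal : IsAlmostIntegral A⟦X⟧ f := by
    obtain ⟨d, hd, hdn⟩ := hx.isAlmostIntegral
    refine ⟨d, hd, fun n => ?_⟩
    obtain ⟨r, hr⟩ := hdn n
    refine ⟨r, IsFractionRing.injective K⟦X⟧ (FractionRing K⟦X⟧) ?_⟩
    have := congrArg Ψ hr
    rw [hΨ, Algebra.smul_def, map_mul, hΨ, map_pow, ← hf] at this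
    rw [Algebra.smul_def, map_mul, map_pow]
    exact this
  choose g hg using fun i => coeff_mem_range_of_isAlmostIntegral hal i
  refine ⟨mk g, Ψ.injective ?_⟩
  rw [hΨ, ← hf]
  change algebraMap _ _ (PowerSeries.map (algebraMap A K) (mk g)) = _
  congr 1
  ext i
  rw [coeff_map, coeff_mk, hg]

end PowerSeriesNormal

/-! ### Dimension and codimension one in power series rings -/

section PowerSeriesDimension

open PowerSeries IsLocalRing

theorem X_mem_maximalIdeal {A : Type*} [CommRing A] [IsLocalRing A] :
    (X : A⟦X⟧) ∈ maximalIdeal A⟦X⟧ := by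
  rw [mem_maximalIdeal, mem_nonunits_iff, isUnit_iff_constantCoeff]
  simp

theorem ringKrullDim_powerSeries {A : Type*} [CommRing A] [IsDomain A] [IsNoetherianRing A]
    [IsLocalRing A] : ringKrullDim A⟦X⟧ = ringKrullDim A + 1 := by
  rw [← ringKrullDim_quotient_span_singleton_succ_eq_ringKrullDim_of_mem_nonZeroDivisors
    (x := (X : A⟦X⟧)) (mem_nonZeroDivisors_of_ne_zero X_ne_zero) X_mem_maximalIdeal]
  congr 1
  have hker : Ideal.span {(X : A⟦X⟧)} = RingHom.ker (constantCoeff (R := A)) := by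
    ext f
    rw [Ideal.mem_span_singleton, X_dvd_iff, RingHom.mem_ker]
  rw [hker]
  exact ringKrullDim_eq_of_ringEquiv
    (RingHom.quotientKerEquivOfSurjective constantCoeff_surj)

variable {A : Type*} [CommRing A] [IsDomain A] [IsNoetherianRing A] [IsIntegrallyClosed A]
  [IsLocalRing A]

/-- If all primes of height one of `A` have codimension at most one, the same holds for `A⟦X⟧`. -/
theorem ringKrullDim_le_quotient_powerSeries
    (hA : ∀ q : Ideal A, q.IsPrime → q.height = 1 → ringKrullDim A ≤ ringKrullDim (A ⧸ q) + 1)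
    (q : Ideal A⟦X⟧) [q.IsPrime] (hq : q.height = 1) :
    ringKrullDim A⟦X⟧ ≤ ringKrullDim (A⟦X⟧ ⧸ q) + 1 := by
  rw [ringKrullDim_powerSeries]
  gcongr
  by_cases hX : (X : A⟦X⟧) ∈ q
  · have hqX := Ideal.eq_span_singleton_of_height_eq_one hq hX X_prime
    have hle : ∀ a ∈ q, constantCoeff a = 0 := by
      intro a ha
      rwa [hqX, Ideal.mem_span_singleton, X_dvd_iff] at ha
    exact ringKrullDim_le_of_surjective (Ideal.Quotient.lift q constantCoeff hle)
      (Ideal.Quotient.lift_surjective_of_surjective _ _ constantCoeff_surj)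
  obtain ⟨x₀, hx₀, hx₀0⟩ := Submodule.exists_mem_ne_zero_of_ne_bot
      (Ideal.ne_bot_of_height_eq_one hq)
  -- As `X ∉ q`, powers of `X` can be divided out of a nonzero element of `q`.
  obtain ⟨x, hx, hx0⟩ : ∃ x ∈ q, constantCoeff x ≠ 0 := by
    refine ⟨divXPowOrder x₀, ?_, ?_⟩
    · rw [← X_pow_order_mul_divXPowOrder (f := x₀)] at hx₀
      exact (Ideal.IsPrime.mem_or_mem ‹_› hx₀).resolve_left
        fun h => hX (Ideal.IsPrime.mem_of_pow_mem ‹_› _ h)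
    · rw [constantCoeff_divXPowOrder]
      exact coeff_order hx₀0
  have hxne : x ≠ 0 := fun h => hx0 (by simp [h])
  have hqmin : q ∈ (Ideal.span {x}).minimalPrimes := by
    have hxq : Ideal.span {x} ≤ q := by simpa [Ideal.span_le] using hx
    refine Ideal.mem_minimalPrimes_of_height_le hxq (hq.le.trans ?_)
    exact Ideal.one_le_height_span_singleton_of_mem_nonZeroDivisors
      (mem_nonZeroDivisors_of_ne_zero hxne)
  obtain ⟨z₀, hz₀, hz₀q⟩ : ∃ z, ¬ x ∣ z ∧ ∀ w ∈ q, x ∣ w * z := by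
    have hass : q ∈ associatedPrimes A⟦X⟧ (A⟦X⟧ ⧸ Ideal.span {x}) :=
      Module.associatedPrimes.minimalPrimes_annihilator_subset_associatedPrimes _ _
        (by rwa [Ideal.annihilator_quotient])
    obtain ⟨_, z, hz⟩ := isAssociatedPrime_iff.1 hass
    obtain ⟨z, rfl⟩ := Ideal.Quotient.mk_surjective z
    have hmem : ∀ w, w ∈ q ↔ x ∣ w * z := by
      intro w
      rw [hz, Submodule.mem_colon_singleton, Submodule.mem_bot, ← Ideal.mem_span_singleton,
        ← Ideal.Quotient.eq_zero_iff_mem]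
      rfl
    refine ⟨z, fun h => Ideal.IsPrime.ne_top ‹q.IsPrime› ?_, fun w hw => (hmem w).1 hw⟩
    exact (Ideal.eq_top_iff_one _).2 ((hmem 1).2 (by rwa [one_mul]))
  let J : Ideal A⟦X⟧ := (Ideal.span {x}).colon (q : Set A⟦X⟧)
  have hJ : ∀ z, z ∈ J ↔ ∀ w ∈ q, x ∣ w * z := by
    intro z
    simp only [J, Submodule.mem_colon, smul_eq_mul, Ideal.mem_span_singleton, SetLike.mem_coe,
      mul_comm z]
  -- Otherwise `J ≤ (x) + X J`, because `X` is prime and does not divide `x`. Nakayama would give `J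
  -- ≤ (x)`, contradicting `z₀`.
  obtain ⟨z, hzJ, hz⟩ : ∃ z ∈ J, ¬ constantCoeff x ∣ constantCoeff z := by
    by_contra hcon
    push Not at hcon
    have hle : J ≤ Ideal.span {x} := by
      refine Submodule.le_of_le_smul_of_le_jacobson_bot (I := Ideal.span {X})
        (IsNoetherian.noetherian J) ?_ fun z hz => ?_
      · rw [Ideal.span_singleton_le_iff_mem]
        exact maximalIdeal_le_jacobson _ X_mem_maximalIdeal
      · obtain ⟨c, hc⟩ := hcon z hz
        have : X ∣ z - x * C c := by
          rw [X_dvd_iff, map_sub, map_mul, constantCoeff_C, hc, sub_self]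
        obtain ⟨z', hz'⟩ := this
        have hz'J : z' ∈ J := by
          rw [hJ] at hz ⊢
          intro w hw
          have h1 : x ∣ X * (w * z') := by
            have : X * (w * z') = w * z - x * (w * C c) := by linear_combination (-w) * hz'
            rw [this]
            exact dvd_sub (hz w hw) (dvd_mul_right _ _)
          obtain ⟨v, hv⟩ := h1
          have hXv : X ∣ x * v := ⟨_, hv.symm⟩
          obtain ⟨v', rfl⟩ := (X_prime.dvd_or_dvd hXv).resolve_left (by rwa [X_dvd_iff])
          exact ⟨v', mul_left_cancel₀ X_ne_zero (by rw [hv]; ring)⟩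
        rw [sub_eq_iff_eq_add'.1 hz']
        exact Submodule.add_mem_sup (Ideal.mul_mem_right _ _ (Ideal.mem_span_singleton_self x))
          (Submodule.smul_mem_smul (Ideal.mem_span_singleton_self X) hz'J)
    exact hz₀ (Ideal.mem_span_singleton.1 (hle ((hJ z₀).2 hz₀q)))
  rw [hJ] at hzJ
  have hne : Ideal.Quotient.mk (Ideal.span {constantCoeff x}) (constantCoeff z) ≠ 0 := by
    rwa [Ne, Ideal.Quotient.eq_zero_iff_mem, Ideal.mem_span_singleton]
  -- The constant terms of `q` multiply `z(0)` into `(x(0))`, so they lie in an associated prime `p`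
  -- of `A ⧸ (x(0))`, of height one by normality.
  obtain ⟨p, hp, hple⟩ := exists_le_isAssociatedPrime_of_isNoetherianRing A _ hne
  have hpp := hp.isPrime
  have hqp : ∀ w ∈ q, constantCoeff w ∈ p := by
    intro w hw
    refine hple ?_
    rw [Submodule.mem_colon_singleton, Submodule.mem_bot]
    change Ideal.Quotient.mk _ (constantCoeff w * constantCoeff z) = 0
    rw [Ideal.Quotient.eq_zero_iff_mem, Ideal.mem_span_singleton, ← map_mul]
    exact map_dvd _ (hzJ w hw)
  have hp1 : p.height = 1 := by
    refine le_antisymm (height_le_one_of_isAssociatedPrime hx0 hp) ?_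
    rw [Order.one_le_iff_ne_zero, Ne, Ideal.height_eq_zero_iff_eq_bot]
    rintro rfl
    exact hx0 (by simpa using hqp x hx)
  refine (hA p hpp hp1).trans ?_
  -- The surjection `A⟦X⟧ ⧸ q → A ⧸ p` kills the nonzero class of `X`, so the dimension drops by at
  -- least one.
  refine ringKrullDim_succ_le_of_surjective
    (Ideal.Quotient.lift q ((Ideal.Quotient.mk p).comp constantCoeff) fun w hw => ?_)
    (Ideal.Quotient.lift_surjective_of_surjective _ _
      (Ideal.Quotient.mk_surjective.comp constantCoeff_surj))
    (r := Ideal.Quotient.mk q X) (mem_nonZeroDivisors_of_ne_zero ?_) ?_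
  · exact Ideal.Quotient.eq_zero_iff_mem.2 (hqp w hw)
  · rwa [Ne, Ideal.Quotient.eq_zero_iff_mem]
  · simp

end PowerSeriesDimension

/-! ### Power series rings over the p-adic integers -/

section PadicPowerSeries

variable (p : ℕ) [Fact p.Prime] (n : ℕ)

instance isDomain_mvPowerSeries : IsDomain (MvPowerSeries (Fin n) ℤ_[p]) :=
  NoZeroDivisors.to_isDomain _

theorem isIntegrallyClosed_mvPowerSeries :
    IsIntegrallyClosed (MvPowerSeries (Fin n) ℤ_[p]) := by
  induction n with
  | zero => exact IsIntegrallyClosed.of_equiv (MvPowerSeries.isEmptyEquiv ..).symm.toRingEquiv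
  | succ n ih => exact IsIntegrallyClosed.of_equiv (MvPowerSeries.finSuccEquiv ..).symm.toRingEquiv

theorem ringKrullDim_mvPowerSeries :
    ringKrullDim (MvPowerSeries (Fin n) ℤ_[p]) = n + 1 := by
  induction n with
  | zero =>
    rw [ringKrullDim_eq_of_ringEquiv (MvPowerSeries.isEmptyEquiv (R := ℤ_[p]) ..).toRingEquiv,
      IsDiscreteValuationRing.ringKrullDim_eq_one]
    simp
  | succ n ih =>
    have := isIntegrallyClosed_mvPowerSeries p n
    rw [ringKrullDim_eq_of_ringEquiv (MvPowerSeries.finSuccEquiv ..).toRingEquiv,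
      ringKrullDim_powerSeries, ih]
    simp

theorem ringKrullDim_le_quotient_of_ringEquiv {A B : Type*} [CommRing A] [CommRing B] (e : A ≃+* B)
    (hA : ∀ q : Ideal A, q.IsPrime → q.height = 1 → ringKrullDim A ≤ ringKrullDim (A ⧸ q) + 1)
    (q : Ideal B) (hqp : q.IsPrime) (hq : q.height = 1) :
    ringKrullDim B ≤ ringKrullDim (B ⧸ q) + 1 := by
  have h := hA (q.comap e) inferInstance (by rw [e.height_comap, hq])
  rw [ringKrullDim_eq_of_ringEquiv e] at h
  rwa [ringKrullDim_eq_of_ringEquiv (Ideal.quotientEquiv (q.comap e) q e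
    (Ideal.map_comap_of_surjective e e.surjective q).symm)] at h

/-- The part of catenarity needed for the height of `Q`, obtained by adding one variable at a time.
For `n = 0` the ring has dimension one and nothing is left to prove. -/
theorem ringKrullDim_le_quotient_mvPowerSeries (q : Ideal (MvPowerSeries (Fin n) ℤ_[p]))
    (hqp : q.IsPrime) (hq : q.height = 1) :
    ringKrullDim (MvPowerSeries (Fin n) ℤ_[p]) ≤
      ringKrullDim (MvPowerSeries (Fin n) ℤ_[p] ⧸ q) + 1 := by
  induction n with
  | zero =>
    rw [ringKrullDim_mvPowerSeries]
    have := Ideal.Quotient.nontrivial_iff.2 hqp.ne_top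
    have := ringKrullDim_nonneg_of_nontrivial (R := MvPowerSeries (Fin 0) ℤ_[p] ⧸ q)
    simpa using add_le_add_left this 1
  | succ n ih =>
    have := isIntegrallyClosed_mvPowerSeries p n
    exact ringKrullDim_le_quotient_of_ringEquiv (MvPowerSeries.finSuccEquiv ..).symm.toRingEquiv
      (fun q hqp hq => ringKrullDim_le_quotient_powerSeries ih q hq) q hqp hq

end PadicPowerSeries

/-! ### Dimension and height in integral extensions -/

section IntegralDimension

variable {A B : Type*} [CommRing A] [CommRing B] [Algebra A B] [Algebra.IsIntegral A B]

theorem ringKrullDim_le_of_isIntegral : ringKrullDim B ≤ ringKrullDim A :=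
  Order.krullDim_le_of_strictMono (PrimeSpectrum.comap (algebraMap A B)) fun _ _ h =>
    Ideal.IsIntegral.comap_lt_comap (R := A) h

theorem ringKrullDim_le_of_isIntegral_of_injective
    (h : Function.Injective (algebraMap A B)) : ringKrullDim A ≤ ringKrullDim B := by
  rw [ringKrullDim, Order.krullDim]
  refine iSup_le fun l => ?_
  obtain ⟨P, -, hP, hPl⟩ := Ideal.exists_ideal_over_prime_of_isIntegral l.head.asIdeal (⊥ : Ideal B)
    (by rw [← RingHom.ker_eq_comap_bot, (RingHom.injective_iff_ker_eq_bot _).1 h]; exact bot_le)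
  have : P.LiesOver l.head.asIdeal := ⟨hPl.symm⟩
  obtain ⟨L, hL, -⟩ := Ideal.exists_ltSeries_of_hasGoingUp l P
  rw [← hL]
  exact Order.LTSeries.length_le_krullDim L

/-- An integral extension `A → B`, restricted modulo a prime of `B`. -/
theorem ringKrullDim_quotient_comap (P : Ideal B) :
    ringKrullDim (A ⧸ P.comap (algebraMap A B)) = ringKrullDim (B ⧸ P) :=
  le_antisymm (ringKrullDim_le_of_isIntegral_of_injective Ideal.algebraMap_quotient_injective)
    ringKrullDim_le_of_isIntegral

/-- Going down, available since `A` is normal, gives the height formula with a fibre term. That term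
vanishes because `P` is minimal over the extension of its contraction. -/
theorem height_comap_eq_of_isIntegral [IsDomain A] [IsDomain B] [FaithfulSMul A B]
    [IsIntegrallyClosed A] [IsNoetherianRing A] [IsNoetherianRing B] (P : Ideal B) [P.IsPrime] :
    (P.comap (algebraMap A B)).height = P.height := by
  have hP : P.LiesOver (P.comap (algebraMap A B)) := ⟨rfl⟩
  rw [Ideal.height_eq_height_add_of_liesOver_of_hasGoingDown (P.comap (algebraMap A B)) P]
  set J := (P.comap (algebraMap A B)).map (algebraMap A B) with hJ
  have hmin : P ∈ J.minimalPrimes := Ideal.IsIntegral.mem_minimalPrimes_map_under (R := A) P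
  have hPJ : (P.map (Ideal.Quotient.mk J)).comap (Ideal.Quotient.mk J) = P := by
    rw [Ideal.comap_map_of_surjective _ Ideal.Quotient.mk_surjective, ← RingHom.ker_eq_comap_bot,
      Ideal.mk_ker, sup_eq_left]
    exact hmin.1.2
  have hprime : (P.map (Ideal.Quotient.mk J)).IsPrime :=
    Ideal.map_isPrime_of_surjective Ideal.Quotient.mk_surjective (by simpa using hmin.1.2)
  have h0 : (P.map (Ideal.Quotient.mk J)).height = 0 := by
    rw [Ideal.height_eq_zero_iff]
    refine ⟨⟨hprime, bot_le⟩, fun q hq hqP => ?_⟩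
    have h1 : P ≤ q.comap (Ideal.Quotient.mk J) := by
      have := hq.1
      refine hmin.2 ⟨inferInstance, ?_⟩ ((Ideal.comap_mono hqP).trans hPJ.le)
      conv_lhs => rw [← Ideal.mk_ker (I := J), RingHom.ker_eq_comap_bot]
      exact Ideal.comap_mono bot_le
    exact Ideal.map_le_iff_le_comap.2 h1
  rw [h0, add_zero]

end IntegralDimension

theorem height_add_ringKrullDim_quotient_le {A : Type*} [CommRing A] (q : Ideal A) [q.IsPrime] :
    (q.height : WithBot ℕ∞) + ringKrullDim (A ⧸ q) ≤ ringKrullDim A := by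
  have : Nonempty (PrimeSpectrum A) := ⟨⟨q, ‹_›⟩⟩
  have h : ringKrullDim (A ⧸ q) = (Order.coheight (⟨q, ‹_›⟩ : PrimeSpectrum A) : ℕ∞) := by
    rw [ringKrullDim_quotient, Order.coheight_eq_krullDim_Ici]
    rfl
  rw [h, ringKrullDim, Order.krullDim_eq_iSup_height_add_coheight_of_nonempty,
    ← WithBot.coe_add, WithBot.coe_le_coe]
  refine le_trans (le_of_eq ?_)
    (le_iSup (fun a : PrimeSpectrum A => Order.height a + Order.coheight a) ⟨q, ‹_›⟩)
  rw [PrimeSpectrum.height_eq_orderHeight ⟨q, ‹_›⟩]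

/-! ### Contractions of height one primes of `R` have height two -/

section Specialization

variable {p : ℕ} [Fact p.Prime] {n : ℕ}
  {T R : Type u} [CommRing T] [CommRing R] [IsDomain R] [Algebra T R]

theorem IsIntegralClosureOfImage.isIntegral (h : IsIntegralClosureOfImage T R) :
    Algebra.IsIntegral T R := by
  obtain ⟨e, he⟩ := h
  refine ⟨fun r => ?_⟩
  have hpr : (RingHom.ker (algebraMap T R)).IsPrime := RingHom.ker_isPrime _
  have h1 := (e r).2
  obtain ⟨f, hf, hf0⟩ := h1
  obtain ⟨g, hg, hgm⟩ : ∃ g : Polynomial T,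
      g.map (Ideal.Quotient.mk (RingHom.ker (algebraMap T R))) = f ∧ g.Monic := by
    obtain ⟨g, hg, -, hgm⟩ := Polynomial.lifts_and_degree_eq_and_monic
      (Polynomial.mem_lifts _ |>.2 (Polynomial.map_surjective _ Ideal.Quotient.mk_surjective f)) hf
    exact ⟨g, hg, hgm⟩
  refine ⟨g, hgm, e.injective (Subtype.ext ?_)⟩
  rw [← hg, Polynomial.eval₂_map] at hf0
  rw [map_zero]
  have h2 := Polynomial.hom_eval₂ g (algebraMap T R)
    ((integralClosure (T ⧸ RingHom.ker (algebraMap T R))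
      (FractionRing (T ⧸ RingHom.ker (algebraMap T R)))).subtype.comp e.toRingHom) r
  refine h2.trans (Eq.trans ?_ hf0)
  congr 1
  ext t
  exact he t

/-- With `Q` the contraction, `ht Q + dim T/Q ≤ n + 1` and `dim T/Q = dim R/P ≥ n - 1` bound the
height above. Below, `Q` strictly contains the kernel, of height one. -/
theorem height_comap_eq_two [Algebra (MvPowerSeries (Fin n) ℤ_[p]) T]
    [Module.Finite (MvPowerSeries (Fin n) ℤ_[p]) T] [IsNoetherianRing T]
    [Algebra (MvPowerSeries (Fin (n - 1)) ℤ_[p]) R]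
    [Module.Finite (MvPowerSeries (Fin (n - 1)) ℤ_[p]) R] [IsNoetherianRing R]
    (hn : 1 ≤ n) (hR : Function.Injective (algebraMap (MvPowerSeries (Fin (n - 1)) ℤ_[p]) R))
    [Algebra.IsIntegral T R]
    (hker : (RingHom.ker (algebraMap T R)).height = 1) (P : Ideal R) [P.IsPrime]
    (hP : P.height = 1) : (P.comap (algebraMap T R)).height = 2 := by
  have hint := isIntegrallyClosed_mvPowerSeries p (n - 1)
  have hf : FaithfulSMul (MvPowerSeries (Fin (n - 1)) ℤ_[p]) R :=
    (faithfulSMul_iff_algebraMap_injective _ _).2 hR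
  have hQne : ∃ r ∈ P, r ≠ 0 :=
    Submodule.exists_mem_ne_zero_of_ne_bot (Ideal.ne_bot_of_height_eq_one hP)
  refine le_antisymm ?_ ?_
  · have h1 := height_add_ringKrullDim_quotient_le (P.comap (algebraMap T R))
    rw [ringKrullDim_quotient_comap] at h1
    have h2 : ringKrullDim T ≤ n + 1 :=
      (ringKrullDim_le_of_isIntegral (A := MvPowerSeries (Fin n) ℤ_[p])).trans
        (ringKrullDim_mvPowerSeries p n).le
    have h3 := ringKrullDim_le_quotient_mvPowerSeries p (n - 1)
      (P.comap (algebraMap (MvPowerSeries (Fin (n - 1)) ℤ_[p]) R)) inferInstance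
      (by rw [height_comap_eq_of_isIntegral, hP])
    rw [ringKrullDim_quotient_comap, ringKrullDim_mvPowerSeries] at h3
    obtain ⟨m, rfl⟩ : ∃ m, n = m + 1 := ⟨n - 1, by omega⟩
    rw [Nat.add_sub_cancel] at h3
    generalize ringKrullDim (R ⧸ P) = d at h1 h3
    generalize (P.comap (algebraMap T R)).height = e at h1
    have h5 := h1.trans h2
    induction d using WithBot.recBotCoe with
    | bot => simp at h3
    | coe d =>
      norm_cast at h3 h5
      have h4 : (m : ℕ∞) ≤ d := by simpa using h3
      have h6 : m + e ≤ m + 2 := by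
        refine le_trans ?_ (h5.trans (by norm_cast))
        rw [add_comm]
        gcongr
      exact (ENat.add_le_add_iff_left (ENat.natCast_ne_top m)).1 h6
  · have hlt : RingHom.ker (algebraMap T R) < P.comap (algebraMap T R) := by
      rw [RingHom.ker_eq_comap_bot]
      refine Ideal.IsIntegral.comap_lt_comap (R := T)
          (bot_lt_iff_ne_bot.2 (Ideal.ne_bot_of_height_eq_one hP))
    have hpr : (RingHom.ker (algebraMap T R)).IsPrime := RingHom.ker_isPrime _
    have := Ideal.height_strict_mono_of_isPrime hlt
    rw [hker] at this
    exact (one_add_one_eq_two (R := ℕ∞)).symm.le.trans (Order.add_one_le_of_lt this)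

end Specialization

/-! ### Finite domains over p-adic power series rings are local -/

section Idempotents

open IsLocalRing

/-- Separatedness holds as `I` lies in the Jacobson radical. Completeness holds because `M` tensored
with the completion of `A`, which is `A`, surjects onto the completion of `M`. -/
theorem isAdicComplete_of_finite {A M : Type*} [CommRing A] [IsNoetherianRing A] (I : Ideal A)
    [IsAdicComplete I A] [AddCommGroup M] [Module A M] [Module.Finite A M] :
    IsAdicComplete I M := by
  have h1 : IsHausdorff I M := IsHausdorff.of_le_jacobson I M (IsAdicComplete.le_jacobson_bot I)
  have h2 : IsPrecomplete I M := by
    rw [← AdicCompletion.of_surjective_iff]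
    intro z
    obtain ⟨t, rfl⟩ := AdicCompletion.ofTensorProduct_surjective_of_finite I M z
    induction t with
    | zero => exact ⟨0, by simp⟩
    | add x y hx hy =>
      obtain ⟨a, ha⟩ := hx
      obtain ⟨b, hb⟩ := hy
      exact ⟨a + b, by simp [ha, hb]⟩
    | tmul r m =>
      obtain ⟨a, rfl⟩ := AdicCompletion.of_surjective I A r
      refine ⟨a • m, ?_⟩
      rw [AdicCompletion.ofTensorProduct_tmul]
      ext n
      simp
      rfl
  exact { toIsHausdorff := h1, toIsPrecomplete := h2 }

theorem exists_isIdempotentElem_of_isAdicComplete {S : Type*} [CommRing S] (I : Ideal S)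
    [IsAdicComplete I S] {b : S} (hb : b ^ 2 - b ∈ I) :
    ∃ e : S, IsIdempotentElem e ∧ e - b ∈ I := by
  obtain ⟨e, he, heb⟩ := HenselianRing.is_henselian (I := I)
      (Polynomial.X ^ 2 - Polynomial.X : Polynomial S)
    (by monicity!) b (by simpa using hb) (by
      rw [isUnit_iff_exists_inv]
      -- The derivative `2b - 1` is its own inverse modulo `I`: its square is `1 + 4(b² - b)`.
      refine ⟨Ideal.Quotient.mk I (2 * b - 1), ?_⟩
      rw [← map_mul, ← map_one (Ideal.Quotient.mk I), Ideal.Quotient.eq]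
      have : Polynomial.eval b (Polynomial.derivative (Polynomial.X ^ 2 - Polynomial.X)) *
        (2 * b - 1) - 1 = 4 * (b ^ 2 - b) := by
        simp
        ring
      rw [this]
      exact I.mul_mem_left _ hb)
  refine ⟨e, ?_, heb⟩
  have h : e ^ 2 - e = 0 := by simpa [Polynomial.IsRoot] using he
  rw [IsIdempotentElem, ← sq]
  exact sub_eq_zero.1 h

theorem exists_isIdempotentElem_pow {S : Type*} [Monoid S] [Finite S] (a : S) :
    ∃ k, k ≠ 0 ∧ IsIdempotentElem (a ^ k) := by
  obtain ⟨i, j, hij, h⟩ := Finite.exists_ne_map_eq_of_infinite (fun n : ℕ => a ^ n)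
  wlog hlt : i < j generalizing i j
  · exact this j i hij.symm h.symm (by omega)
  obtain ⟨d, rfl⟩ := Nat.exists_eq_add_of_lt hlt
  have hper : ∀ m, a ^ (i + m) = a ^ (i + m + (d + 1)) := by
    intro m
    have h' : a ^ i = a ^ (i + d + 1) := h
    rw [pow_add, h', ← pow_add]
    congr 1
    ring
  have hper' : ∀ l m, a ^ (i + m) = a ^ (i + m + l * (d + 1)) := by
    intro l m
    induction l with
    | zero => simp
    | succ l ih =>
      rw [ih, add_assoc, hper]
      congr 1
      ring
  -- From exponent `i` on, the powers have period `d + 1`. This exponent is a multiple of the period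
  -- that exceeds `i`.
  refine ⟨(i + 1) * (d + 1), by positivity, ?_⟩
  rw [IsIdempotentElem, ← pow_add]
  have h3 : (i + 1) * (d + 1) = i + (i * d + d + 1) := by ring
  conv_rhs => rw [h3, hper' (i + 1), ← h3]

/-- In every finite algebra over the local ring `A`, some power of each element is, modulo the
maximal ideal of `A`, an idempotent of the algebra. -/
def PowersLiftToIdempotents (A : Type v) [CommRing A] [IsLocalRing A] : Prop :=
  ∀ (S : Type u) [CommRing S] [Algebra A S] [Module.Finite A S] (a : S),
    ∃ k, k ≠ 0 ∧ ∃ e : S, IsIdempotentElem e ∧ e - a ^ k ∈ (maximalIdeal A).map (algebraMap A S)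

theorem powersLiftToIdempotents_of_isAdicComplete (A : Type v) [CommRing A] [IsLocalRing A]
    [IsNoetherianRing A] [IsAdicComplete (maximalIdeal A) A] [Finite (ResidueField A)] :
    PowersLiftToIdempotents.{u, v} A := by
  intro S _ _ _ a
  set J := (maximalIdeal A).map (algebraMap A S)
  have hfin : Finite (S ⧸ J) := by
    have : Finite (A ⧸ maximalIdeal A) := inferInstanceAs (Finite (ResidueField A))
    exact Module.finite_of_finite (A ⧸ maximalIdeal A)
  obtain ⟨k, hk, hid⟩ := exists_isIdempotentElem_pow (Ideal.Quotient.mk J a)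
  have := isAdicComplete_of_finite (M := S) (maximalIdeal A)
  have : IsAdicComplete J S := (IsAdicComplete.map_algebraMap_iff ..).2 this
  refine ⟨k, hk, exists_isIdempotentElem_of_isAdicComplete J ?_⟩
  rw [← Ideal.Quotient.eq, map_pow, map_pow, sq]
  exact hid

/-- `S / XS` is finite over `A`, so the property holds there, and the idempotent lifts since `S` is
`X`-adically complete. Only completeness in one variable is used at each stage. -/
theorem PowersLiftToIdempotents.powerSeries {A : Type v} [CommRing A] [IsLocalRing A]
    [IsNoetherianRing A] (h : PowersLiftToIdempotents.{u, v} A) :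
    PowersLiftToIdempotents.{u, v} (PowerSeries A) := by
  intro S _ _ _ a
  set I : Ideal (PowerSeries A) := Ideal.span {PowerSeries.X}
  set J := I.map (algebraMap (PowerSeries A) S)
  let alg : Algebra A (S ⧸ J) :=
    ((Ideal.Quotient.mk J).comp ((algebraMap (PowerSeries A) S).comp
      (algebraMap A (PowerSeries A)))).toAlgebra
  have : IsScalarTower A (PowerSeries A ⧸ I) (S ⧸ J) := by
    refine ⟨fun x y z => ?_⟩
    obtain ⟨y, rfl⟩ := Ideal.Quotient.mk_surjective y
    obtain ⟨z, rfl⟩ := Ideal.Quotient.mk_surjective z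
    have h1 : x • Ideal.Quotient.mk I y = Ideal.Quotient.mk I (algebraMap A _ x * y) := by
      rw [← Algebra.smul_def]
      rfl
    rw [h1, Algebra.smul_def, Algebra.smul_def, Algebra.smul_def, ← mul_assoc]
    congr 1
    change Ideal.Quotient.mk J (algebraMap (PowerSeries A) S _) =
      Ideal.Quotient.mk J (algebraMap (PowerSeries A) S _) *
        Ideal.Quotient.mk J (algebraMap (PowerSeries A) S _)
    rw [map_mul, map_mul]
  have : Module.Finite A (PowerSeries A ⧸ I) := by
    refine Module.Finite.of_surjective (Algebra.linearMap A (PowerSeries A ⧸ I)) fun f => ?_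
    obtain ⟨f, rfl⟩ := Ideal.Quotient.mk_surjective f
    refine ⟨PowerSeries.constantCoeff f, ?_⟩
    refine Eq.symm (Ideal.Quotient.eq.2 (Ideal.mem_span_singleton.2 ?_))
    rw [PowerSeries.X_dvd_iff]
    simp
  have : Module.Finite A (S ⧸ J) := Module.Finite.trans (PowerSeries A ⧸ I) (S ⧸ J)
  obtain ⟨k, hk, e₁, he₁, hek⟩ := h (S ⧸ J) (Ideal.Quotient.mk J a)
  obtain ⟨c, rfl⟩ := Ideal.Quotient.mk_surjective e₁
  have := isAdicComplete_of_finite (M := S) I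
  have : IsAdicComplete J S := (IsAdicComplete.map_algebraMap_iff ..).2 this
  obtain ⟨e, he, hec⟩ := exists_isIdempotentElem_of_isAdicComplete J (b := c) (by
    rw [← Ideal.Quotient.eq, map_pow, sq]
    exact he₁)
  refine ⟨k, hk, e, he, ?_⟩
  have hJ : J ≤ (maximalIdeal (PowerSeries A)).map (algebraMap (PowerSeries A) S) := by
    refine Ideal.map_mono ?_
    rw [Ideal.span_le, Set.singleton_subset_iff]
    exact X_mem_maximalIdeal
  rw [← sub_add_sub_cancel e c]
  refine add_mem (hJ hec) ?_
  have h2 : (maximalIdeal A).map (algebraMap A (S ⧸ J)) ≤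
      ((maximalIdeal (PowerSeries A)).map (algebraMap (PowerSeries A) S)).map
        (Ideal.Quotient.mk J) := by
    rw [Ideal.map_le_iff_le_comap]
    intro x hx
    refine Ideal.mem_map_of_mem _ (Ideal.mem_map_of_mem _ ?_)
    rw [mem_maximalIdeal, mem_nonunits_iff, PowerSeries.isUnit_iff_constantCoeff]
    simpa using! hx
  have h3 := h2 hek
  rw [← map_pow, ← map_sub, Ideal.mem_quotient_iff_mem hJ] at h3
  exact h3

theorem PowersLiftToIdempotents.of_ringEquiv {A B : Type v} [CommRing A] [IsLocalRing A]
    [CommRing B] [IsLocalRing B] (f : A ≃+* B) (h : PowersLiftToIdempotents.{u, v} A) :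
    PowersLiftToIdempotents.{u, v} B := by
  intro S _ _ _ a
  let alg : Algebra A S := ((algebraMap B S).comp f.toRingHom).toAlgebra
  let alg' : Algebra A B := f.toRingHom.toAlgebra
  have : IsScalarTower A B S := IsScalarTower.of_algebraMap_eq fun _ => rfl
  have : Module.Finite A B := Module.Finite.of_surjective (Algebra.linearMap A B) f.surjective
  have : Module.Finite A S := Module.Finite.trans B S
  obtain ⟨k, hk, e, he, hek⟩ := h S a
  refine ⟨k, hk, e, he, ?_⟩
  refine Ideal.map_le_iff_le_comap.2 (fun x hx => ?_) hek
  refine Ideal.mem_map_of_mem (algebraMap B S) (x := f x) ?_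
  rw [mem_maximalIdeal, mem_nonunits_iff] at hx ⊢
  simpa using hx

theorem powersLiftToIdempotents_mvPowerSeries (p : ℕ) [Fact p.Prime] (n : ℕ) :
    PowersLiftToIdempotents.{u, 0} (MvPowerSeries (Fin n) ℤ_[p]) := by
  induction n with
  | zero =>
    have : Finite (ResidueField ℤ_[p]) := Finite.of_equiv _ PadicInt.residueField.symm.toEquiv
    exact (powersLiftToIdempotents_of_isAdicComplete ℤ_[p]).of_ringEquiv
      (MvPowerSeries.isEmptyEquiv ..).symm.toRingEquiv
  | succ n ih => exact ih.powerSeries.of_ringEquiv (MvPowerSeries.finSuccEquiv ..).symm.toRingEquiv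

/-- In a domain the idempotent is `0` or `1`. For `a` in one maximal ideal but not in another, a
power of `a` would be `0` or `1` modulo an ideal contained in both, which is impossible either way.
-/
theorem PowersLiftToIdempotents.isLocalRing {A : Type v} [CommRing A] [IsLocalRing A]
    (h : PowersLiftToIdempotents.{u, v} A) (S : Type u) [CommRing S] [IsDomain S] [Algebra A S]
    [Module.Finite A S] : IsLocalRing S := by
  obtain ⟨M₁, hM₁⟩ := Ideal.exists_maximal S
  refine IsLocalRing.of_unique_max_ideal ⟨M₁, hM₁, fun M₂ hM₂ => ?_⟩
  by_contra hne
  obtain ⟨a, ha₂, ha₁⟩ : ∃ a ∈ M₂, a ∉ M₁ := by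
    by_contra! hle
    exact hne (hM₂.eq_of_le hM₁.ne_top hle)
  have hle : ∀ M : Ideal S, M.IsMaximal → (maximalIdeal A).map (algebraMap A S) ≤ M := by
    intro M hM
    rw [Ideal.map_le_iff_le_comap, ← eq_maximalIdeal
        (Ideal.isMaximal_comap_of_isIntegral_of_isMaximal M)]
  obtain ⟨k, hk, e, he, hek⟩ := h S a
  rcases IsIdempotentElem.iff_eq_zero_or_one.1 he with rfl | rfl
  · have := hle M₁ hM₁ hek
    rw [zero_sub, neg_mem_iff] at this
    exact ha₁ (hM₁.isPrime.mem_of_pow_mem _ this)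
  · have h1 := add_mem (hle M₂ hM₂ hek) (Ideal.pow_mem_of_mem _ ha₂ k (Nat.pos_of_ne_zero hk))
    rw [sub_add_cancel] at h1
    exact hM₂.ne_top ((Ideal.eq_top_iff_one _).2 h1)

end Idempotents

/-! ### Independence of `Tor_1` from the projective presentation -/

section TorPresentation

variable {T : Type*} (R : Type*) [CommRing T] [CommRing R] [Algebra T R]
  {M E F K L : Type*} [AddCommGroup M] [Module T M] [AddCommGroup E] [Module T E]
  [AddCommGroup F] [Module T F] [AddCommGroup K] [Module T K] [AddCommGroup L] [Module T L]

theorem exists_comparison {i : K →ₗ[T] F} {q : F →ₗ[T] M} {j : L →ₗ[T] E} {π : E →ₗ[T] M}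
    (hq : Function.Exact i q) (hj : Function.Injective j) (hπ : Function.Exact j π) {α : F →ₗ[T] E}
    (hα : π ∘ₗ α = q) : ∃ k : K →ₗ[T] L, j ∘ₗ k = α ∘ₗ i := by
  have hmem : ∀ x, α (i x) ∈ LinearMap.range j := fun x =>
    (hπ _).1 (by rw [← LinearMap.comp_apply, hα, hq.apply_apply_eq_zero])
  refine ⟨(LinearEquiv.ofInjective j hj).symm.toLinearMap ∘ₗ
    (α ∘ₗ i).codRestrict (LinearMap.range j) hmem, ?_⟩
  ext x
  have := LinearEquiv.apply_symm_apply (LinearEquiv.ofInjective j hj) ⟨α (i x), hmem x⟩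
  exact congrArg Subtype.val this

/-- Since `γ` lifts the identity of `M`, `γ - id` takes values in `K` and is the homotopy. After
base change, `k` is then the identity on the kernel of `i`. -/
theorem exists_homotopy {i : K →ₗ[T] F} {q : F →ₗ[T] M} (hi : Function.Injective i)
    (hq : Function.Exact i q) {γ : F →ₗ[T] F} (hγ : q ∘ₗ γ = q) {k : K →ₗ[T] K}
    (hk : i ∘ₗ k = γ ∘ₗ i) : ∃ h : F →ₗ[T] K, k - LinearMap.id = h ∘ₗ i := by
  have hmem : ∀ x, (γ - LinearMap.id : F →ₗ[T] F) x ∈ LinearMap.range i := fun x =>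
    (hq _).1 (by
      rw [LinearMap.sub_apply, map_sub, ← LinearMap.comp_apply, hγ, LinearMap.id_apply, sub_self])
  refine ⟨(LinearEquiv.ofInjective i hi).symm.toLinearMap ∘ₗ
    (γ - LinearMap.id : F →ₗ[T] F).codRestrict (LinearMap.range i) hmem, ?_⟩
  ext x
  apply hi
  have := congrArg Subtype.val
    (LinearEquiv.apply_symm_apply (LinearEquiv.ofInjective i hi) ⟨_, hmem (i x)⟩)
  refine Eq.trans ?_ this.symm
  simpa using LinearMap.congr_fun hk x

/-- The kernel of `R ⊗ K → R ⊗ F` depends only on `M`, for projective presentations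
`0 → K → F → M → 0`. -/
theorem nonempty_ker_baseChange_equiv [Module.Projective T F] [Module.Projective T E]
    {i : K →ₗ[T] F} {q : F →ₗ[T] M} {j : L →ₗ[T] E} {π : E →ₗ[T] M}
    (hi : Function.Injective i) (hq : Function.Exact i q) (hqs : Function.Surjective q)
    (hj : Function.Injective j) (hπ : Function.Exact j π) (hπs : Function.Surjective π) :
    Nonempty (LinearMap.ker (i.baseChange R) ≃ₗ[R] LinearMap.ker (j.baseChange R)) := by
  obtain ⟨α, hα⟩ := Module.projective_lifting_property π q hπs
  obtain ⟨β, hβ⟩ := Module.projective_lifting_property q π hqs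
  obtain ⟨k, hk⟩ := exists_comparison hq hj hπ hα
  obtain ⟨l, hl⟩ := exists_comparison hπ hi hq hβ
  obtain ⟨h₁, hh₁⟩ := exists_homotopy hi hq (γ := β ∘ₗ α) (k := l ∘ₗ k)
    (by rw [← LinearMap.comp_assoc, hβ, hα])
    (by rw [← LinearMap.comp_assoc, hl, LinearMap.comp_assoc, hk, LinearMap.comp_assoc])
  obtain ⟨h₂, hh₂⟩ := exists_homotopy hj hπ (γ := α ∘ₗ β) (k := k ∘ₗ l)
    (by rw [← LinearMap.comp_assoc, hα, hβ])
    (by rw [← LinearMap.comp_assoc, hk, LinearMap.comp_assoc, hl, LinearMap.comp_assoc])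
  have hmaps : ∀ x ∈ LinearMap.ker (i.baseChange R),
      k.baseChange R x ∈ LinearMap.ker (j.baseChange R) := by
    intro x hx
    rw [LinearMap.mem_ker] at hx ⊢
    rw [← LinearMap.comp_apply, ← LinearMap.baseChange_comp, hk, LinearMap.baseChange_comp,
      LinearMap.comp_apply, hx, map_zero]
  have hmaps' : ∀ x ∈ LinearMap.ker (j.baseChange R),
      l.baseChange R x ∈ LinearMap.ker (i.baseChange R) := by
    intro x hx
    rw [LinearMap.mem_ker] at hx ⊢
    rw [← LinearMap.comp_apply, ← LinearMap.baseChange_comp, hl, LinearMap.baseChange_comp,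
      LinearMap.comp_apply, hx, map_zero]
  refine ⟨LinearEquiv.ofLinearMap ((k.baseChange R).restrict hmaps)
      ((l.baseChange R).restrict hmaps')
    ?_ ?_⟩
  · ext x
    have h3 := congrArg (fun g => LinearMap.baseChange R g x.1) hh₂
    simp only [LinearMap.baseChange_sub, LinearMap.baseChange_comp, LinearMap.sub_apply,
      LinearMap.comp_apply, LinearMap.baseChange_id, LinearMap.id_apply,
      LinearMap.mem_ker.1 x.2, map_zero] at h3
    exact sub_eq_zero.1 h3
  · ext x
    have h3 := congrArg (fun g => LinearMap.baseChange R g x.1) hh₁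
    simp only [LinearMap.baseChange_sub, LinearMap.baseChange_comp, LinearMap.sub_apply,
      LinearMap.comp_apply, LinearMap.baseChange_id, LinearMap.id_apply,
      LinearMap.mem_ker.1 x.2, map_zero] at h3
    exact sub_eq_zero.1 h3

/-- The homology at the middle of `R ⊗ E₂ → R ⊗ E₁ → R ⊗ E₀`, for an exact sequence
`E₂ → E₁ → E₀`, is the kernel of `R ⊗ L → R ⊗ E₀`, where `L` is the image of `E₁ → E₀`. -/
theorem exists_ker_baseChange_range {E₂ E₁ : Type*} [AddCommGroup E₂] [Module T E₂]
    [AddCommGroup E₁] [Module T E₁] {d₂ : E₂ →ₗ[T] E₁} {d₁ : E₁ →ₗ[T] E}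
    (hd : Function.Exact d₂ d₁) :
    ∃ ψ : LinearMap.ker (d₁.baseChange R) →ₗ[R]
        LinearMap.ker ((LinearMap.range d₁).subtype.baseChange R),
      Function.Surjective ψ ∧ ∀ x, ψ x = 0 ↔ x.1 ∈ LinearMap.range (d₂.baseChange R) := by
  have hu : Function.Surjective d₁.rangeRestrict := d₁.surjective_rangeRestrict
  have hex : Function.Exact d₂ d₁.rangeRestrict := by
    intro x
    rw [← hd x, ← Subtype.val_inj]
    rfl
  have hexR : Function.Exact (d₂.baseChange R) (d₁.rangeRestrict.baseChange R) :=
    lTensor_exact R hex hu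
  have huR : Function.Surjective (d₁.rangeRestrict.baseChange R) :=
    LinearMap.lTensor_surjective R hu
  have hcomp : ∀ x, (LinearMap.range d₁).subtype.baseChange R (d₁.rangeRestrict.baseChange R x) =
      d₁.baseChange R x := by
    intro x
    rw [← LinearMap.comp_apply, ← LinearMap.baseChange_comp]
    rfl
  let ψ := (d₁.rangeRestrict.baseChange R).restrict (p := LinearMap.ker (d₁.baseChange R))
    (q := LinearMap.ker ((LinearMap.range d₁).subtype.baseChange R)) fun x hx => by
      rw [LinearMap.mem_ker] at hx ⊢
      rw [hcomp, hx]
  have hψ : Function.Surjective ψ := by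
    intro y
    obtain ⟨x, hx⟩ := huR y.1
    exact ⟨⟨x, by rw [LinearMap.mem_ker, ← hcomp, hx]; exact y.2⟩, Subtype.ext hx⟩
  refine ⟨ψ, hψ, fun x => ?_⟩
  rw [← Subtype.val_inj]
  exact hexR x.1

end TorPresentation

/-! ### The derived functor `Tor_1` computed from a presentation -/

section Tor

open CategoryTheory

/-- For the algebra structure `f.toAlgebra`, extension of scalars is the tensor product by
definition, so the identity serves. A given structure is reached by rewriting. -/
theorem exists_extendScalars_equiv_toAlgebra {T R : Type u} [CommRing T] [CommRing R]
    (f : T →+* R) :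
    letI := f.toAlgebra
    ∃ τ : ∀ N : ModuleCat.{u} T, (ModuleCat.extendScalars.{u, u, u} f).obj N ≃ₗ[R] R ⊗[T] N,
      ∀ (N N' : ModuleCat.{u} T) (g : N ⟶ N') (x : (ModuleCat.extendScalars.{u, u, u} f).obj N),
        τ N' ((ModuleCat.extendScalars.{u, u, u} f).map g x) = g.hom.baseChange R (τ N x) := by
  let alg := f.toAlgebra
  exact ⟨fun N => LinearEquiv.refl R ((ModuleCat.extendScalars.{u, u, u} f).obj N),
    fun N N' g x => rfl⟩

theorem exists_extendScalars_equiv (T R : Type u) [CommRing T] [CommRing R] [alg : Algebra T R] :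
    ∃ τ : ∀ N : ModuleCat.{u} T,
      (ModuleCat.extendScalars.{u, u, u} (algebraMap T R)).obj N ≃ₗ[R] R ⊗[T] N,
      ∀ (N N' : ModuleCat.{u} T) (g : N ⟶ N')
        (x : (ModuleCat.extendScalars.{u, u, u} (algebraMap T R)).obj N),
        τ N' ((ModuleCat.extendScalars.{u, u, u} (algebraMap T R)).map g x) =
          g.hom.baseChange R (τ N x) := by
  have h := exists_extendScalars_equiv_toAlgebra (algebraMap T R)
  have halg : (algebraMap T R).toAlgebra = alg := Algebra.algebra_ext _ _ fun _ => rfl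
  rw [halg] at h
  exact h

theorem nonempty_equiv_of_ker_eq {R X Y Z : Type*} [Ring R] [AddCommGroup X] [AddCommGroup Y]
    [AddCommMonoid Z] [Module R X] [Module R Y] [Module R Z] (f : X →ₗ[R] Y) (g : X →ₗ[R] Z)
    (hf : Function.Surjective f) (hg : Function.Surjective g) (h : ∀ x, f x = 0 ↔ g x = 0) :
    Nonempty (Y ≃ₗ[R] Z) :=
  letI : AddCommGroup Z := Module.addCommMonoidToAddCommGroup R
  ⟨(f.quotKerEquivOfSurjective hf).symm.trans
    ((Submodule.quotEquivOfEq _ _ (Submodule.ext h)).trans (g.quotKerEquivOfSurjective hg))⟩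

theorem nonempty_homology_equiv_of_surjective {R : Type u} [CommRing R]
    (S : ShortComplex (ModuleCat.{u} R)) {Z : Type u} [AddCommMonoid Z] [Module R Z]
    (g : LinearMap.ker S.g.hom →ₗ[R] Z) (hg : Function.Surjective g)
    (h : ∀ x, g x = 0 ↔ x.1 ∈ LinearMap.range S.f.hom) : Nonempty (S.homology ≃ₗ[R] Z) := by
  have hex : Function.Exact S.moduleCatLeftHomologyData.f'.hom S.moduleCatLeftHomologyData.π.hom :=
    (ShortComplex.ShortExact.moduleCat_exact_iff_function_exact _).1
      (ShortComplex.exact_of_g_is_cokernel (ShortComplex.mk _ _ S.moduleCatLeftHomologyData.wπ)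
        S.moduleCatLeftHomologyData.hπ)
  obtain ⟨e⟩ := nonempty_equiv_of_ker_eq S.moduleCatLeftHomologyData.π.hom g
    ((ModuleCat.epi_iff_surjective _).1 inferInstance) hg fun x => by
      refine Iff.trans ?_ (h x).symm
      refine (hex x).trans ⟨?_, ?_⟩
      · rintro ⟨z, rfl⟩
        exact ⟨z, rfl⟩
      · rintro ⟨z, hz⟩
        exact ⟨z, Subtype.ext hz⟩
  exact ⟨S.moduleCatHomologyIso.toLinearEquiv.trans e⟩

theorem nonempty_homology_equiv {T R : Type u} [CommRing T] [CommRing R] [Algebra T R]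
    (S : ShortComplex (ModuleCat.{u} T)) (hS : Function.Exact S.f.hom S.g.hom)
    (S' : ShortComplex (ModuleCat.{u} R)) (τ₁ : S'.X₁ ≃ₗ[R] R ⊗[T] S.X₁)
    (τ₂ : S'.X₂ ≃ₗ[R] R ⊗[T] S.X₂) (τ₃ : S'.X₃ ≃ₗ[R] R ⊗[T] S.X₃)
    (hf : ∀ x, τ₂ (S'.f.hom x) = S.f.hom.baseChange R (τ₁ x))
    (hg : ∀ x, τ₃ (S'.g.hom x) = S.g.hom.baseChange R (τ₂ x)) :
    Nonempty (S'.homology ≃ₗ[R]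
      LinearMap.ker ((LinearMap.range S.g.hom).subtype.baseChange R)) := by
  obtain ⟨ψ, hψ, hψ0⟩ := exists_ker_baseChange_range R hS
  let ρ : LinearMap.ker S'.g.hom →ₗ[R] LinearMap.ker (S.g.hom.baseChange R) :=
    τ₂.toLinearMap.restrict fun x hx => by
      rw [LinearMap.mem_ker] at hx ⊢
      rw [LinearEquiv.coe_coe, ← hg, hx, map_zero]
  have hρ : Function.Surjective ρ := by
    intro y
    refine ⟨⟨τ₂.symm y.1, ?_⟩, Subtype.ext (τ₂.apply_symm_apply y.1)⟩
    rw [LinearMap.mem_ker]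
    apply τ₃.injective
    rw [map_zero, hg, LinearEquiv.apply_symm_apply]
    exact y.2
  let g := ψ ∘ₗ ρ
  refine nonempty_homology_equiv_of_surjective S' g (hψ.comp hρ) fun x => ?_
  rw [LinearMap.comp_apply, hψ0]
  constructor
  · rintro ⟨z, hz⟩
    refine ⟨τ₁.symm z, τ₂.injective ?_⟩
    rw [hf, LinearEquiv.apply_symm_apply]
    exact hz
  · rintro ⟨z, hz⟩
    exact ⟨τ₁ z, by rw [← hf, hz]; rfl⟩

theorem nonempty_homology_extendScalars_equiv {T R : Type u} [CommRing T] [CommRing R]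
    [Algebra T R] (S : ShortComplex (ModuleCat.{u} T)) (hS : Function.Exact S.f.hom S.g.hom) :
    Nonempty ((S.map (ModuleCat.extendScalars.{u, u, u} (algebraMap T R))).homology ≃ₗ[R]
      LinearMap.ker ((LinearMap.range S.g.hom).subtype.baseChange R)) := by
  obtain ⟨τ, hτ⟩ := exists_extendScalars_equiv T R
  exact nonempty_homology_equiv S hS _ (τ S.X₁) (τ S.X₂) (τ S.X₃) (hτ _ _ S.f) (hτ _ _ S.g)

/-- `Tor_1(R, M)` is the kernel of `R ⊗ K → R ⊗ F` for every short exact sequence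
`0 → K → F → M → 0` with `F` projective. -/
theorem nonempty_torOne_equiv {T R : Type u} [CommRing T] [CommRing R] [Algebra T R]
    {M F K : Type u} [AddCommGroup M] [Module T M] [AddCommGroup F] [Module T F] [AddCommGroup K]
    [Module T K] [Module.Projective T F] {i : K →ₗ[T] F} {q : F →ₗ[T] M}
    (hi : Function.Injective i) (hq : Function.Exact i q) (hqs : Function.Surjective q) :
    Nonempty (TorOne T R M ≃ₗ[R] LinearMap.ker (i.baseChange R)) := by
  let P := projectiveResolution (ModuleCat.of T M)
  let Φ := ModuleCat.extendScalars.{u, u, u} (algebraMap T R)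
  have e₁ := (P.isoLeftDerivedObj Φ 1).toLinearEquiv
  have e₂ := (((Φ.mapHomologicalComplex (ComplexShape.down ℕ)).obj P.complex).homologyIsoSc' 2 1 0
    (by simp) (by simp)).toLinearEquiv
  let π : P.complex.X 0 →ₗ[T] M := (P.π.f 0).hom
  have hπ : Function.Exact (P.complex.d 1 0).hom π :=
    (ShortComplex.ShortExact.moduleCat_exact_iff_function_exact _).1
      (ShortComplex.exact_of_g_is_cokernel
        (ShortComplex.mk (P.complex.d 1 0) (P.π.f 0) P.complex_d_comp_π_f_zero)
        P.isColimitCokernelCofork)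
  have hπs : Function.Surjective π := (ModuleCat.epi_iff_surjective (P.π.f 0)).1 inferInstance
  have hproj : Module.Projective T (P.complex.X 0) :=
    (IsProjective.iff_projective _).2 (P.projective 0)
  have hπ' : Function.Exact (LinearMap.range (P.complex.d 1 0).hom).subtype π := by
    intro x
    rw [hπ x]
    simp
  obtain ⟨e₄⟩ := nonempty_homology_extendScalars_equiv (R := R) (P.complex.sc' 2 1 0)
    ((ShortComplex.ShortExact.moduleCat_exact_iff_function_exact _).1 (P.exact_succ 0))
  -- The image of `P₁ → P₀` is a first syzygy of `M`, to be compared with `K`.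
  obtain ⟨e₅⟩ := nonempty_ker_baseChange_equiv R
    (LinearMap.range (P.complex.d 1 0).hom).injective_subtype hπ' hπs hi hq hqs
  exact ⟨(e₁.trans e₂).trans (e₄.trans e₅)⟩

end Tor

/-! ### Divisors and `Tor_1` over a two-dimensional regular local ring -/

section RegularLocal

open IsLocalRing

theorem tmul_one_surjective {A B : Type*} [CommRing A] [CommRing B] [Algebra A B]
    (hAB : Function.Surjective (algebraMap A B)) (N : Type*) [AddCommGroup N] [Module A N] :
    Function.Surjective (TensorProduct.mk A B N 1) := by
  intro z
  induction z with
  | zero => exact ⟨0, map_zero _⟩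
  | add a b ha hb =>
    obtain ⟨a', rfl⟩ := ha
    obtain ⟨b', rfl⟩ := hb
    exact ⟨a' + b', map_add _ _ _⟩
  | tmul b n =>
    obtain ⟨a, rfl⟩ := hAB b
    refine ⟨a • n, ?_⟩
    rw [TensorProduct.mk_apply, TensorProduct.tmul_smul, TensorProduct.smul_tmul',
      Algebra.smul_def, mul_one]

theorem tmul_one_eq_zero_iff {A B : Type*} [CommRing A] [CommRing B] [Algebra A B]
    (hAB : Function.Surjective (algebraMap A B)) {f : A}
    (hf : RingHom.ker (algebraMap A B) = Ideal.span {f}) {N : Type*} [AddCommGroup N] [Module A N]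
    (n : N) : (1 : B) ⊗ₜ[A] n = 0 ↔ ∃ n', n = f • n' := by
  have hex : Function.Exact (LinearMap.lsmul A A f) (Algebra.linearMap A B) := by
    intro a
    rw [Algebra.linearMap_apply, ← RingHom.mem_ker, hf, Ideal.mem_span_singleton]
    exact ⟨fun ⟨c, hc⟩ => ⟨c, hc.symm⟩, fun ⟨c, hc⟩ => ⟨c, hc.symm⟩⟩
  have h := rTensor_exact N hex hAB ((1 : A) ⊗ₜ n)
  rw [LinearMap.rTensor_tmul, Algebra.linearMap_apply, map_one] at h
  rw [h]
  constructor
  · rintro ⟨z, hz⟩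
    refine ⟨TensorProduct.lid A N z, ?_⟩
    have h2 := congrArg (TensorProduct.lid A N) hz
    rw [TensorProduct.lid_tmul, one_smul] at h2
    rw [← h2]
    have h3 : (TensorProduct.lid A N).toLinearMap ∘ₗ (LinearMap.lsmul A A f).rTensor N =
        LinearMap.lsmul A N f ∘ₗ (TensorProduct.lid A N).toLinearMap := by
      ext
      simp
    exact LinearMap.congr_fun h3 z
  · rintro ⟨n', rfl⟩
    exact ⟨1 ⊗ₜ n', by simp [TensorProduct.tmul_smul, TensorProduct.smul_tmul']⟩

variable {A B : Type*} [CommRing A] [CommRing B] [Algebra A B]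

/-- `Tor_1(A / f, M)` is the `f`-torsion of `M`. -/
theorem length_ker_baseChange_eq_torsionBy (hAB : Function.Surjective (algebraMap A B)) {f : A}
    (hf : RingHom.ker (algebraMap A B) = Ideal.span {f}) {M F K : Type*} [AddCommGroup M]
    [Module A M] [AddCommGroup F] [Module A F] [AddCommGroup K] [Module A K] {i : K →ₗ[A] F}
    {π : F →ₗ[A] M} (hi : Function.Injective i) (hex : Function.Exact i π)
    (hπ : Function.Surjective π) (hF : ∀ x : F, f • x = 0 → x = 0) :
    Module.length B (LinearMap.ker (i.baseChange B)) =
      Module.length A (Submodule.torsionBy A M f) := by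
  -- `X = {x | f • x ∈ K}` maps onto the `f`-torsion of `M` by `x ↦ π x` and onto the kernel by `x ↦
  -- 1 ⊗ f • x`. Both maps vanish exactly on `K`.
  let X : Submodule A F := (LinearMap.range i).comap (LinearMap.lsmul A F f)
  have hX : ∀ x : F, x ∈ X ↔ π (f • x) = 0 := fun x => (hex _).symm
  let g₁ : X →ₗ[A] Submodule.torsionBy A M f :=
    (π ∘ₗ X.subtype).codRestrict _ fun x => by
      rw [Submodule.mem_torsionBy_iff, LinearMap.comp_apply, ← map_smul]
      exact (hX _).1 x.2
  have hg₁ : Function.Surjective g₁ := by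
    rintro ⟨m, hm⟩
    obtain ⟨x, rfl⟩ := hπ m
    exact ⟨⟨x, (hX x).2 (by rw [map_smul]; exact hm)⟩, rfl⟩
  let k : X →ₗ[A] K := (LinearEquiv.ofInjective i hi).symm.toLinearMap ∘ₗ
    (LinearMap.lsmul A F f ∘ₗ X.subtype).codRestrict (LinearMap.range i) fun x => x.2
  have hk : ∀ x : X, i (k x) = f • x.1 := fun x =>
    congrArg Subtype.val ((LinearEquiv.ofInjective i hi).apply_symm_apply ⟨f • x.1, x.2⟩)
  let g₂ : X →ₗ[A] (LinearMap.ker (i.baseChange B)).restrictScalars A :=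
    (TensorProduct.mk A B K 1 ∘ₗ k).codRestrict _ fun x => by
      rw [Submodule.restrictScalars_mem, LinearMap.mem_ker, LinearMap.comp_apply,
        TensorProduct.mk_apply, LinearMap.baseChange_tmul, tmul_one_eq_zero_iff hAB hf]
      exact ⟨x.1, hk x⟩
  have hg₂ : Function.Surjective g₂ := by
    rintro ⟨z, hz⟩
    obtain ⟨w, rfl⟩ := tmul_one_surjective hAB K z
    rw [Submodule.restrictScalars_mem, LinearMap.mem_ker, TensorProduct.mk_apply,
      LinearMap.baseChange_tmul, tmul_one_eq_zero_iff hAB hf] at hz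
    obtain ⟨x, hx⟩ := hz
    refine ⟨⟨x, ⟨w, hx⟩⟩, Subtype.ext ?_⟩
    refine congrArg (TensorProduct.mk A B K 1) (hi ?_)
    rw [hk, hx]
  obtain ⟨e⟩ := nonempty_equiv_of_ker_eq g₁ g₂ hg₁ hg₂ fun x => by
    rw [← Subtype.val_inj, ← Subtype.val_inj]
    change π x.1 = 0 ↔ (1 : B) ⊗ₜ[A] k x = 0
    rw [tmul_one_eq_zero_iff hAB hf, hex]
    constructor
    · rintro ⟨w, hw⟩
      exact ⟨w, hi (by rw [hk, map_smul, hw])⟩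
    · rintro ⟨w, hw⟩
      refine ⟨w, sub_eq_zero.1 (hF _ ?_)⟩
      rw [smul_sub, ← hk, hw, map_smul, sub_self]
  rw [← Module.length_eq_of_surjective (S := A) (R := B) hAB]
  exact e.length_eq.symm

/-- Multiplication by `f` on a module of finite length has kernel and cokernel of equal length. -/
theorem length_baseChange_eq_torsionBy (hAB : Function.Surjective (algebraMap A B)) {f : A}
    (hf : RingHom.ker (algebraMap A B) = Ideal.span {f}) {M : Type*} [AddCommGroup M]
    [Module A M] (hM : Module.length A M ≠ ⊤) :
    Module.length B (B ⊗[A] M) = Module.length A (Submodule.torsionBy A M f) := by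
  have h1 : Module.length A M = Module.length A (Submodule.torsionBy A M f) +
      Module.length A (LinearMap.range (LinearMap.lsmul A M f)) :=
    Module.length_eq_add_of_exact (Submodule.torsionBy A M f).subtype
      (LinearMap.lsmul A M f).rangeRestrict (Submodule.injective_subtype _)
      (LinearMap.surjective_rangeRestrict _) (by
        intro x
        rw [← Subtype.val_inj]
        simp)
  have h2 : Module.length A M = Module.length A (LinearMap.range (LinearMap.lsmul A M f)) +
      Module.length A (B ⊗[A] M) :=
    Module.length_eq_add_of_exact (LinearMap.range (LinearMap.lsmul A M f)).subtype
      (TensorProduct.mk A B M 1) (Submodule.injective_subtype _)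
      (tmul_one_surjective hAB M) (by
        intro x
        rw [TensorProduct.mk_apply, tmul_one_eq_zero_iff hAB hf]
        simp [eq_comm])
  rw [← Module.length_eq_of_surjective (S := A) (R := B) hAB]
  have h3 : Module.length A (LinearMap.range (LinearMap.lsmul A M f)) ≠ ⊤ :=
    ne_top_of_le_ne_top hM (h1.symm ▸ le_add_self)
  rw [h1, add_comm] at h2
  exact (ENat.add_right_injective_of_ne_top h3 h2).symm

/-- As `f` is injective on `M ⧸ M₀`, reduction modulo `f` keeps `0 → M₀ → M → M ⧸ M₀ → 0` exact, and
all `f`-torsion of `M` lies in `M₀`. -/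
theorem length_baseChange_eq_add_of_torsion (hAB : Function.Surjective (algebraMap A B)) {f : A}
    (hf : RingHom.ker (algebraMap A B) = Ideal.span {f}) {M : Type*} [AddCommGroup M]
    [Module A M] (M₀ : Submodule A M) (hM₀ : Module.length A M₀ ≠ ⊤)
    (hinj : ∀ m : M, f • m ∈ M₀ → m ∈ M₀) :
    Module.length B (B ⊗[A] M) = Module.length A (Submodule.torsionBy A M f) +
      Module.length B (B ⊗[A] (M ⧸ M₀)) := by
  have h1 : Module.length B (B ⊗[A] M) = Module.length B (B ⊗[A] M₀) +
      Module.length B (B ⊗[A] (M ⧸ M₀)) := by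
    refine Module.length_eq_add_of_exact (M₀.subtype.baseChange B) (M₀.mkQ.baseChange B) ?_
      (LinearMap.lTensor_surjective B M₀.mkQ_surjective)
      (lTensor_exact B (LinearMap.exact_subtype_mkQ M₀) M₀.mkQ_surjective)
    rw [injective_iff_map_eq_zero]
    intro z hz
    obtain ⟨m, rfl⟩ := tmul_one_surjective hAB M₀ z
    rw [TensorProduct.mk_apply, LinearMap.baseChange_tmul, tmul_one_eq_zero_iff hAB hf] at hz
    obtain ⟨m', hm'⟩ := hz
    rw [TensorProduct.mk_apply, tmul_one_eq_zero_iff hAB hf]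
    exact ⟨⟨m', hinj m' (hm' ▸ m.2)⟩, Subtype.ext hm'⟩
  rw [h1, length_baseChange_eq_torsionBy hAB hf hM₀]
  congr 1
  obtain ⟨e⟩ : Nonempty (Submodule.torsionBy A M₀ f ≃ₗ[A] Submodule.torsionBy A M f) := by
    refine ⟨LinearEquiv.ofBijective (M₀.subtype.restrict (p := Submodule.torsionBy A M₀ f)
      (q := Submodule.torsionBy A M f) fun x hx => congrArg Subtype.val hx) ⟨?_, ?_⟩⟩
    · intro a b h
      exact Subtype.ext (Subtype.ext (congrArg (fun z => (z.1 : M)) h))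
    · rintro ⟨m, hm⟩
      have hm' : f • m = 0 := hm
      exact ⟨⟨⟨m, hinj m (hm' ▸ M₀.zero_mem)⟩, Subtype.ext hm'⟩, rfl⟩
  exact e.length_eq

/-- A regular system of parameters `f, y` of a two-dimensional regular local ring such that `f`
generates the kernel of a given surjection onto a discrete valuation ring. -/
theorem exists_parameters_of_surjective [IsDomain A] [IsLocalRing A] [IsNoetherianRing A]
    [IsDomain B] [IsDiscreteValuationRing B] (hAB : Function.Surjective (algebraMap A B))
    {u₁ u₂ : A}
    (hu : maximalIdeal A = Ideal.span {u₁, u₂}) (hht : 1 < (maximalIdeal A).height) :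
    ∃ f y : A, maximalIdeal A = Ideal.span {f, y} ∧
      RingHom.ker (algebraMap A B) = Ideal.span {f} ∧ IsRegularPair f y A := by
  have hloc : IsLocalHom (algebraMap A B) := .of_surjective _ hAB
  set k := RingHom.ker (algebraMap A B) with hk
  have hkp : k.IsPrime := RingHom.ker_isPrime _
  have hkm : k ≤ maximalIdeal A := le_maximalIdeal hkp.ne_top
  obtain ⟨ϖ, hϖ⟩ := IsDiscreteValuationRing.exists_irreducible B
  obtain ⟨y, rfl⟩ := hAB ϖ
  have hym : y ∈ maximalIdeal A := by
    rw [mem_maximalIdeal, mem_nonunits_iff]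
    exact fun h => hϖ.1 (h.map _)
  have hyk : y ∉ k := fun h => hϖ.ne_zero h
  have hmB : maximalIdeal B = Ideal.span {algebraMap A B y} := hϖ.maximalIdeal_eq
  have hmk : ∀ z ∈ maximalIdeal A, ∃ a, z - a * y ∈ k := by
    intro z hz
    have h1 : algebraMap A B z ∈ maximalIdeal B := by
      rw [mem_maximalIdeal, mem_nonunits_iff] at hz ⊢
      exact fun h => hz (isUnit_of_map_unit _ _ h)
    rw [hmB, Ideal.mem_span_singleton'] at h1
    obtain ⟨b, hb⟩ := h1
    obtain ⟨a, rfl⟩ := hAB b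
    exact ⟨a, by rw [hk, RingHom.mem_ker, map_sub, map_mul, hb, sub_self]⟩
  have hy2 : ∀ z ∈ maximalIdeal A ^ 2, y - z ∉ k := by
    intro z hz hyz
    rw [hk, RingHom.mem_ker, map_sub, sub_eq_zero] at hyz
    have h1 : algebraMap A B z ∈ maximalIdeal B ^ 2 := by
      have := Ideal.mem_map_of_mem (algebraMap A B) hz
      rw [Ideal.map_pow] at this
      refine Ideal.pow_right_mono ?_ 2 this
      rw [Ideal.map_le_iff_le_comap]
      exact (maximalIdeal_comap (algebraMap A B)).ge
    rw [← hyz, hmB, Ideal.span_singleton_pow, Ideal.mem_span_singleton'] at h1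
    obtain ⟨c, hc⟩ := h1
    refine hϖ.1 (IsUnit.of_mul_eq_one_right c (mul_right_cancel₀ hϖ.ne_zero ?_))
    rw [one_mul, mul_assoc, ← sq, hc]
  -- If `k` were inside the square of the maximal ideal, Nakayama would make `y` a generator of the
  -- maximal ideal, whose height exceeds one.
  obtain ⟨f, hfk, hf2⟩ : ∃ f ∈ k, f ∉ maximalIdeal A ^ 2 := by
    by_contra! hle
    have hmy : maximalIdeal A ≤ Ideal.span {y} := by
      refine Submodule.le_of_le_smul_of_le_jacobson_bot (I := maximalIdeal A)
        (IsNoetherian.noetherian _) (maximalIdeal_le_jacobson _) fun z hz => ?_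
      obtain ⟨a, ha⟩ := hmk z hz
      rw [← add_sub_cancel (a * y) z]
      refine Submodule.add_mem_sup (Ideal.mul_mem_left _ _ (Ideal.mem_span_singleton_self y)) ?_
      rw [smul_eq_mul, ← sq]
      exact hle _ ha
    have h1 : (Ideal.span {y}).height ≤ 1 := by
      exact Ideal.height_span_singleton_le_one ((mem_maximalIdeal y).1 hym)
    exact absurd (hht.trans_le (Ideal.height_mono hmy)) (not_lt_of_ge h1)
  -- Exchange: `f` replaces `u`, then `y` replaces `v`. The second exchange works because `y` is a
  -- uniformizer modulo `k`, so it is not in `k` plus the square of the maximal ideal.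
  have key : ∀ u v a b : A, maximalIdeal A = Ideal.span {u, v} → a * u + b * v = f → IsUnit a →
      maximalIdeal A = Ideal.span {f, y} := by
    rintro u v a b huv hab ⟨a, rfl⟩
    have hfv : maximalIdeal A = Ideal.span {f, v} := by
      refine le_antisymm ?_ (Ideal.span_le.2 (Set.pair_subset (hkm hfk) ?_))
      · rw [huv, Ideal.span_le]
        refine Set.pair_subset (Ideal.mem_span_pair.2 ⟨↑a⁻¹, -(↑a⁻¹ * b), ?_⟩)
          (Ideal.subset_span (by simp))
        rw [← hab, mul_add, ← mul_assoc, Units.inv_mul]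
        ring
      · rw [huv]
        exact Ideal.subset_span (by simp)
    have hvm : v ∈ maximalIdeal A := hfv ▸ Ideal.subset_span (by simp)
    obtain ⟨c, d, hcd⟩ := Ideal.mem_span_pair.1 (hfv ▸ hym)
    have hd : IsUnit d := by
      by_contra hd
      refine hy2 (d * v) (by rw [sq]; exact Ideal.mul_mem_mul hd hvm) ?_
      rw [← hcd, add_sub_cancel_right]
      exact k.mul_mem_left _ hfk
    obtain ⟨d, rfl⟩ := hd
    refine le_antisymm ?_ (Ideal.span_le.2 (Set.pair_subset (hkm hfk) hym))
    rw [hfv, Ideal.span_le]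
    refine Set.pair_subset (Ideal.subset_span (by simp))
      (Ideal.mem_span_pair.2 ⟨-(↑d⁻¹ * c), ↑d⁻¹, ?_⟩)
    rw [← hcd, mul_add, ← mul_assoc _ (d : A), Units.inv_mul]
    ring
  have hfy : maximalIdeal A = Ideal.span {f, y} := by
    obtain ⟨a, b, hab⟩ := Ideal.mem_span_pair.1 (hu ▸ hkm hfk)
    by_cases ha : IsUnit a
    · exact key u₁ u₂ a b hu hab ha
    by_cases hb : IsUnit b
    · exact key u₂ u₁ b a (by rw [hu, Set.pair_comm]) (by rw [add_comm, hab]) hb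
    refine absurd ?_ hf2
    rw [← hab, sq]
    exact add_mem (Ideal.mul_mem_mul ha (hu ▸ Ideal.subset_span (by simp)))
      (Ideal.mul_mem_mul hb (hu ▸ Ideal.subset_span (by simp)))
  have hkf : k = Ideal.span {f} := by
    refine le_antisymm ?_ (by simpa [Ideal.span_le] using hfk)
    refine Submodule.le_of_le_smul_of_le_jacobson_bot (I := maximalIdeal A)
      (IsNoetherian.noetherian _) (maximalIdeal_le_jacobson _) fun g hg => ?_
    obtain ⟨a, b, rfl⟩ := Ideal.mem_span_pair.1 (hfy ▸ hkm hg)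
    refine Submodule.add_mem_sup (Ideal.mul_mem_left _ _ (Ideal.mem_span_singleton_self f)) ?_
    have hb : b * y ∈ k := by
      have := sub_mem hg (k.mul_mem_left a hfk)
      rwa [add_sub_cancel_left] at this
    rw [mul_comm b]
    exact Submodule.smul_mem_smul hym ((hkp.mem_or_mem hb).resolve_right hyk)
  have hf0 : f ≠ 0 := fun h => hf2 (h ▸ zero_mem _)
  refine ⟨f, y, hfy, hkf, ⟨fun a ha => ?_, fun a b hab => ?_⟩⟩
  · exact (mul_eq_zero.1 ha).resolve_left hf0
  · have h1 : y * a ∈ k := by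
      rw [← smul_eq_mul, hab, smul_eq_mul]
      exact k.mul_mem_right _ hfk
    have h2 := (hkp.mem_or_mem h1).resolve_left hyk
    rw [hkf, Ideal.mem_span_singleton] at h2
    exact h2

/-- `M₀` collects the elements killed by a power of the maximal ideal. It vanishes at height one
primes and accounts for the torsion term. `M ⧸ M₀` has positive depth, so its first syzygy is free
over the regular ring and `θ` is the determinant of a square presentation. -/
theorem exists_divisor_of_regular {A B : Type u} [CommRing A] [CommRing B] [Algebra A B]
    [IsDomain A] [IsLocalRing A] [IsNoetherianRing A] [IsIntegrallyClosed A]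
    (hht : 1 < (maximalIdeal A).height)
    [IsDomain B] [IsDiscreteValuationRing B] (hAB : Function.Surjective (algebraMap A B))
    {f y : A} (hm : maximalIdeal A = Ideal.span {f, y})
    (hf : RingHom.ker (algebraMap A B) = Ideal.span {f}) (hreg : IsRegularPair f y A)
    (M : Type u) [AddCommGroup M] [Module A M] [Module.Finite A M] {s : A}
    (hs : algebraMap A B s ≠ 0) (hsM : ∀ m : M, s • m = 0) :
    ∃ θ : A, algebraMap A B θ ≠ 0 ∧
      (∀ (q : Ideal A) [q.IsPrime], q.height = 1 →
        Module.length (Localization.AtPrime q) (Localization.AtPrime q ⊗[A] M) =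
          Ring.ord (Localization.AtPrime q) (algebraMap A _ θ)) ∧
      Module.length B (B ⊗[A] M) = Module.length A (Submodule.torsionBy A M f) +
        Ring.ord B (algebraMap A B θ) := by
  have hs0 : s ≠ 0 := fun h => hs (by rw [h, map_zero])
  have hloc : IsLocalHom (algebraMap A B) := .of_surjective _ hAB
  -- the largest submodule of finite length
  obtain ⟨M₀, k, hk, hM₀⟩ : ∃ (M₀ : Submodule A M) (k : ℕ),
      (∀ a ∈ maximalIdeal A ^ k, ∀ m ∈ M₀, a • m = 0) ∧
      ∀ m j, (∀ a ∈ maximalIdeal A ^ j, a • m ∈ M₀) → m ∈ M₀ := by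
    let N : ℕ →o Submodule A M :=
      { toFun := fun k => Submodule.torsionBySet A M (maximalIdeal A ^ k : Ideal A)
        monotone' := fun i j hij =>
          Submodule.torsionBySet_le_torsionBySet_of_subset (Ideal.pow_le_pow_right hij) }
    have hN : ∀ k m, m ∈ N k ↔ ∀ a ∈ maximalIdeal A ^ k, a • m = 0 := fun k m =>
      (Submodule.mem_torsionBySet_iff _ _).trans ⟨fun h a ha => h ⟨a, ha⟩, fun h a => h a.1 a.2⟩
    obtain ⟨k, hk⟩ := monotone_stabilizes_iff_noetherian.2 (inferInstance : IsNoetherian A M) N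
    refine ⟨N k, k, fun a ha m hm => (hN k m).1 hm a ha, fun m j hm => ?_⟩
    rw [hk (k + j) (Nat.le_add_right k j), hN]
    intro a ha
    rw [pow_add] at ha
    refine Submodule.mul_induction_on ha (fun x hx y hy => ?_) fun x y hx hy => ?_
    · rw [mul_smul]
      exact (hN k _).1 (hm y hy) x hx
    · rw [add_smul, hx, hy, add_zero]
  have hlen : Module.length A M₀ ≠ ⊤ := by
    have htor : Module.IsTorsionBySet A M₀ (maximalIdeal A ^ k : Ideal A) :=
      fun m a => Subtype.ext (hk a.1 a.2 m.1 m.2)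
    let := htor.module
    have : IsScalarTower A (A ⧸ maximalIdeal A ^ k) M₀ := htor.isScalarTower
    rw [Module.length_eq_of_surjective (R := A ⧸ maximalIdeal A ^ k) Ideal.Quotient.mk_surjective]
    have : Ring.KrullDimLE 0 (A ⧸ maximalIdeal A ^ k) := .mk₀ fun I hI => by
      have h1 : maximalIdeal A ≤ I.comap (Ideal.Quotient.mk _) := by
        refine Ideal.IsPrime.le_of_pow_le (n := k) ?_
        conv_lhs => rw [← Ideal.mk_ker (I := maximalIdeal A ^ k), RingHom.ker_eq_comap_bot]
        exact Ideal.comap_mono bot_le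
      have h2 := le_antisymm h1 (le_maximalIdeal (Ideal.comap_ne_top _ hI.ne_top))
      have h3 : (I.comap (Ideal.Quotient.mk (maximalIdeal A ^ k))).IsMaximal :=
        h2 ▸ maximalIdeal.isMaximal A
      have h4 := Ideal.map_eq_top_or_isMaximal_of_surjective
          (Ideal.Quotient.mk (maximalIdeal A ^ k))
        Ideal.Quotient.mk_surjective h3
      rw [Ideal.map_comap_of_surjective _ Ideal.Quotient.mk_surjective] at h4
      exact h4.resolve_left hI.ne_top
    have : IsArtinianRing (A ⧸ maximalIdeal A ^ k) :=
      IsNoetherianRing.isArtinianRing_of_krullDimLE_zero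
    have : Module.Finite (A ⧸ maximalIdeal A ^ k) M₀ := Module.Finite.of_restrictScalars_finite A
        _ _
    exact Module.length_ne_top
  have hfM₀ : ∀ m : M, f • m ∈ M₀ → m ∈ M₀ := by
    intro m hfm
    -- Since `s ≠ 0` in the discrete valuation ring `B = A/(f)`, a power of the maximal ideal of `A`
    -- lies in `(s, f)`. As `s` kills `M`, that power sends `m` into `M₀` once `f • m` is there.
    obtain ⟨j, hj⟩ : ∃ j, maximalIdeal B ^ j ≤ Ideal.span {algebraMap A B s} := by
      obtain ⟨ϖ, hϖ⟩ := IsDiscreteValuationRing.exists_irreducible B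
      obtain ⟨j, hj⟩ := IsDiscreteValuationRing.ideal_eq_span_pow_irreducible
        (s := Ideal.span {algebraMap A B s}) (by simpa using hs) hϖ
      exact ⟨j, by rw [hj, hϖ.maximalIdeal_eq, Ideal.span_singleton_pow]⟩
    refine hM₀ m j fun a ha => ?_
    have h1 : algebraMap A B a ∈ Ideal.span {algebraMap A B s} := by
      have := Ideal.mem_map_of_mem (algebraMap A B) ha
      rw [Ideal.map_pow] at this
      refine hj (Ideal.pow_right_mono ?_ j this)
      rw [Ideal.map_le_iff_le_comap]
      exact (maximalIdeal_comap (algebraMap A B)).ge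
    obtain ⟨c, hc⟩ := Ideal.mem_span_singleton'.1 h1
    obtain ⟨c, rfl⟩ := hAB c
    have h2 : a - c * s ∈ RingHom.ker (algebraMap A B) := by
      rw [RingHom.mem_ker, map_sub, map_mul, hc, sub_self]
    rw [hf, Ideal.mem_span_singleton'] at h2
    obtain ⟨d, hd⟩ := h2
    rw [← sub_add_cancel a (c * s), ← hd, add_smul, mul_smul, mul_smul, hsM, smul_zero, add_zero]
    exact M₀.smul_mem _ hfm
  obtain ⟨n, π, hπ⟩ := Module.Finite.exists_fin' A (M ⧸ M₀)
  have hsY : ∀ z : M ⧸ M₀, s • z = 0 := by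
    intro z
    obtain ⟨m, rfl⟩ := M₀.mkQ_surjective z
    rw [← map_smul, hsM, map_zero]
  have hreg' : IsRegularPair f y (LinearMap.ker π) := (hreg.pi n).ker π fun z hfz _ => by
    obtain ⟨m, rfl⟩ := M₀.mkQ_surjective z
    rw [← map_smul] at hfz
    simp only [Submodule.mkQ_apply, Submodule.Quotient.mk_eq_zero] at hfz ⊢
    exact hfM₀ m hfz
  obtain ⟨φ, hφ⟩ := exists_square_presentation hs0 hsY π (hreg'.free_of_maximalIdeal_eq hm)
  have hdet : algebraMap A B (LinearMap.det φ) ≠ 0 := by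
    intro h
    have := map_dvd (algebraMap A B) (det_dvd_pow hφ hsY)
    rw [h, zero_dvd_iff, map_pow] at this
    exact hs (eq_zero_of_pow_eq_zero this)
  refine ⟨LinearMap.det φ, hdet, fun q hq hq1 => ?_, ?_⟩
  · set C := Localization.AtPrime q
    have hC := isDiscreteValuationRing_of_height_eq_one q hq1 C
    rw [← length_baseChange_eq_ord hπ hφ C (by
      simpa using! (IsLocalization.injective C q.primeCompl_le_nonZeroDivisors).ne
        fun h => hdet (by rw [h, map_zero]))]
    obtain ⟨u, hu, huq⟩ : ∃ u ∈ maximalIdeal A, u ∉ q := by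
      by_contra! hle
      have := le_antisymm hle (le_maximalIdeal hq.ne_top)
      rw [this, hq1] at hht
      exact lt_irrefl _ hht
    have hsub : ∀ z : C ⊗[A] M₀, z = 0 := by
      intro z
      have hunit : IsUnit (algebraMap A C (u ^ k)) :=
        IsLocalization.map_units C (⟨u ^ k, q.primeCompl.pow_mem huq k⟩ : q.primeCompl)
      rw [← hunit.smul_eq_zero]
      induction z with
      | zero => simp
      | add x y hx hy => rw [smul_add, hx, hy, add_zero]
      | tmul c m =>
        rw [algebraMap_smul, ← TensorProduct.tmul_smul]
        have : u ^ k • m = 0 := Subtype.ext (hk _ (Ideal.pow_mem_pow hu k) m.1 m.2)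
        rw [this, TensorProduct.tmul_zero]
    refine (LinearEquiv.ofBijective (M₀.mkQ.baseChange C)
      ⟨?_, LinearMap.lTensor_surjective C M₀.mkQ_surjective⟩).length_eq
    rw [injective_iff_map_eq_zero]
    intro z hz
    obtain ⟨w, rfl⟩ :=
      (lTensor_exact C (LinearMap.exact_subtype_mkQ M₀) M₀.mkQ_surjective z).1 hz
    rw [hsub w, map_zero]
  · rw [length_baseChange_eq_add_of_torsion hAB hf M₀ hlen hfM₀,
      length_baseChange_eq_ord hπ hφ B hdet]

end RegularLocal

/-! ### Divisors of modules of finite projective dimension -/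

section FiniteProjectiveDimension

open IsLocalRing

theorem length_localizedModule_eq_zero {A : Type*} [CommRing A] (S : Submonoid A) {L : Type*}
    [AddCommGroup L] [Module A L] {s : A} (hs : s ∈ S) (hsL : ∀ z : L, s • z = 0) :
    Module.length (Localization S) (LocalizedModule S L) = 0 := by
  have : Subsingleton (LocalizedModule S L) :=
    LocalizedModule.subsingleton_iff.2 fun z => ⟨s, hs, hsL z⟩
  exact Module.length_eq_zero

theorem isPseudoNull_of_smul_eq_zero {A : Type u} [CommRing A] [IsDomain A] [IsNoetherianRing A]
    {L : Type v} [AddCommGroup L] [Module A L] [Module.Finite A L] {x y : A} (hx0 : x ≠ 0)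
    (hxy : ∀ q : Ideal A, q.IsPrime → q.height = 1 → x ∈ q → y ∉ q)
    (hx : ∀ z : L, x • z = 0) (hy : ∀ z : L, y • z = 0) : IsPseudoNull A L := by
  have htor : Module.IsTorsion A L := fun {z} => ⟨⟨x, mem_nonZeroDivisors_of_ne_zero hx0⟩, hx z⟩
  refine ⟨inferInstance, htor, ?_⟩
  ext P
  rw [divisor_apply htor, localLength, Finsupp.zero_apply]
  by_cases hxP : x ∈ P.1.asIdeal
  · rw [length_localizedModule_eq_zero _ (hxy _ P.1.2 P.2 hxP) hy]
    rfl
  · rw [length_localizedModule_eq_zero P.1.asIdeal.primeCompl hxP hx]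
    rfl

/-- No height one prime contains both `x` and `y`, so an element killed by both spans a pseudo-null
submodule and is zero. This is the depth needed for the first syzygy to be free. -/
theorem exists_divisor_of_finiteProjDim {A B : Type u} [CommRing A] [CommRing B] [Algebra A B]
    [IsDomain A] [IsLocalRing A] [IsNoetherianRing A] [IsIntegrallyClosed A]
    (hht : (maximalIdeal A).height = 2) [IsDomain B] [IsPrincipalIdealRing B]
    (Y : Type u) [AddCommGroup Y] [Module A Y] [Module.Finite A Y] {s : A}
    (hs : algebraMap A B s ≠ 0) (hsY : ∀ z : Y, s • z = 0)
    (hnp : ∀ L : Submodule A Y, IsPseudoNull A L → L = ⊥) {d : ℕ}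
    (hpd : CategoryTheory.HasProjectiveDimensionLE (ModuleCat.of A Y) d) :
    ∃ θ : A, algebraMap A B θ ≠ 0 ∧
      (∀ (q : Ideal A) [q.IsPrime], q.height = 1 →
        Module.length (Localization.AtPrime q) (Localization.AtPrime q ⊗[A] Y) =
          Ring.ord (Localization.AtPrime q) (algebraMap A _ θ)) ∧
      Module.length B (B ⊗[A] Y) = Ring.ord B (algebraMap A B θ) := by
  have hs0 : s ≠ 0 := fun h => hs (by rw [h, map_zero])
  obtain ⟨x, y, hxy, hprime, t, ht, htm⟩ := exists_isRegularPair hht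
  have hx0 : x ≠ 0 := by
    rintro rfl
    exact one_ne_zero (hxy.eq_zero_of_smul 1 (zero_smul _ _))
  have hY : ∀ z : Y, x • z = 0 → y • z = 0 → z = 0 := by
    intro z hxz hyz
    have hL := hnp (Submodule.span A {z}) (isPseudoNull_of_smul_eq_zero (x := x) (y := y) hx0
      (fun q hq hq1 hxq hyq => by
        rw [hprime q hq hxq hyq, hht] at hq1
        exact absurd hq1 (by norm_num)) ?_ ?_)
    · rwa [Submodule.span_singleton_eq_bot] at hL
    · rintro ⟨w, hw⟩
      obtain ⟨a, rfl⟩ := Submodule.mem_span_singleton.1 hw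
      exact Subtype.ext (by simp [smul_comm x a, hxz])
    · rintro ⟨w, hw⟩
      obtain ⟨a, rfl⟩ := Submodule.mem_span_singleton.1 hw
      exact Subtype.ext (by simp [smul_comm y a, hyz])
  obtain ⟨n, π, hπ⟩ := Module.Finite.exists_fin' A Y
  have hpdK : CategoryTheory.HasProjectiveDimensionLE (ModuleCat.of A (LinearMap.ker π)) d := by
    have hS := LinearMap.shortExact_shortComplexKer hπ
    have hproj : CategoryTheory.Projective (ModuleCat.of A (Fin n → A)) :=
      (IsProjective.iff_projective _).1 inferInstance
    exact (hS.hasProjectiveDimensionLT_X₃_iff d hproj).1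
      -- The bound is weakened by one before shifting to the syzygy, so that `d = 0` needs no
      -- separate case.
      (CategoryTheory.hasProjectiveDimensionLT_of_ge _ (d + 1) (d + 2) (by omega))
  obtain ⟨φ, hφ⟩ := exists_square_presentation hs0 hsY π
    (hxy.free_of_hasProjectiveDimensionLE ht htm d _ ((hxy.pi n).ker π hY) hpdK)
  have hdet : algebraMap A B (LinearMap.det φ) ≠ 0 := by
    intro h
    have := map_dvd (algebraMap A B) (det_dvd_pow hφ hsY)
    rw [h, zero_dvd_iff, map_pow] at this
    exact hs (eq_zero_of_pow_eq_zero this)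
  refine ⟨LinearMap.det φ, hdet, fun q hq hq1 => ?_, length_baseChange_eq_ord hπ hφ B hdet⟩
  have hC := isDiscreteValuationRing_of_height_eq_one q hq1 (Localization.AtPrime q)
  refine length_baseChange_eq_ord hπ hφ _ ?_
  simpa using! (IsLocalization.injective (Localization.AtPrime q)
    q.primeCompl_le_nonZeroDivisors).ne fun h => hdet (by rw [h, map_zero])

end FiniteProjectiveDimension

/-! ### Base change of lengths and annihilation of `Tor_1` -/

section BaseChange

variable {T : Type*} [CommRing T] (A C : Type*) [CommRing A] [CommRing C] [Algebra T A]
  [Algebra A C] [Algebra T C] [IsScalarTower T A C]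

theorem length_tensor_tensor (X : Type*) [AddCommGroup X] [Module T X] :
    Module.length C (C ⊗[A] (A ⊗[T] X)) = Module.length C (C ⊗[T] X) :=
  (TensorProduct.AlgebraTensorModule.cancelBaseChange T A C C X).length_eq

theorem length_tensor_localizedModule (S : Submonoid T) [Algebra (Localization S) C]
    [IsScalarTower T (Localization S) C] (X : Type*) [AddCommGroup X] [Module T X] :
    Module.length C (C ⊗[Localization S] (LocalizedModule S X)) = Module.length C (C ⊗[T] X) := by
  rw [← length_tensor_tensor (Localization S) C X]
  exact (LinearEquiv.baseChange (Localization S) C _ _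
    (LocalizedModule.equivTensorProduct S X)).length_eq

theorem length_ker_baseChange_baseChange {K F : Type*} [AddCommGroup K] [Module T K]
    [AddCommGroup F] [Module T F] (i : K →ₗ[T] F) :
    Module.length C (LinearMap.ker ((i.baseChange A).baseChange C)) =
      Module.length C (LinearMap.ker (i.baseChange C)) := by
  let eK := TensorProduct.AlgebraTensorModule.cancelBaseChange T A C C K
  let eF := TensorProduct.AlgebraTensorModule.cancelBaseChange T A C C F
  have h : i.baseChange C ∘ₗ eK.toLinearMap = eF.toLinearMap ∘ₗ (i.baseChange A).baseChange C := by
    ext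
    simp [eK, eF]
  have h' : ∀ z, i.baseChange C (eK z) = eF ((i.baseChange A).baseChange C z) :=
    LinearMap.congr_fun h
  refine (LinearEquiv.ofBijective (eK.toLinearMap.restrict
    (p := LinearMap.ker ((i.baseChange A).baseChange C)) (q := LinearMap.ker (i.baseChange C))
    fun z hz => ?_) ⟨fun a b hab => ?_, fun w => ?_⟩).length_eq
  · rw [LinearMap.mem_ker] at hz ⊢
    rw [LinearEquiv.coe_coe, h', hz, map_zero]
  · exact Subtype.ext (eK.injective (congrArg Subtype.val hab))
  · refine ⟨⟨eK.symm w.1, ?_⟩, Subtype.ext (eK.apply_symm_apply _)⟩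
    rw [LinearMap.mem_ker]
    apply eF.injective
    rw [← h', LinearEquiv.apply_symm_apply, map_zero]
    exact w.2

theorem length_tensor_ker [Module.Flat A C] {K F : Type*} [AddCommGroup K] [Module A K]
    [AddCommGroup F] [Module A F] (g : K →ₗ[A] F) :
    Module.length C (C ⊗[A] (LinearMap.ker g)) = Module.length C (LinearMap.ker (g.baseChange C)) :=
  (LinearMap.tensorKerEquiv C C g).length_eq

end BaseChange

section TorProperties

theorem exists_free_presentation (T : Type u) [CommRing T] (M : Type u) [AddCommGroup M]
    [Module T M] [Module.Finite T M] :
    ∃ (n : ℕ) (π : (Fin n → T) →ₗ[T] M), Function.Surjective π ∧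
      Function.Exact (LinearMap.ker π).subtype π := by
  obtain ⟨n, π, hπ⟩ := Module.Finite.exists_fin' T M
  exact ⟨n, π, hπ, LinearMap.exact_subtype_ker_map π⟩

variable {T R : Type u} [CommRing T] [CommRing R] [Algebra T R]
  (M : Type u) [AddCommGroup M] [Module T M] [Module.Finite T M]

theorem finite_torOne [IsNoetherianRing T] [IsNoetherianRing R] :
    Module.Finite R (TorOne T R M) := by
  obtain ⟨n, π, hπ, hex⟩ := exists_free_presentation T M
  obtain ⟨e⟩ := nonempty_torOne_equiv (R := R) (LinearMap.ker π).injective_subtype hex hπ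
  exact Module.Finite.equiv e.symm

/-- Multiplication by `s` on the syzygy factors through its inclusion into the free module, so after
base change it kills the kernel of that inclusion. -/
theorem smul_torOne_eq_zero {s : T} (hs : ∀ m : M, s • m = 0) (z : TorOne T R M) :
    algebraMap T R s • z = 0 := by
  obtain ⟨n, π, hπ, hex⟩ := exists_free_presentation T M
  obtain ⟨e⟩ := nonempty_torOne_equiv (R := R) (LinearMap.ker π).injective_subtype hex hπ
  apply e.injective
  rw [map_smul, map_zero]
  apply Subtype.ext
  let g : (Fin n → T) →ₗ[T] LinearMap.ker π :=
    (LinearMap.lsmul T _ s).codRestrict _ fun v => by simp [hs]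
  have hg : g ∘ₗ (LinearMap.ker π).subtype = LinearMap.lsmul T _ s := by
    ext x
    rfl
  have h := LinearMap.congr_fun (congrArg (LinearMap.baseChange R) hg) (e z).1
  rw [LinearMap.baseChange_comp, LinearMap.comp_apply, LinearMap.mem_ker.1 (e z).2, map_zero] at h
  rw [Submodule.coe_smul, Submodule.coe_zero, h]
  have h2 : (LinearMap.lsmul T (LinearMap.ker π) s).baseChange R =
      LinearMap.lsmul R (R ⊗[T] LinearMap.ker π) (algebraMap T R s) := by
    ext x
    simp [TensorProduct.tmul_smul, TensorProduct.smul_tmul', Algebra.smul_def]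
  rw [h2]
  rfl

end TorProperties

/-! ### The local map from `T_Q` to `R_P` -/

section IntegralClosureOfImage

variable {T R : Type u} [CommRing T] [CommRing R] [IsDomain R] [Algebra T R]

/-- `r` is integral over the localization of `T / ker` at `Q`, which is integrally closed, so it is
a fraction with denominator outside `Q`. Surjectivity of `T_Q → R_P` follows from this. -/
theorem IsIntegralClosureOfImage.exists_mul_eq (h : IsIntegralClosureOfImage T R) (Q : Ideal T)
    [Q.IsPrime] (hQ : RingHom.ker (algebraMap T R) ≤ Q)
    [IsIntegrallyClosed
      (Localization (Q.primeCompl.map (Ideal.Quotient.mk (RingHom.ker (algebraMap T R)))))]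
          (r : R) :
    ∃ σ ∉ Q, ∃ t : T, algebraMap T R σ * r = algebraMap T R t := by
  obtain ⟨e, he⟩ := h
  have hpr : (RingHom.ker (algebraMap T R)).IsPrime := RingHom.ker_isPrime _
  let N := Q.primeCompl.map (Ideal.Quotient.mk (RingHom.ker (algebraMap T R)))
  have hNle : N ≤ nonZeroDivisors (T ⧸ RingHom.ker (algebraMap T R)) := by
    rintro _ ⟨σ, hσ, rfl⟩
    refine mem_nonZeroDivisors_of_ne_zero fun h0 => hσ (hQ (Ideal.Quotient.eq_zero_iff_mem.1 h0))
  let alg : Algebra (Localization N) (FractionRing (T ⧸ RingHom.ker (algebraMap T R))) :=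
    IsLocalization.localizationAlgebraOfSubmonoidLe (Localization N)
        (FractionRing (T ⧸ RingHom.ker (algebraMap T R))) N
      (nonZeroDivisors (T ⧸ RingHom.ker (algebraMap T R))) hNle
  have htower := IsLocalization.localization_isScalarTower_of_submonoid_le (Localization N)
    (FractionRing (T ⧸ RingHom.ker (algebraMap T R))) N
    (nonZeroDivisors (T ⧸ RingHom.ker (algebraMap T R))) hNle
  have hfrac : IsFractionRing (Localization N) (FractionRing (T ⧸ RingHom.ker (algebraMap T R))) :=
    IsFractionRing.isFractionRing_of_isDomain_of_isLocalization N _ _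
  have hint : IsIntegral (Localization N) (e r).1 := IsIntegral.tower_top (e r).2
  obtain ⟨l, hl⟩ := (isIntegrallyClosed_iff (FractionRing (T ⧸ RingHom.ker (algebraMap T R)))).1
      inferInstance hint
  obtain ⟨⟨a, n⟩, hn⟩ := IsLocalization.surj N l
  obtain ⟨σ, hσ, hσn⟩ := n.2
  obtain ⟨t, rfl⟩ := Ideal.Quotient.mk_surjective a
  refine ⟨σ, hσ, t, e.injective (Subtype.ext ?_)⟩
  have h1 := congrArg (algebraMap (Localization N)
      (FractionRing (T ⧸ RingHom.ker (algebraMap T R)))) hn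
  rw [map_mul, hl, ← IsScalarTower.algebraMap_apply, ← IsScalarTower.algebraMap_apply] at h1
  rw [map_mul, he, ← h1]
  change (e (algebraMap T R σ)).1 * (e r).1 = _
  rw [he, mul_comm]
  congr 2

end IntegralClosureOfImage

section AtPrime

variable {T R : Type u} [CommRing T] [CommRing R] [Algebra T R] (P : Ideal R) [P.IsPrime]

theorem surjective_of_exists_mul_eq
    (h : ∀ r : R, ∃ σ ∉ P.comap (algebraMap T R), ∃ t : T, algebraMap T R σ * r = algebraMap T R t)
    [Algebra (Localization.AtPrime (P.comap (algebraMap T R))) (Localization.AtPrime P)]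
    [IsScalarTower T (Localization.AtPrime (P.comap (algebraMap T R))) (Localization.AtPrime P)] :
    Function.Surjective (algebraMap (Localization.AtPrime (P.comap (algebraMap T R)))
      (Localization.AtPrime P)) := by
  set B := Localization.AtPrime P
  set A := Localization.AtPrime (P.comap (algebraMap T R))
  intro b
  obtain ⟨⟨r, w⟩, hb⟩ := IsLocalization.surj P.primeCompl b
  obtain ⟨σ, hσ, t, ht⟩ := h r
  obtain ⟨σ', hσ', t', ht'⟩ := h w.1
  have ht'Q : t' ∉ P.comap (algebraMap T R) := by
    rw [Ideal.mem_comap, ← ht']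
    exact fun h0 => (Ideal.IsPrime.mem_or_mem ‹_› h0).elim hσ' w.2
  let d : (P.comap (algebraMap T R)).primeCompl := ⟨σ * t', Submonoid.mul_mem _ hσ ht'Q⟩
  refine ⟨IsLocalization.mk' A (t * σ') d, ?_⟩
  have hunit : IsUnit (algebraMap T B d.1) := by
    rw [IsScalarTower.algebraMap_apply T A B]
    exact (IsLocalization.map_units A d).map _
  apply hunit.mul_right_cancel
  have h1 := congrArg (algebraMap A B) (IsLocalization.mk'_spec A (t * σ') d)
  rw [map_mul, ← IsScalarTower.algebraMap_apply, ← IsScalarTower.algebraMap_apply] at h1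
  rw [h1, IsScalarTower.algebraMap_apply T R B, IsScalarTower.algebraMap_apply T R B]
  simp only [d, map_mul]
  rw [← ht, ← ht', map_mul, map_mul, ← hb]
  ring

end AtPrime

/-! ### Local divisor elements at a height one prime of `R` -/

section AtHeightOnePrime

open IsLocalRing

theorem length_tensor_eq_zero {T C X : Type*} [CommRing T] [CommRing C] [Algebra T C]
    [AddCommGroup X] [Module T X] {s : T} (hs : IsUnit (algebraMap T C s))
    (hsX : ∀ x : X, s • x = 0) : Module.length C (C ⊗[T] X) = 0 := by
  have : Subsingleton (C ⊗[T] X) := by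
    refine subsingleton_of_forall_eq 0 fun z => ?_
    induction z with
    | zero => rfl
    | add a b ha hb => rw [ha, hb, add_zero]
    | tmul c x =>
      obtain ⟨w, hw⟩ := hs.exists_left_inv
      have : c = s • (w * c) := by
        rw [Algebra.smul_def, ← mul_assoc, mul_comm _ w, hw, one_mul]
      rw [this, TensorProduct.smul_tmul, hsX, TensorProduct.tmul_zero]
  exact Module.length_eq_zero

theorem length_localizedModule_tensor {T R : Type*} [CommRing T] [CommRing R] [Algebra T R]
    (S : Submonoid R) (X : Type*) [AddCommGroup X] [Module T X] :
    Module.length (Localization S) (LocalizedModule S (R ⊗[T] X)) =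
      Module.length (Localization S) (Localization S ⊗[T] X) := by
  rw [length_localizedModule_eq_tensor S (Localization S), length_tensor_tensor]

theorem height_maximalIdeal_atPrime {T : Type*} [CommRing T] (Q : Ideal T) [Q.IsPrime] :
    (maximalIdeal (Localization.AtPrime Q)).height = Q.height := by
  have h := IsLocalization.AtPrime.ringKrullDim_eq_height Q (Localization.AtPrime Q)
  rw [← IsLocalRing.maximalIdeal_height_eq_ringKrullDim] at h
  exact_mod_cast h

theorem exists_pair_of_isRegularLocalRing {A : Type*} [CommRing A] [IsRegularLocalRing A]
    (h : (maximalIdeal A).height = 2) : ∃ u₁ u₂ : A, maximalIdeal A = Ideal.span {u₁, u₂} := by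
  have h2 : (maximalIdeal A).spanFinrank = 2 := by
    have h1 := IsRegularLocalRing.spanFinrank_maximalIdeal (R := A)
    rw [← IsLocalRing.maximalIdeal_height_eq_ringKrullDim, h] at h1
    exact_mod_cast h1
  obtain ⟨s, hs, hspan⟩ :=
    Submodule.FG.exists_span_finset_card_eq_spanFinrank (IsNoetherian.noetherian (maximalIdeal A))
  rw [h2] at hs
  classical
  obtain ⟨u₁, u₂, -, rfl⟩ := Finset.card_eq_two.1 hs
  exact ⟨u₁, u₂, by rw [← hspan]; simp [Ideal.span]⟩

theorem smul_tensor_eq_zero {T A X : Type*} [CommRing T] [CommRing A] [Algebra T A]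
    [AddCommGroup X] [Module T X] {s : T} (hs : ∀ x : X, s • x = 0) (z : A ⊗[T] X) :
    algebraMap T A s • z = 0 := by
  rw [algebraMap_smul]
  induction z with
  | zero => simp
  | add a b ha hb => rw [smul_add, ha, hb, add_zero]
  | tmul c x => rw [← TensorProduct.tmul_smul, hs, TensorProduct.tmul_zero]

theorem exists_divisor_of_isRegularLocalRing {T A B : Type u} [CommRing T] [CommRing A]
    [CommRing B] [Algebra T A] [Algebra A B] [Algebra T B] [IsScalarTower T A B] [IsDomain A]
    [IsIntegrallyClosed A] [IsRegularLocalRing A] (hht : (maximalIdeal A).height = 2)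
    [IsDomain B] [IsDiscreteValuationRing B] (hsurj : Function.Surjective (algebraMap A B))
    (M : Type u) [AddCommGroup M] [Module T M] [Module.Finite T M] {s : T}
    (hs : algebraMap A B (algebraMap T A s) ≠ 0) (hsM : ∀ z : M, s • z = 0) :
    ∃ f : A, f ≠ 0 ∧ RingHom.ker (algebraMap A B) = Ideal.span {f} ∧
      ∃ θ : A, algebraMap A B θ ≠ 0 ∧
        (∀ (q : Ideal A) [q.IsPrime], q.height = 1 →
          Module.length (Localization.AtPrime q) (Localization.AtPrime q ⊗[T] M) =
            Ring.ord (Localization.AtPrime q) (algebraMap A _ θ)) ∧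
        Module.length B (B ⊗[T] M) =
          Module.length A (Submodule.torsionBy A (A ⊗[T] M) f) +
            Ring.ord B (algebraMap A B θ) := by
  obtain ⟨u₁, u₂, hu⟩ := exists_pair_of_isRegularLocalRing hht
  have hht' : 1 < (maximalIdeal A).height := by
    rw [hht]
    norm_num
  obtain ⟨f, y, hm, hf, hfy⟩ := exists_parameters_of_surjective hsurj hu hht'
  have hf0 : f ≠ 0 := by
    rintro rfl
    exact one_ne_zero (hfy.eq_zero_of_smul 1 (zero_smul _ _))
  obtain ⟨θ, h1, h2, h3⟩ := exists_divisor_of_regular hht' hsurj hm hf hfy (A ⊗[T] M) hs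
    (smul_tensor_eq_zero hsM)
  refine ⟨f, hf0, hf, θ, h1, fun q _ hq => ?_, ?_⟩
  · rw [← h2 q hq, length_tensor_tensor]
  · rw [← h3, length_tensor_tensor]

theorem smul_localizedModule_eq_zero {T : Type*} [CommRing T] (S : Submonoid T) {X : Type*}
    [AddCommGroup X] [Module T X] {s : T} (hs : ∀ x : X, s • x = 0) (z : LocalizedModule S X) :
    algebraMap T (Localization S) s • z = 0 := by
  induction z using LocalizedModule.induction_on with
  | h m t => rw [algebraMap_smul, LocalizedModule.smul'_mk, hs, LocalizedModule.zero_mk]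

theorem ker_le_comap {T R : Type*} [CommRing T] [CommRing R] [Algebra T R] (P : Ideal R) :
    RingHom.ker (algebraMap T R) ≤ P.comap (algebraMap T R) := fun x hx => by
  rw [Ideal.mem_comap, RingHom.mem_ker.1 hx]
  exact P.zero_mem

section Tower

variable {T R : Type u} [CommRing T] [CommRing R] [Algebra T R] (P : Ideal R) [P.IsPrime]
  [Algebra (Localization.AtPrime (P.comap (algebraMap T R))) (Localization.AtPrime P)]
  [IsScalarTower T (Localization.AtPrime (P.comap (algebraMap T R))) (Localization.AtPrime P)]

theorem algebraMap_localization_ne_zero [IsDomain R] {s : T} (hs : algebraMap T R s ≠ 0) :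
    algebraMap (Localization.AtPrime (P.comap (algebraMap T R))) (Localization.AtPrime P)
      (algebraMap T _ s) ≠ 0 := by
  rw [← IsScalarTower.algebraMap_apply, IsScalarTower.algebraMap_apply T R]
  simpa using! (IsLocalization.injective (Localization.AtPrime P)
    P.primeCompl_le_nonZeroDivisors).ne hs

/-- Flatness of `R → R_P` and of `T → T_Q` turns both sides into the kernel of one base-changed
syzygy inclusion, which is `Tor_1` of `T_Q / (f)`. -/
theorem length_localizedModule_torOne [IsDomain T]
    (hsurj : Function.Surjective (algebraMap (Localization.AtPrime (P.comap (algebraMap T R)))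
      (Localization.AtPrime P))) {f : Localization.AtPrime (P.comap (algebraMap T R))} (hf0 : f ≠ 0)
    (hf : RingHom.ker (algebraMap (Localization.AtPrime (P.comap (algebraMap T R)))
      (Localization.AtPrime P)) = Ideal.span {f})
    (M : Type u) [AddCommGroup M] [Module T M] [Module.Finite T M] :
    Module.length (Localization.AtPrime P) (LocalizedModule P.primeCompl (TorOne T R M)) =
      Module.length (Localization.AtPrime (P.comap (algebraMap T R)))
        (Submodule.torsionBy _ (Localization.AtPrime (P.comap (algebraMap T R)) ⊗[T] M) f) := by
  set A := Localization.AtPrime (P.comap (algebraMap T R))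
  set B := Localization.AtPrime P
  obtain ⟨n, π, hπ, hex⟩ := exists_free_presentation T M
  obtain ⟨e⟩ := nonempty_torOne_equiv (R := R) (LinearMap.ker π).injective_subtype hex hπ
  have : Module.Flat R B := IsLocalization.flat _ P.primeCompl
  have : Module.Flat T A := IsLocalization.flat _ (P.comap (algebraMap T R)).primeCompl
  rw [length_localizedModule_eq_tensor P.primeCompl B, (e.baseChange R B _ _).length_eq,
    length_tensor_ker R B, length_ker_baseChange_baseChange R B,
    ← length_ker_baseChange_baseChange A B]
  refine length_ker_baseChange_eq_torsionBy hsurj hf (π := π.baseChange A) ?_ ?_ ?_ ?_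
  · exact Module.Flat.lTensor_preserves_injective_linearMap _ (LinearMap.ker π).injective_subtype
  · exact lTensor_exact A hex hπ
  · exact LinearMap.lTensor_surjective A hπ
  · intro x hx
    exact (smul_eq_zero.1 hx).resolve_left hf0

end Tower

variable {T R : Type u} [CommRing T] [IsDomain T] [IsIntegrallyClosed T] [CommRing R]
  [IsDomain R] [IsIntegrallyClosed R] [IsNoetherianRing R] [Algebra T R]
  (P : Ideal R) [P.IsPrime]
  [Algebra (Localization.AtPrime (P.comap (algebraMap T R))) (Localization.AtPrime P)]
  [IsScalarTower T (Localization.AtPrime (P.comap (algebraMap T R))) (Localization.AtPrime P)]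

theorem exists_divisor_atPrime_of_finiteProjDim [IsNoetherianRing T] (hP : P.height = 1)
    (hQ : (P.comap (algebraMap T R)).height = 2)
    (Y : Type u) [AddCommGroup Y] [Module T Y] [Module.Finite T Y] {s : T}
    (hs : algebraMap T R s ≠ 0) (hsY : ∀ z : Y, s • z = 0) (hnp : NoPseudoNull T R Y)
    (hpd : FiniteProjDim T R Y) :
    ∃ θ : Localization.AtPrime (P.comap (algebraMap T R)),
      algebraMap _ (Localization.AtPrime P) θ ≠ 0 ∧
      (∀ (q : Ideal (Localization.AtPrime (P.comap (algebraMap T R)))) [q.IsPrime], q.height = 1 →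
        Module.length (Localization.AtPrime q) (Localization.AtPrime q ⊗[T] Y) =
          Ring.ord (Localization.AtPrime q) (algebraMap _ _ θ)) ∧
      Module.length (Localization.AtPrime P) (LocalizedModule P.primeCompl (R ⊗[T] Y)) =
        Ring.ord (Localization.AtPrime P) (algebraMap _ _ θ) := by
  have hnorm : IsIntegrallyClosed (Localization.AtPrime (P.comap (algebraMap T R))) :=
    isIntegrallyClosed_of_isLocalization _ _
        (P.comap (algebraMap T R)).primeCompl_le_nonZeroDivisors
  have hB := isDiscreteValuationRing_of_height_eq_one P hP (Localization.AtPrime P)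
  obtain ⟨d, hd⟩ := hpd ⟨P.comap (algebraMap T R), inferInstance⟩ hQ (ker_le_comap P)
  obtain ⟨θ, h1, h2, h3⟩ := exists_divisor_of_finiteProjDim
    ((height_maximalIdeal_atPrime _).trans hQ) (B := Localization.AtPrime P)
    (LocalizedModule (P.comap (algebraMap T R)).primeCompl Y)
    (algebraMap_localization_ne_zero P hs) (smul_localizedModule_eq_zero _ hsY)
    (hnp ⟨P.comap (algebraMap T R), inferInstance⟩ hQ (ker_le_comap P)) hd
  refine ⟨θ, h1, fun q _ hq => ?_, ?_⟩
  · rw [← h2 q hq, length_tensor_localizedModule]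
  · rw [← h3, length_localizedModule_tensor, length_tensor_localizedModule]

theorem exists_divisor_atPrime_of_regularAlong (hclosure : IsIntegralClosureOfImage T R)
    (hP : P.height = 1) (hQ : (P.comap (algebraMap T R)).height = 2)
    (M : Type u) [AddCommGroup M] [Module T M] [Module.Finite T M] {s : T}
    (hs : algebraMap T R s ≠ 0) (hsM : ∀ z : M, s • z = 0) (hreg : RegularAlong T R M) :
    ∃ θ : Localization.AtPrime (P.comap (algebraMap T R)),
      algebraMap _ (Localization.AtPrime P) θ ≠ 0 ∧
      (∀ (q : Ideal (Localization.AtPrime (P.comap (algebraMap T R)))) [q.IsPrime], q.height = 1 →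
        Module.length (Localization.AtPrime q) (Localization.AtPrime q ⊗[T] M) =
          Ring.ord (Localization.AtPrime q) (algebraMap _ _ θ)) ∧
      Module.length (Localization.AtPrime P) (LocalizedModule P.primeCompl (R ⊗[T] M)) =
        Module.length (Localization.AtPrime P) (LocalizedModule P.primeCompl (TorOne T R M)) +
          Ring.ord (Localization.AtPrime P) (algebraMap _ _ θ) := by
  have hnorm : IsIntegrallyClosed (Localization.AtPrime (P.comap (algebraMap T R))) :=
    isIntegrallyClosed_of_isLocalization _ _
        (P.comap (algebraMap T R)).primeCompl_le_nonZeroDivisors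
  have hB := isDiscreteValuationRing_of_height_eq_one P hP (Localization.AtPrime P)
  by_cases hsupp : (⟨P.comap (algebraMap T R), inferInstance⟩ : PrimeSpectrum T) ∈
      Module.support T M
  · obtain ⟨hA, hcl⟩ := hreg ⟨P.comap (algebraMap T R), inferInstance⟩ hQ (ker_le_comap P) hsupp
    have hsurj := surjective_of_exists_mul_eq P (hclosure.exists_mul_eq _ (ker_le_comap P))
    obtain ⟨f, hf0, hf, θ, h1, h2, h3⟩ := exists_divisor_of_isRegularLocalRing
      ((height_maximalIdeal_atPrime (P.comap (algebraMap T R))).trans hQ) hsurj M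
      (algebraMap_localization_ne_zero P hs) hsM
    exact ⟨θ, h1, h2, by
      rw [length_localizedModule_torOne P hsurj hf0 hf, length_localizedModule_tensor, ← h3]⟩
  · rw [Module.mem_support_iff_of_finite, SetLike.not_le_iff_exists] at hsupp
    obtain ⟨σ, hσ, hσQ⟩ := hsupp
    rw [Module.mem_annihilator] at hσ
    -- Off the support every length is zero, so `θ = 1` works.
    refine ⟨1, by simp, fun q _ hq => ?_, ?_⟩
    · rw [map_one, Ring.ord_one, length_tensor_eq_zero _ hσ]
      rw [IsScalarTower.algebraMap_apply T (Localization.AtPrime (P.comap (algebraMap T R)))]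
      exact (IsLocalization.map_units _ (⟨σ, hσQ⟩ : (P.comap (algebraMap T R)).primeCompl)).map _
    · rw [map_one, Ring.ord_one, length_localizedModule_tensor,
        length_localizedModule_eq_zero P.primeCompl hσQ (smul_torOne_eq_zero M hσ),
        length_tensor_eq_zero _ hσ, add_zero]
      rw [IsScalarTower.algebraMap_apply T R]
      exact IsLocalization.map_units _ (⟨_, hσQ⟩ : P.primeCompl)

end AtHeightOnePrime

/-! ### Integer orders and principal divisors -/

section OrderInt

/-- The order of vanishing as an integer. -/
noncomputable def ordInt (C : Type*) [CommRing C] (x : C) : ℤ :=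
  ((Ring.ord C x).toNat : ℤ)

theorem length_tensor_quotient {T : Type*} [CommRing T] (C : Type*) [CommRing C] [Algebra T C]
    (c : T) : Module.length C (C ⊗[T] (T ⧸ Ideal.span {c})) = Ring.ord C (algebraMap T C c) := by
  rw [Ring.ord, ← Set.image_singleton, ← Ideal.map_span]
  exact (Algebra.TensorProduct.quotIdealMapEquivTensorQuot C
      (Ideal.span {c})).toLinearEquiv.symm.length_eq

variable {C : Type*} [CommRing C]

theorem ordInt_one : ordInt C 1 = 0 := by
  simp [ordInt]

theorem ordInt_nonneg (x : C) : 0 ≤ ordInt C x := Int.natCast_nonneg _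

variable [IsDomain C] [IsDiscreteValuationRing C]

theorem ord_ne_top_of_ne_zero {x : C} (hx : x ≠ 0) : Ring.ord C x ≠ ⊤ :=
  Ring.ord_ne_top (mem_nonZeroDivisors_of_ne_zero hx)

theorem ordInt_mul {x y : C} (hx : x ≠ 0) (hy : y ≠ 0) :
    ordInt C (x * y) = ordInt C x + ordInt C y := by
  rw [ordInt, Ring.ord_mul C (mem_nonZeroDivisors_of_ne_zero hy),
    ENat.toNat_add (ord_ne_top_of_ne_zero hx) (ord_ne_top_of_ne_zero hy)]
  push_cast
  rfl

theorem ordInt_pow {x : C} (hx : x ≠ 0) (N : ℕ) : ordInt C (x ^ N) = N * ordInt C x := by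
  induction N with
  | zero => simp [ordInt_one]
  | succ N ih =>
    rw [pow_succ, ordInt_mul (pow_ne_zero N hx) hx, ih]
    push_cast
    ring

theorem ordInt_eq_zero_iff {x : C} (hx : x ≠ 0) : ordInt C x = 0 ↔ IsUnit x := by
  rw [ordInt, Nat.cast_eq_zero, ENat.toNat_eq_zero, or_iff_left (ord_ne_top_of_ne_zero hx),
      Ring.ord,
    Module.length_eq_zero_iff, Ideal.Quotient.subsingleton_iff, Ideal.span_singleton_eq_top]

theorem ordInt_le_iff_dvd {x y : C} (hx : x ≠ 0) (hy : y ≠ 0) :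
    ordInt C x ≤ ordInt C y ↔ x ∣ y := by
  constructor
  · intro h
    obtain hxy | ⟨z, rfl⟩ := ValuationRing.dvd_total x y
    · exact hxy
    · have hz : z ≠ 0 := right_ne_zero_of_mul hx
      rw [ordInt_mul hy hz] at h
      have hz0 : ordInt C z = 0 := le_antisymm (by linarith) (ordInt_nonneg z)
      exact ((ordInt_eq_zero_iff hz).1 hz0).mul_right_dvd.2 dvd_rfl
  · rintro ⟨z, rfl⟩
    have hz : z ≠ 0 := right_ne_zero_of_mul hy
    rw [ordInt_mul hx hz]
    linarith [ordInt_nonneg z]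

end OrderInt

section Divisors

variable {A : Type u} [CommRing A]

theorem localLength_quotient (c : A) (P : HeightOnePrime A) :
    localLength A (A ⧸ Ideal.span {c}) P =
      ordInt (Localization.AtPrime P.1.asIdeal) (algebraMap A _ c) := by
  rw [localLength, length_localizedModule_eq_tensor P.1.asIdeal.primeCompl
    (Localization.AtPrime P.1.asIdeal), length_tensor_quotient]
  rfl

variable [IsDomain A]

theorem isTorsion_of_smul_eq_zero {X : Type*} [AddCommGroup X] [Module A X] {s : A} (hs : s ≠ 0)
    (hsX : ∀ x : X, s • x = 0) : Module.IsTorsion A X :=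
  fun {x} => ⟨⟨s, mem_nonZeroDivisors_of_ne_zero hs⟩, hsX x⟩

theorem divisor_quotient_apply [IsNoetherianRing A] {c : A} (hc : c ≠ 0) (P : HeightOnePrime A) :
    divisor A (A ⧸ Ideal.span {c}) P =
      ordInt (Localization.AtPrime P.1.asIdeal) (algebraMap A _ c) := by
  rw [divisor_apply (isTorsion_of_smul_eq_zero hc _), localLength_quotient]
  intro x
  obtain ⟨x, rfl⟩ := Ideal.Quotient.mk_surjective x
  rw [← Ideal.Quotient.mk_eq_mk, ← Submodule.Quotient.mk_smul, Ideal.Quotient.mk_eq_mk,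
    Ideal.Quotient.eq_zero_iff_mem]
  exact Ideal.mul_mem_right _ _ (Ideal.mem_span_singleton_self c)

theorem algebraMap_atPrime_ne_zero (q : Ideal A) [q.IsPrime] {c : A} (hc : c ≠ 0) :
    algebraMap A (Localization.AtPrime q) c ≠ 0 := by
  simpa using! (IsLocalization.injective (Localization.AtPrime q)
    q.primeCompl_le_nonZeroDivisors).ne hc

variable [IsNoetherianRing A]

theorem divisor_quotient_one : divisor A (A ⧸ Ideal.span {(1 : A)}) = 0 := by
  ext P
  rw [divisor_quotient_apply one_ne_zero, map_one, ordInt_one]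
  rfl

variable [IsIntegrallyClosed A]

instance (P : HeightOnePrime A) : IsDiscreteValuationRing (Localization.AtPrime P.1.asIdeal) :=
  isDiscreteValuationRing_of_height_eq_one _ P.2 _

theorem divisor_quotient_mul {a b : A} (ha : a ≠ 0) (hb : b ≠ 0) :
    divisor A (A ⧸ Ideal.span {a * b}) =
      divisor A (A ⧸ Ideal.span {a}) + divisor A (A ⧸ Ideal.span {b}) := by
  ext P
  rw [Finsupp.add_apply, divisor_quotient_apply (mul_ne_zero ha hb), divisor_quotient_apply ha,
    divisor_quotient_apply hb, map_mul,
    ordInt_mul (algebraMap_atPrime_ne_zero _ ha) (algebraMap_atPrime_ne_zero _ hb)]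

theorem dvd_of_divisor_le {a b : A} (ha : a ≠ 0) (hb : b ≠ 0)
    (h : divisor A (A ⧸ Ideal.span {a}) ≤ divisor A (A ⧸ Ideal.span {b})) : a ∣ b := by
  refine dvd_of_forall_height_one ha fun q hq hq1 => ?_
  have := h ⟨⟨q, hq⟩, hq1⟩
  rw [divisor_quotient_apply ha, divisor_quotient_apply hb] at this
  have hC := isDiscreteValuationRing_of_height_eq_one q hq1 (Localization.AtPrime q)
  exact (ordInt_le_iff_dvd (algebraMap_atPrime_ne_zero q ha)
    (algebraMap_atPrime_ne_zero q hb)).1 this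

theorem exists_eq_sub_of_mem_principalDivisors {D : DivisorGroup A}
    (hD : D ∈ principalDivisors A) : ∃ a b : A, a ≠ 0 ∧ b ≠ 0 ∧
      D = divisor A (A ⧸ Ideal.span {a}) - divisor A (A ⧸ Ideal.span {b}) := by
  induction hD using AddSubgroup.closure_induction with
  | mem D hD =>
    obtain ⟨r, hr, rfl⟩ := hD
    exact ⟨r, 1, hr, one_ne_zero, by rw [divisor_quotient_one, sub_zero]⟩
  | zero => exact ⟨1, 1, one_ne_zero, one_ne_zero, by rw [sub_self]⟩
  | add D E _ _ hD hE =>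
    obtain ⟨a, b, ha, hb, rfl⟩ := hD
    obtain ⟨c, d, hc, hd, rfl⟩ := hE
    refine ⟨a * c, b * d, mul_ne_zero ha hc, mul_ne_zero hb hd, ?_⟩
    rw [divisor_quotient_mul ha hc, divisor_quotient_mul hb hd]
    abel
  | neg D _ hD =>
    obtain ⟨a, b, ha, hb, rfl⟩ := hD
    exact ⟨b, a, hb, ha, by rw [neg_sub]⟩

/-- A positive divisor of finite order in the class group has a multiple that is the divisor of an
element. -/
theorem exists_nsmul_eq_divisor {D : DivisorGroup A} (hD : IsOfFinAddOrder (divisorClass A D))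
    (hpos : 0 < D) : ∃ N : ℕ, 0 < N ∧ ∃ c : A, c ≠ 0 ∧ ¬ IsUnit c ∧
      N • D = divisor A (A ⧸ Ideal.span {c}) := by
  obtain ⟨N, hN, hND⟩ := isOfFinAddOrder_iff_nsmul_eq_zero.1 hD
  have hmem : N • D ∈ principalDivisors A := (QuotientAddGroup.eq_zero_iff (N • D)).1 hND
  obtain ⟨a, b, ha, hb, hab⟩ := exists_eq_sub_of_mem_principalDivisors hmem
  have hNpos : 0 < N • D := by
    obtain ⟨h0, P, hP⟩ := Finsupp.lt_def.1 hpos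
    exact Finsupp.lt_def.2 ⟨nsmul_nonneg h0 N, P, by simpa [hN] using hP⟩
  -- The multiple is `Div(a) - Div(b) ≥ 0`, so `b ∣ a` by normality and the quotient is `c`.
  obtain ⟨c, rfl⟩ := dvd_of_divisor_le hb ha (sub_nonneg.1 (hab ▸ hNpos.le))
  have hc : c ≠ 0 := right_ne_zero_of_mul ha
  rw [divisor_quotient_mul hb hc, add_sub_cancel_left] at hab
  refine ⟨N, hN, c, hc, fun hu => hNpos.ne' ?_, hab⟩
  rw [hab, Ideal.span_singleton_eq_top.2 hu, ← Ideal.span_singleton_one, divisor_quotient_one]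

theorem divisor_quotient_pos {c : A} (hc : c ≠ 0) (hu : ¬ IsUnit c) :
    0 < divisor A (A ⧸ Ideal.span {c}) := by
  obtain ⟨m, hm, hcm⟩ := exists_max_ideal_of_mem_nonunits hu
  have hcm' : Ideal.span {c} ≤ m := (Ideal.span_singleton_le_iff_mem m).2 hcm
  obtain ⟨q, hq, -⟩ := Ideal.exists_minimalPrimes_le hcm'
  have hqp : q.IsPrime := hq.1.1
  have hcq : c ∈ q := hq.1.2 (Ideal.mem_span_singleton_self c)
  have hq1 : q.height = 1 := by
    refine le_antisymm (Ideal.height_le_one_of_isPrincipal_of_mem_minimalPrimes _ q hq)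
      (Order.one_le_iff_pos.2 (pos_iff_ne_zero.2 fun h => ?_))
    rw [Ideal.height_eq_zero_iff_eq_bot] at h
    subst h
    exact hc (by simpa using hcq)
  refine Finsupp.lt_def.2 ⟨fun P => ?_, ⟨⟨q, hqp⟩, hq1⟩, ?_⟩
  · rw [divisor_quotient_apply hc]
    exact ordInt_nonneg _
  · rw [divisor_quotient_apply hc]
    refine lt_of_le_of_ne (ordInt_nonneg _) fun h => ?_
    have hC := isDiscreteValuationRing_of_height_eq_one q hq1 (Localization.AtPrime q)
    exact (IsLocalization.AtPrime.isUnit_to_map_iff (Localization.AtPrime q) q c).1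
      ((ordInt_eq_zero_iff (algebraMap_atPrime_ne_zero q hc)).1 h.symm) hcq

end Divisors

/-- Clears the signs: the identity between divisors becomes an equality of orders of two ring
elements, a form that can be carried from `A` to `B`. -/
theorem ordInt_eq_iff {C : Type*} [CommRing C] [IsDomain C] [IsDiscreteValuationRing C]
    {c d a b e : C} (hc : c ≠ 0) (hd : d ≠ 0) (ha : a ≠ 0) (hb : b ≠ 0) (he : e ≠ 0) (N : ℕ) :
    ordInt C (c * b ^ N) = ordInt C (d * (a * e) ^ N) ↔
      N * (ordInt C a + ordInt C e - ordInt C b) = ordInt C c - ordInt C d := by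
  rw [ordInt_mul hc (pow_ne_zero N hb), ordInt_mul hd (pow_ne_zero N (mul_ne_zero ha he)),
    ordInt_pow hb, ordInt_pow (mul_ne_zero ha he), ordInt_mul ha he]
  constructor <;> intro h <;> linarith

/-- Elements of a normal domain with the same divisor divide each other, and divisibility passes to
`B`. This is how information at height one primes of `A` reaches `P`. -/
theorem ordInt_eq_of_forall_height_one {A B : Type*} [CommRing A] [IsDomain A]
    [IsNoetherianRing A] [IsIntegrallyClosed A] [CommRing B] [IsDomain B]
    [IsDiscreteValuationRing B] [Algebra A B] {x y : A} (hx : algebraMap A B x ≠ 0)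
    (hy : algebraMap A B y ≠ 0)
    (h : ∀ (q : Ideal A) [q.IsPrime], q.height = 1 →
      ordInt (Localization.AtPrime q) (algebraMap A _ x) =
        ordInt (Localization.AtPrime q) (algebraMap A _ y)) :
    ordInt B (algebraMap A B x) = ordInt B (algebraMap A B y) := by
  have hx0 : x ≠ 0 := fun h => hx (by rw [h, map_zero])
  have hy0 : y ≠ 0 := fun h => hy (by rw [h, map_zero])
  apply le_antisymm
  · refine (ordInt_le_iff_dvd hx hy).2 (map_dvd _ (dvd_of_forall_height_one hx0 fun q _ hq => ?_))
    have := isDiscreteValuationRing_of_height_eq_one q hq (Localization.AtPrime q)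
    exact (ordInt_le_iff_dvd (algebraMap_atPrime_ne_zero q hx0)
      (algebraMap_atPrime_ne_zero q hy0)).1 (h q hq).le
  · refine (ordInt_le_iff_dvd hy hx).2 (map_dvd _ (dvd_of_forall_height_one hy0 fun q _ hq => ?_))
    have := isDiscreteValuationRing_of_height_eq_one q hq (Localization.AtPrime q)
    exact (ordInt_le_iff_dvd (algebraMap_atPrime_ne_zero q hy0)
      (algebraMap_atPrime_ne_zero q hx0)).1 (h q hq).ge

theorem localLength_of_comap_eq {T : Type u} [CommRing T] (Q : Ideal T) [Q.IsPrime]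
    (q : Ideal (Localization.AtPrime Q)) [q.IsPrime] (P : HeightOnePrime T)
    (hP : q.comap (algebraMap T _) = P.1.asIdeal) (X : Type v) [AddCommGroup X] [Module T X] :
    localLength T X P =
      ((Module.length (Localization.AtPrime q) (Localization.AtPrime q ⊗[T] X)).toNat : ℤ) := by
  have h : IsLocalization.AtPrime (Localization.AtPrime q) (q.comap (algebraMap T _)) :=
    inferInstance
  have h' : IsLocalization P.1.asIdeal.primeCompl (Localization.AtPrime q) := by
    simp only [hP] at h
    exact h
  rw [localLength, length_localizedModule_eq_tensor P.1.asIdeal.primeCompl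
    (Localization.AtPrime q)]

/-! ### Specialization of the divisor identity -/

section Specialize

variable {T R : Type u} [CommRing T] [IsDomain T] [IsIntegrallyClosed T] [IsNoetherianRing T]
  [CommRing R] [IsDomain R] [IsIntegrallyClosed R] [IsNoetherianRing R] [Algebra T R]
  {Y₁ Y₂ M : Type u} [AddCommGroup Y₁] [AddCommGroup Y₂] [AddCommGroup M]
  [Module T Y₁] [Module T Y₂] [Module T M]
  [Module.Finite T Y₁] [Module.Finite T Y₂] [Module.Finite T M]

theorem localLength_specialization (hclosure : IsIntegralClosureOfImage T R)
    (P : HeightOnePrime R) (hQ : (P.1.asIdeal.comap (algebraMap T R)).height = 2)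
    (hnp₁ : NoPseudoNull T R Y₁) (hnp₂ : NoPseudoNull T R Y₂)
    (hpd₁ : FiniteProjDim T R Y₁) (hpd₂ : FiniteProjDim T R Y₂) (hreg : RegularAlong T R M)
    {s₁ s₂ s : T} (hs₁ : algebraMap T R s₁ ≠ 0) (hs₂ : algebraMap T R s₂ ≠ 0)
    (hs : algebraMap T R s ≠ 0) (hsY₁ : ∀ z : Y₁, s₁ • z = 0) (hsY₂ : ∀ z : Y₂, s₂ • z = 0)
    (hsM : ∀ z : M, s • z = 0) {N : ℕ} {c d : T} (hc : algebraMap T R c ≠ 0)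
    (hd : algebraMap T R d ≠ 0)
    (hdiv : ∀ q : HeightOnePrime T,
      N * (localLength T Y₁ q + localLength T M q - localLength T Y₂ q) =
        ordInt (Localization.AtPrime q.1.asIdeal) (algebraMap T _ c) -
          ordInt (Localization.AtPrime q.1.asIdeal) (algebraMap T _ d)) :
    N * (localLength R (R ⊗[T] Y₁) P + localLength R (R ⊗[T] M) P - localLength R (TorOne T R M) P
        - localLength R (R ⊗[T] Y₂) P) =
      ordInt (Localization.AtPrime P.1.asIdeal) (algebraMap R _ (algebraMap T R c)) -
        ordInt (Localization.AtPrime P.1.asIdeal) (algebraMap R _ (algebraMap T R d)) := by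
  let _ : Algebra (Localization.AtPrime (P.1.asIdeal.comap (algebraMap T R)))
      (Localization.AtPrime P.1.asIdeal) :=
    (Localization.localRingHom (P.1.asIdeal.comap (algebraMap T R)) P.1.asIdeal
      (algebraMap T R) rfl).toAlgebra
  have tower : IsScalarTower T (Localization.AtPrime (P.1.asIdeal.comap (algebraMap T R)))
      (Localization.AtPrime P.1.asIdeal) := IsScalarTower.of_algebraMap_eq fun t => by
    rw [IsScalarTower.algebraMap_apply T R]
    exact (Localization.localRingHom_to_map _ _ _ rfl t).symm
  set A := Localization.AtPrime (P.1.asIdeal.comap (algebraMap T R))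
  set B := Localization.AtPrime P.1.asIdeal
  have hnorm : IsIntegrallyClosed A := isIntegrallyClosed_of_isLocalization _ _
    (P.1.asIdeal.comap (algebraMap T R)).primeCompl_le_nonZeroDivisors
  obtain ⟨θ₁, h₁, hq₁, hP₁⟩ := exists_divisor_atPrime_of_finiteProjDim P.1.asIdeal P.2 hQ Y₁ hs₁
    hsY₁ hnp₁ hpd₁
  obtain ⟨θ₂, h₂, hq₂, hP₂⟩ := exists_divisor_atPrime_of_finiteProjDim P.1.asIdeal P.2 hQ Y₂ hs₂
    hsY₂ hnp₂ hpd₂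
  obtain ⟨θ, h, hq, hP⟩ := exists_divisor_atPrime_of_regularAlong P.1.asIdeal hclosure P.2 hQ M hs
    hsM hreg
  have hcB := algebraMap_localization_ne_zero P.1.asIdeal hc
  have hdB := algebraMap_localization_ne_zero P.1.asIdeal hd
  have hx : algebraMap A B (algebraMap T A c * θ₂ ^ N) ≠ 0 := by
    rw [map_mul, map_pow]
    exact mul_ne_zero hcB (pow_ne_zero N h₂)
  have hy : algebraMap A B (algebraMap T A d * (θ₁ * θ) ^ N) ≠ 0 := by
    rw [map_mul, map_pow, map_mul]
    exact mul_ne_zero hdB (pow_ne_zero N (mul_ne_zero h₁ h))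
  have key := ordInt_eq_of_forall_height_one hx hy fun q _ hq1 => by
    have hC := isDiscreteValuationRing_of_height_eq_one q hq1 (Localization.AtPrime q)
    have hne : ∀ {a : A}, algebraMap A B a ≠ 0 → algebraMap A (Localization.AtPrime q) a ≠ 0 :=
      fun ha => algebraMap_atPrime_ne_zero q fun h0 => ha (by rw [h0, map_zero])
    rw [map_mul, map_pow, map_mul, map_pow, map_mul,
      ordInt_eq_iff (hne hcB) (hne hdB) (hne h₁) (hne h₂) (hne h)]
    -- Height one primes of `A = T_Q` come from height one primes of `T` with the same local ring,
    -- so the hypothesis over `T` applies.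
    let q' : HeightOnePrime T := ⟨⟨q.comap (algebraMap T A), inferInstance⟩,
      (IsLocalization.height_under (P.1.asIdeal.comap (algebraMap T R)).primeCompl q).trans hq1⟩
    have hdq := hdiv q'
    have hord : ∀ a : T, ordInt (Localization.AtPrime q'.1.asIdeal) (algebraMap T _ a) =
        ordInt (Localization.AtPrime q) (algebraMap A _ (algebraMap T A a)) := fun a => by
      rw [← localLength_quotient, localLength_of_comap_eq _ q q' rfl, length_tensor_quotient,
        IsScalarTower.algebraMap_apply T A]
      rfl
    rw [localLength_of_comap_eq _ q q' rfl, localLength_of_comap_eq _ q q' rfl,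
      localLength_of_comap_eq _ q q' rfl, hord, hord, hq₁ q hq1, hq₂ q hq1, hq q hq1] at hdq
    exact hdq
  have hB : IsDiscreteValuationRing B := isDiscreteValuationRing_of_height_eq_one _ P.2 _
  rw [map_mul, map_pow, map_mul, map_pow, map_mul, ordInt_eq_iff hcB hdB h₁ h₂ h] at key
  have hTorFin : Module.Finite R (TorOne T R M) := finite_torOne M
  have hTor := length_ne_top (isTorsion_of_smul_eq_zero hs (smul_torOne_eq_zero M hsM)) P
  have e₁ : localLength R (R ⊗[T] Y₁) P = ordInt B (algebraMap A B θ₁) := by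
    rw [localLength, hP₁]
    rfl
  have e₂ : localLength R (R ⊗[T] Y₂) P = ordInt B (algebraMap A B θ₂) := by
    rw [localLength, hP₂]
    rfl
  have e : localLength R (R ⊗[T] M) P =
      localLength R (TorOne T R M) P + ordInt B (algebraMap A B θ) := by
    rw [localLength, hP, ENat.toNat_add hTor (ord_ne_top_of_ne_zero h)]
    push_cast
    rfl
  have hmap : ∀ a : T, algebraMap A B (algebraMap T A a) = algebraMap R B (algebraMap T R a) :=
    fun a => by
      rw [← IsScalarTower.algebraMap_apply, ← IsScalarTower.algebraMap_apply]
  rw [hmap, hmap] at key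
  rw [e₁, e₂, e, ← key]
  ring

end Specialize

/-! ### Positivity and the comparison of divisors -/

section Comparison

theorem isOfFinAddOrder_divisorClass_sub {A : Type u} [CommRing A] {D E : DivisorGroup A}
    (hD : IsOfFinAddOrder (divisorClass A D)) (hE : IsOfFinAddOrder (divisorClass A E)) :
    IsOfFinAddOrder (divisorClass A (D - E)) := by
  have h := IsOfFinAddOrder.add hD (IsOfFinAddOrder.neg hE)
  rwa [← sub_eq_add_neg] at h

variable {T R : Type u} [CommRing T] [CommRing R] [IsDomain R] [Algebra T R]

theorem exists_smul_eq_zero_of_notMem_support {X : Type*} [AddCommGroup X] [Module T X]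
    [Module.Finite T X] (h : kerPrime T R ∉ Module.support T X) :
    ∃ s : T, algebraMap T R s ≠ 0 ∧ ∀ x : X, s • x = 0 := by
  rw [Module.mem_support_iff_of_finite, SetLike.not_le_iff_exists] at h
  obtain ⟨s, hs, hsk⟩ := h
  exact ⟨s, fun h0 => hsk h0, Module.mem_annihilator.1 hs⟩

theorem localLength_kerPrime_eq_zero (hker : (kerPrime T R).asIdeal.height = 1) {X : Type*}
    [AddCommGroup X] [Module T X] {s : T} (hs : algebraMap T R s ≠ 0) (hsX : ∀ x : X, s • x = 0) :
    localLength T X ⟨kerPrime T R, hker⟩ = 0 := by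
  rw [localLength, length_localizedModule_eq_zero (kerPrime T R).asIdeal.primeCompl
    (fun h0 => hs h0) hsX]
  rfl

theorem pos_of_nsmul_pos_divisor {A : Type u} [CommRing A] {D : DivisorGroup A} {N : ℕ}
    (h : 0 < N • D) : 0 < D := by
  obtain ⟨h0, P, hP⟩ := Finsupp.lt_def.1 h
  have hpos : ∀ Q, 0 ≤ D Q := fun Q => by
    have h1 := h0 Q
    have h2 := h0 P
    simp only [Finsupp.smul_apply, Finsupp.zero_apply, nsmul_eq_mul] at h1 hP
    have hN : (0 : ℤ) < N := by
      refine lt_of_le_of_ne (Int.natCast_nonneg N) fun h => ?_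
      rw [← h, zero_mul] at hP
      exact hP.false
    exact nonneg_of_mul_nonneg_right h1 hN
  refine Finsupp.lt_def.2 ⟨hpos, P, ?_⟩
  refine lt_of_le_of_ne (hpos P) fun h => ?_
  rw [Finsupp.smul_apply, ← h] at hP
  simp at hP

theorem algebraMap_ne_zero_of_divisor_eq [IsDomain T] [IsNoetherianRing T]
    [IsIntegrallyClosed T] (hker : (kerPrime T R).asIdeal.height = 1) {c : T}
    (hc : c ≠ 0) (h : divisor T (T ⧸ Ideal.span {c}) ⟨kerPrime T R, hker⟩ = 0) :
    algebraMap T R c ≠ 0 := by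
  have := isDiscreteValuationRing_of_height_eq_one _ hker
    (Localization.AtPrime (kerPrime T R).asIdeal)
  rw [divisor_quotient_apply hc] at h
  replace h := (ordInt_eq_zero_iff (algebraMap_atPrime_ne_zero (kerPrime T R).asIdeal hc)).1 h
  exact fun h0 => (IsLocalization.AtPrime.isUnit_to_map_iff _ (kerPrime T R).asIdeal c).1 h h0

/-- The maximal ideal of the local ring `T` contains the kernel and `c`. By lying over it is the
contraction of a maximal ideal of `R`, which then contains the image of `c`. -/
theorem not_isUnit_algebraMap [IsLocalRing T] [Algebra.IsIntegral T R] {c : T} (hc : ¬ IsUnit c) :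
    ¬ IsUnit (algebraMap T R c) := by
  obtain ⟨m, hm, hmc⟩ := Ideal.exists_ideal_over_maximal_of_isIntegral (S := R)
    (IsLocalRing.maximalIdeal T) (IsLocalRing.le_maximalIdeal (RingHom.ker_isPrime _).ne_top)
  have hcm : algebraMap T R c ∈ m := by
    rw [← Ideal.mem_comap, hmc]
    exact (IsLocalRing.mem_maximalIdeal c).2 hc
  exact fun hu => hm.ne_top (Ideal.eq_top_of_isUnit_mem _ hcm hu)

variable [IsDomain T] [IsIntegrallyClosed T] [IsNoetherianRing T]
  [IsIntegrallyClosed R] [IsNoetherianRing R]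

variable {Y₁ Y₂ M : Type u} [AddCommGroup Y₁] [AddCommGroup Y₂] [AddCommGroup M]
  [Module T Y₁] [Module T Y₂] [Module T M]
  [Module.Finite T Y₁] [Module.Finite T Y₂] [Module.Finite T M]

theorem nsmul_divisor_specialization (hclosure : IsIntegralClosureOfImage T R)
    (hQ : ∀ P : HeightOnePrime R, (P.1.asIdeal.comap (algebraMap T R)).height = 2)
    (hnp₁ : NoPseudoNull T R Y₁) (hnp₂ : NoPseudoNull T R Y₂)
    (hpd₁ : FiniteProjDim T R Y₁) (hpd₂ : FiniteProjDim T R Y₂) (hreg : RegularAlong T R M)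
    {s₁ s₂ s : T} (hs₁ : algebraMap T R s₁ ≠ 0) (hs₂ : algebraMap T R s₂ ≠ 0)
    (hs : algebraMap T R s ≠ 0) (hsY₁ : ∀ z : Y₁, s₁ • z = 0) (hsY₂ : ∀ z : Y₂, s₂ • z = 0)
    (hsM : ∀ z : M, s • z = 0) {N : ℕ} {c d : T} (hc : algebraMap T R c ≠ 0)
    (hd : algebraMap T R d ≠ 0)
    (hdiv : N • (divisor T Y₁ - (divisor T Y₂ - divisor T M)) =
      divisor T (T ⧸ Ideal.span {c}) - divisor T (T ⧸ Ideal.span {d})) :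
    N • (divisor R (R ⊗[T] Y₁) -
        (divisor R (R ⊗[T] Y₂) + divisor R (TorOne T R M) - divisor R (R ⊗[T] M))) =
      divisor R (R ⧸ Ideal.span {algebraMap T R c}) -
        divisor R (R ⧸ Ideal.span {algebraMap T R d}) := by
  have hc0 : c ≠ 0 := fun h => hc (by rw [h, map_zero])
  have hd0 : d ≠ 0 := fun h => hd (by rw [h, map_zero])
  have hne : ∀ {a : T}, algebraMap T R a ≠ 0 → a ≠ 0 := fun ha h => ha (by rw [h, map_zero])
  have hTorFin : Module.Finite R (TorOne T R M) := finite_torOne M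
  ext P
  simp only [Finsupp.smul_apply, Finsupp.sub_apply, Finsupp.add_apply, divisor_quotient_apply hc,
    divisor_quotient_apply hd, nsmul_eq_mul]
  rw [← localLength_specialization hclosure P (hQ P) hnp₁ hnp₂ hpd₁ hpd₂ hreg hs₁ hs₂ hs hsY₁ hsY₂
    hsM hc hd (N := N) fun q => ?_,
    divisor_apply (isTorsion_of_smul_eq_zero hs₁ (smul_tensor_eq_zero hsY₁)),
    divisor_apply (isTorsion_of_smul_eq_zero hs₂ (smul_tensor_eq_zero hsY₂)),
    divisor_apply (isTorsion_of_smul_eq_zero (X := R ⊗[T] M) hs (smul_tensor_eq_zero hsM)),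
    divisor_apply (isTorsion_of_smul_eq_zero (X := TorOne T R M) hs (smul_torOne_eq_zero M hsM))]
  · ring
  · have h := DFunLike.congr_fun hdiv q
    simp only [Finsupp.smul_apply, Finsupp.sub_apply, divisor_quotient_apply hc0,
      divisor_quotient_apply hd0, nsmul_eq_mul,
      divisor_apply (isTorsion_of_smul_eq_zero (hne hs₁) hsY₁),
      divisor_apply (isTorsion_of_smul_eq_zero (hne hs₂) hsY₂),
      divisor_apply (isTorsion_of_smul_eq_zero (hne hs) hsM)] at h
    rw [← h]
    ring

theorem divisor_specialization_gt_and_lt [IsLocalRing T] [Algebra.IsIntegral T R]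
    (hker : (RingHom.ker (algebraMap T R)).height = 1) (hclosure : IsIntegralClosureOfImage T R)
    (hQ : ∀ P : HeightOnePrime R, (P.1.asIdeal.comap (algebraMap T R)).height = 2)
    (hsupp₁ : kerPrime T R ∉ Module.support T Y₁) (hsupp₂ : kerPrime T R ∉ Module.support T Y₂)
    (hsuppM : kerPrime T R ∉ Module.support T M)
    (hnp₁ : NoPseudoNull T R Y₁) (hnp₂ : NoPseudoNull T R Y₂)
    (hpd₁ : FiniteProjDim T R Y₁) (hpd₂ : FiniteProjDim T R Y₂) (hreg : RegularAlong T R M)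
    (htors₁ : IsOfFinAddOrder (divisorClass T (divisor T Y₁)))
    (htors₂ : IsOfFinAddOrder (divisorClass T (divisor T Y₂ - divisor T M))) :
    (divisor T Y₁ > divisor T Y₂ - divisor T M →
      divisor R (R ⊗[T] Y₁) >
        divisor R (R ⊗[T] Y₂) + divisor R (TorOne T R M) - divisor R (R ⊗[T] M)) ∧
    (divisor T Y₁ < divisor T Y₂ - divisor T M →
      divisor R (R ⊗[T] Y₁) <
        divisor R (R ⊗[T] Y₂) + divisor R (TorOne T R M) - divisor R (R ⊗[T] M)) := by
  obtain ⟨s₁, hs₁, hsY₁⟩ := exists_smul_eq_zero_of_notMem_support hsupp₁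
  obtain ⟨s₂, hs₂, hsY₂⟩ := exists_smul_eq_zero_of_notMem_support hsupp₂
  obtain ⟨s, hs, hsM⟩ := exists_smul_eq_zero_of_notMem_support hsuppM
  have hne : ∀ {a : T}, algebraMap T R a ≠ 0 → a ≠ 0 := fun ha h => ha (by rw [h, map_zero])
  let k : HeightOnePrime T := ⟨kerPrime T R, hker⟩
  have hk₁ : divisor T Y₁ k = 0 := by
    rw [divisor_apply (isTorsion_of_smul_eq_zero (hne hs₁) hsY₁)]
    exact localLength_kerPrime_eq_zero hker hs₁ hsY₁
  have hk₂ : divisor T Y₂ k = 0 := by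
    rw [divisor_apply (isTorsion_of_smul_eq_zero (hne hs₂) hsY₂)]
    exact localLength_kerPrime_eq_zero hker hs₂ hsY₂
  have hkM : divisor T M k = 0 := by
    rw [divisor_apply (isTorsion_of_smul_eq_zero (hne hs) hsM)]
    exact localLength_kerPrime_eq_zero hker hs hsM
  have spec := fun (N : ℕ) (c d : T) (hc : algebraMap T R c ≠ 0) (hd : algebraMap T R d ≠ 0) =>
    nsmul_divisor_specialization hclosure hQ hnp₁ hnp₂ hpd₁ hpd₂ hreg hs₁ hs₂ hs hsY₁ hsY₂ hsM
      (N := N) hc hd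
  have hone : algebraMap T R 1 ≠ 0 := by simp
  constructor
  · intro h
    obtain ⟨N, hN, c, hc, hcu, hNc⟩ := exists_nsmul_eq_divisor
      (isOfFinAddOrder_divisorClass_sub htors₁ htors₂) (sub_pos.2 h)
    have hcR : algebraMap T R c ≠ 0 := algebraMap_ne_zero_of_divisor_eq hker hc (by
      rw [← hNc]
      simp [k, hk₁, hk₂, hkM])
    have h1 := spec N c 1 hcR hone (by rw [hNc, divisor_quotient_one, sub_zero])
    rw [map_one, divisor_quotient_one, sub_zero] at h1
    refine sub_pos.1 (pos_of_nsmul_pos_divisor (N := N) ?_)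
    rw [h1]
    exact divisor_quotient_pos hcR (not_isUnit_algebraMap hcu)
  · intro h
    obtain ⟨N, hN, c, hc, hcu, hNc⟩ := exists_nsmul_eq_divisor
      (isOfFinAddOrder_divisorClass_sub htors₂ htors₁) (sub_pos.2 h)
    have hcR : algebraMap T R c ≠ 0 := algebraMap_ne_zero_of_divisor_eq hker hc (by
      rw [← hNc]
      simp [k, hk₁, hk₂, hkM])
    -- For the reversed inequality `c` represents the opposite difference, so it takes the place of
    -- `d`.
    have h1 := spec N 1 c hone hcR (by
      rw [← hNc, divisor_quotient_one, zero_sub, ← smul_neg, neg_sub])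
    rw [map_one, divisor_quotient_one, zero_sub, ← neg_eq_iff_eq_neg, ← smul_neg, neg_sub] at h1
    refine sub_pos.1 (pos_of_nsmul_pos_divisor (N := N) ?_)
    rw [h1]
    exact divisor_quotient_pos hcR (not_isUnit_algebraMap hcu)

end Comparison

end Specialization

open Specialization in
theorem mainTheorem5
    (p : ℕ) [Fact p.Prime] (n : ℕ) (hn : 1 ≤ n)
    (T R : Type u) [CommRing T] [IsDomain T] [IsIntegrallyClosed T]
    [CommRing R] [IsDomain R] [IsIntegrallyClosed R]
    [Algebra (MvPowerSeries (Fin n) ℤ_[p]) T]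
    [Module.Finite (MvPowerSeries (Fin n) ℤ_[p]) T]
    (hT : Function.Injective (algebraMap (MvPowerSeries (Fin n) ℤ_[p]) T))
    [Algebra (MvPowerSeries (Fin (n - 1)) ℤ_[p]) R]
    [Module.Finite (MvPowerSeries (Fin (n - 1)) ℤ_[p]) R]
    (hR : Function.Injective (algebraMap (MvPowerSeries (Fin (n - 1)) ℤ_[p]) R))
    [Algebra T R]
    (hker : (RingHom.ker (algebraMap T R)).height = 1)
    (hclosure : IsIntegralClosureOfImage T R)
    (Y₁ Y₂ M : Type u) [AddCommGroup Y₁] [AddCommGroup Y₂] [AddCommGroup M]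
    [Module T Y₁] [Module T Y₂] [Module T M]
    [Module.Finite T Y₁] [Module.Finite T Y₂] [Module.Finite T M]
    (hY₁ : Module.IsTorsion T Y₁) (hY₂ : Module.IsTorsion T Y₂) (hM : Module.IsTorsion T M)
    (hsupp₁ : kerPrime T R ∉ Module.support T Y₁)
    (hsupp₂ : kerPrime T R ∉ Module.support T Y₂)
    (hsuppM : kerPrime T R ∉ Module.support T M)
    (hnp₁ : NoPseudoNull T R Y₁) (hnp₂ : NoPseudoNull T R Y₂)
    (hpd₁ : FiniteProjDim T R Y₁) (hpd₂ : FiniteProjDim T R Y₂)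
    (hreg : RegularAlong T R M)
    (htors₁ : IsOfFinAddOrder (divisorClass T (divisor T Y₁)))
    (htors₂ : IsOfFinAddOrder (divisorClass T (divisor T Y₂ - divisor T M))) :
    ((Module.Finite R (R ⊗[T] Y₁) ∧ Module.IsTorsion R (R ⊗[T] Y₁)) ∧
      (Module.Finite R (R ⊗[T] Y₂) ∧ Module.IsTorsion R (R ⊗[T] Y₂)) ∧
      (Module.Finite R (R ⊗[T] M) ∧ Module.IsTorsion R (R ⊗[T] M)) ∧
      (Module.Finite R (TorOne T R M) ∧ Module.IsTorsion R (TorOne T R M))) ∧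
    (divisor T Y₁ > divisor T Y₂ - divisor T M →
      divisor R (R ⊗[T] Y₁) >
        divisor R (R ⊗[T] Y₂) + divisor R (TorOne T R M) - divisor R (R ⊗[T] M)) ∧
    (divisor T Y₁ < divisor T Y₂ - divisor T M →
      divisor R (R ⊗[T] Y₁) <
        divisor R (R ⊗[T] Y₂) + divisor R (TorOne T R M) - divisor R (R ⊗[T] M)) := by
  have hTN : IsNoetherianRing T := IsNoetherianRing.of_finite (MvPowerSeries (Fin n) ℤ_[p]) T
  have hRN : IsNoetherianRing R := IsNoetherianRing.of_finite (MvPowerSeries (Fin (n - 1)) ℤ_[p]) R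
  have hint : Algebra.IsIntegral T R := hclosure.isIntegral
  have hTloc : IsLocalRing T :=
    (powersLiftToIdempotents_mvPowerSeries.{u} p n).isLocalRing T
  obtain ⟨s₁, hs₁, hsY₁⟩ := exists_smul_eq_zero_of_notMem_support hsupp₁
  obtain ⟨s₂, hs₂, hsY₂⟩ := exists_smul_eq_zero_of_notMem_support hsupp₂
  obtain ⟨s, hs, hsM⟩ := exists_smul_eq_zero_of_notMem_support hsuppM
  exact ⟨⟨⟨inferInstance, isTorsion_of_smul_eq_zero hs₁ (smul_tensor_eq_zero hsY₁)⟩,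
      ⟨inferInstance, isTorsion_of_smul_eq_zero hs₂ (smul_tensor_eq_zero hsY₂)⟩,
      ⟨inferInstance, isTorsion_of_smul_eq_zero hs (smul_tensor_eq_zero hsM)⟩,
      ⟨finite_torOne M, isTorsion_of_smul_eq_zero hs (smul_torOne_eq_zero M hsM)⟩⟩,
    divisor_specialization_gt_and_lt hker hclosure
      (fun P => height_comap_eq_two (p := p) hn hR hker P.1.asIdeal P.2)
      hsupp₁ hsupp₂ hsuppM hnp₁ hnp₂ hpd₁ hpd₂ hreg htors₁ htors₂⟩
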